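/- Let $m_1,m_2\ge 0$ be integers, $m=m_1+m_2$, $0<l<\infty$, and let $v$ be a measurable $m_1\times m_2$ matrix function with $\|v(x)\|\le M$ for $0<x<l$. Let $u(x,z)$ be the fundamental solution, normalized by $u(0,z)=I_m$ and absolutely continuous in $x$, of the skew-self-adjoint Dirac system $$\frac{d}{dx}u(x,z)=\big(\mathrm{i}zj+jV(x)\big)u(x,z),\qquad j=\begin{bmatrix}I_{m_1}&0\\0&-I_{m_2}\end{bmatrix},\quad V=\begin{bmatrix}0&v\\v^*&0\end{bmatrix}\qquad(0\le x\le l),$$ and put $\beta(x)=\begin{bmatrix}I_{m_1}&0\end{bmatrix}u(x,0)$, $\gamma(x)=\begin{bmatrix}0&I_{m_2}\end{bmatrix}u(x,0)=\begin{bmatrix}\gamma_1(x)&\gamma_2(x)\end{bmatrix}$, where $\gamma_k$ has $m_k$ columns. Call a bounded and boundedly invertible operator $E$ on $L^2_{m_2}(0,l)$ a normalized similarity operator for $\gamma$ if * $K=EAE^{-1}$, where $(Af)(x)=-\mathrm{i}\int_0^xf(t)\,dt$ and $(Kf)(x)=-\mathrm{i}\,\gamma(x)\int_0^x\gamma(t)^*f(t)\,dt$;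 * $E$ has the triangular form $(Ef)(x)=\rho(x)f(x)+\int_0^xE(x,t)f(t)\,dt$ with a bounded measurable kernel $E(x,t)$ and an absolutely continuous $\rho$ such that $\rho'=\gamma'\gamma^*\rho$ almost everywhere and $\det\rho(0)\ne0$; * $E^{-1}\gamma_2\equiv I_{m_2}$ ($E^{-1}$ is applied columnwise). Such an operator $E$ exists. For every such $E$ put $S=E^{-1}(E^*)^{-1}$ and let $S_x=P_xSP_x^*$, where $P_x$ is the restriction map from $L^2_{m_2}(0,l)$ onto $L^2_{m_2}(0,x)$. Then the matrix function $\Phi_1:=E^{-1}\gamma_1$ (columnwise) is boundedly differentiable on $[0,l]$, that is, it has an absolutely continuous representative with bounded derivative; for every $x\in[0,l]$ the operator $S_x$ is boundedly invertible; and $$\beta(x)=\begin{bmatrix}I_{m_1}&0\end{bmatrix}-\int_0^x\big(S_x^{-1}\Phi_1'\big)(t)^*\begin{bmatrix}\Phi_1(t)&I_{m_2}\end{bmatrix}dt,\qquad 0\le x\le l,$$ where $S_x^{-1}$ is applied columnwise and the integrand is integrable. -/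

import Mathlib

open MeasureTheory Set
open scoped Matrix Matrix.Norms.L2Operator

noncomputable section

namespace SkewDirac

/-! ### The Dirac system `y' = (i z j + j V) y` on `[0, l]` -/

/-- `j = diag (I, -I)`. -/
def jMat (m₁ m₂ : ℕ) : Matrix (Fin m₁ ⊕ Fin m₂) (Fin m₁ ⊕ Fin m₂) ℂ :=
  Matrix.fromBlocks 1 0 0 (-1)

/-- `V = [[0, v], [v*, 0]]`. -/
def vMat {m₁ m₂ : ℕ} (v : Matrix (Fin m₁) (Fin m₂) ℂ) :
    Matrix (Fin m₁ ⊕ Fin m₂) (Fin m₁ ⊕ Fin m₂) ℂ :=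
  Matrix.fromBlocks 0 v vᴴ 0

/-- `u(x, z)` is the fundamental solution on `[0, l]` of the Dirac system with potential `v`,
normalized by `u(0, z) = I`: it is absolutely continuous in `x` and satisfies the system
almost everywhere. -/
structure IsFundamentalSolution {m₁ m₂ : ℕ} (l : ℝ) (v : ℝ → Matrix (Fin m₁) (Fin m₂) ℂ)
    (u : ℝ → ℂ → Matrix (Fin m₁ ⊕ Fin m₂) (Fin m₁ ⊕ Fin m₂) ℂ) : Prop where
  absCont : ∀ z : ℂ, AbsolutelyContinuousOnInterval (fun x => u x z) 0 l
  initial : ∀ z : ℂ, u 0 z = 1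
  ode : ∀ z : ℂ, ∀ᵐ x ∂(volume.restrict (Ioo 0 l)),
    HasDerivAt (fun x => u x z)
      (((Complex.I * z) • jMat m₁ m₂ + jMat m₁ m₂ * vMat (v x)) * u x z) x

/-- `β(x) = [I 0] u(x, 0)`. -/
def beta {m₁ m₂ : ℕ} (u : ℝ → ℂ → Matrix (Fin m₁ ⊕ Fin m₂) (Fin m₁ ⊕ Fin m₂) ℂ) (x : ℝ) :
    Matrix (Fin m₁) (Fin m₁ ⊕ Fin m₂) ℂ :=
  Matrix.fromCols 1 0 * u x 0

/-- `γ(x) = [0 I] u(x, 0)`. -/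
def gamma {m₁ m₂ : ℕ} (u : ℝ → ℂ → Matrix (Fin m₁ ⊕ Fin m₂) (Fin m₁ ⊕ Fin m₂) ℂ) (x : ℝ) :
    Matrix (Fin m₂) (Fin m₁ ⊕ Fin m₂) ℂ :=
  Matrix.fromCols 0 1 * u x 0

/-- `f` is boundedly differentiable on `[0, l]`: absolutely continuous with bounded derivative.
(`deriv` is `0` at points where there is no derivative; by absolute continuity these form a
null set, so the bound is a bound on the derivative wherever it exists.) -/
def BoundedlyDifferentiableOn {p q : ℕ} (f : ℝ → Matrix (Fin p) (Fin q) ℂ) (l : ℝ) : Prop :=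
  AbsolutelyContinuousOnInterval f 0 l ∧ ∃ C : ℝ, ∀ x ∈ Ioo 0 l, ‖deriv f x‖ ≤ C

/-! ### Operators in `L²` -/

/-- The Hilbert space `L²_n(0, l)` of `ℂⁿ`-valued functions. -/
abbrev L2 (n : ℕ) (l : ℝ) : Type :=
  Lp (EuclideanSpace ℂ (Fin n)) 2 (volume.restrict (Ioo (0 : ℝ) l))

/-- The Hilbert space `L²_n(0, x)` for `0 ≤ x ≤ l` (in this range `(0, x) ⊆ (0, l)`, so the
iterated restriction of Lebesgue measure is the Lebesgue measure on `(0, x)`). -/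
abbrev L2Sub (n : ℕ) (l x : ℝ) : Type :=
  Lp (EuclideanSpace ℂ (Fin n)) 2 ((volume.restrict (Ioo (0 : ℝ) l)).restrict (Ioo (0 : ℝ) x))

/-- The `k`-th column of the matrix function `Ψ`, as an element of `L²(μ)` (for `Ψ` with
square integrable columns). -/
def column {p q : ℕ} (μ : Measure ℝ) (Ψ : ℝ → Matrix (Fin p) (Fin q) ℂ) (k : Fin q) :
    Lp (EuclideanSpace ℂ (Fin p)) 2 μ :=
  open Classical in
  if h : MemLp (fun t => (WithLp.toLp 2 (fun i => Ψ t i k) : EuclideanSpace ℂ (Fin p))) 2 μ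
  then h.toLp _ else 0

/-- An operator `T` on `L²(μ)` applied columnwise to a matrix function: `t ↦ (T Ψ)(t)`. -/
def applyColumns {p q : ℕ} {μ : Measure ℝ}
    (T : Lp (EuclideanSpace ℂ (Fin p)) 2 μ →L[ℂ] Lp (EuclideanSpace ℂ (Fin p)) 2 μ)
    (Ψ : ℝ → Matrix (Fin p) (Fin q) ℂ) (t : ℝ) : Matrix (Fin p) (Fin q) ℂ :=
  Matrix.of fun i k => (T (column μ Ψ k) : ℝ → EuclideanSpace ℂ (Fin p)) t i

/-- `A` is the operator `(A f)(x) = -i ∫₀ˣ f(t) dt` in `L²_n(0, l)`. -/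
def IsIntegration {n : ℕ} {l : ℝ} (A : L2 n l →L[ℂ] L2 n l) : Prop :=
  ∀ f : L2 n l, ∀ᵐ x ∂(volume.restrict (Ioo 0 l)),
    A f x = (-Complex.I) • ∫ t in (0 : ℝ)..x, f t

/-- `K` is the operator `(K f)(x) = ∫₀ˣ F(x) G(t) f(t) dt` in `L²_n(0, l)`. -/
def IsVolterra {n : ℕ} {ι : Type} [Fintype ι] {l : ℝ} (F : ℝ → Matrix (Fin n) ι ℂ)
    (G : ℝ → Matrix ι (Fin n) ℂ) (K : L2 n l →L[ℂ] L2 n l) : Prop :=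
  ∀ f : L2 n l, ∀ᵐ x ∂(volume.restrict (Ioo 0 l)),
    K f x = ∫ t in (0 : ℝ)..x, Matrix.toEuclideanCLM (𝕜 := ℂ) (F x * G t) (f t)

/-- `E` is a similarity operator for `K = ∫₀ˣ F(x) G(t) · dt`: a boundedly invertible operator
with `K = E A E⁻¹`, of the triangular form `(E f)(x) = ρ(x) f(x) + ∫₀ˣ E(x, t) f(t) dt` with a
bounded kernel, where `ρ' = i F' G ρ` and `det ρ(0) ≠ 0`. -/
structure IsSimilarity {n : ℕ} {ι : Type} [Fintype ι] [DecidableEq ι] {l : ℝ}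
    (F : ℝ → Matrix (Fin n) ι ℂ) (G : ℝ → Matrix ι (Fin n) ℂ)
    (E : L2 n l ≃L[ℂ] L2 n l) : Prop where
  similar : ∃ A K : L2 n l →L[ℂ] L2 n l, IsIntegration A ∧ IsVolterra F G K ∧
    K = (E : L2 n l →L[ℂ] L2 n l) ∘L A ∘L (E.symm : L2 n l →L[ℂ] L2 n l)
  triangular : ∃ (ρ : ℝ → Matrix (Fin n) (Fin n) ℂ) (k : ℝ → ℝ → Matrix (Fin n) (Fin n) ℂ),
    AbsolutelyContinuousOnInterval ρ 0 l ∧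
    (∀ᵐ x ∂(volume.restrict (Ioo 0 l)),
      HasDerivAt ρ (Complex.I • (deriv F x * G x * ρ x)) x) ∧
    (ρ 0).det ≠ 0 ∧
    StronglyMeasurable (fun p : ℝ × ℝ => k p.1 p.2) ∧
    (∃ C : ℝ, ∀ x t, ‖k x t‖ ≤ C) ∧
    ∀ f : L2 n l, ∀ᵐ x ∂(volume.restrict (Ioo 0 l)),
      E f x = Matrix.toEuclideanCLM (𝕜 := ℂ) (ρ x) (f x) +
        ∫ t in (0 : ℝ)..x, Matrix.toEuclideanCLM (𝕜 := ℂ) (k x t) (f t)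

/-- For `γ = [γ₁ γ₂]`: `E` is a similarity operator for `K = ∫₀ˣ F(x) G(t) · dt` with `F = γ`,
`G = -i γ*`, normalized by `E⁻¹ γ₂ ≡ I`. -/
structure IsNormalizedSimilarity {m₁ m₂ : ℕ} {l : ℝ}
    (γ : ℝ → Matrix (Fin m₂) (Fin m₁ ⊕ Fin m₂) ℂ) (E : L2 m₂ l ≃L[ℂ] L2 m₂ l) : Prop where
  isSimilarity : IsSimilarity γ (fun t => (-Complex.I) • (γ t)ᴴ) E
  normalized : ∀ᵐ x ∂(volume.restrict (Ioo 0 l)),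
    applyColumns (E.symm : L2 m₂ l →L[ℂ] L2 m₂ l) (fun t => (γ t).toCols₂) x = 1

/-- `Φ₁` is the boundedly differentiable matrix function `E⁻¹ γ₁` on `[0, l]`. -/
structure IsPhiOne {m₁ m₂ : ℕ} {l : ℝ} (γ : ℝ → Matrix (Fin m₂) (Fin m₁ ⊕ Fin m₂) ℂ)
    (E : L2 m₂ l ≃L[ℂ] L2 m₂ l) (Φ₁ : ℝ → Matrix (Fin m₂) (Fin m₁) ℂ) : Prop where
  eq_ae : ∀ᵐ x ∂(volume.restrict (Ioo 0 l)),
    Φ₁ x = applyColumns (E.symm : L2 m₂ l →L[ℂ] L2 m₂ l) (fun t => (γ t).toCols₁) x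
  boundedlyDifferentiable : BoundedlyDifferentiableOn Φ₁ l

/-- `S = E⁻¹ (E*)⁻¹`, written with `(E*)⁻¹ = (E⁻¹)*`. -/
def opS {n : ℕ} {l : ℝ} (E : L2 n l ≃L[ℂ] L2 n l) : L2 n l →L[ℂ] L2 n l :=
  (E.symm : L2 n l →L[ℂ] L2 n l) ∘L
    ContinuousLinearMap.adjoint (E.symm : L2 n l →L[ℂ] L2 n l)

/-- The projection `P_x` from `L²_n(0, l)` onto `L²_n(0, x)`: `(P_x f)(t) = f(t)`, `0 < t < x`. -/
def opP (n : ℕ) (l x : ℝ) : L2 n l →L[ℂ] L2Sub n l x :=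
  LpToLpRestrictCLM ℝ (EuclideanSpace ℂ (Fin n)) ℂ (volume.restrict (Ioo (0 : ℝ) l)) 2 (Ioo 0 x)

/-- `S_x = P_x S P_x*`. -/
def opSx {n : ℕ} {l : ℝ} (S : L2 n l →L[ℂ] L2 n l) (x : ℝ) : L2Sub n l x →L[ℂ] L2Sub n l x :=
  opP n l x ∘L S ∘L ContinuousLinearMap.adjoint (opP n l x)

end SkewDirac

end

open SkewDirac

set_option linter.unusedSectionVars false

namespace SkewDirac

/-! ### Measurability and Fubini on triangles -/

section Fubini

variable {E F : Type*} [NormedAddCommGroup E] [NormedSpace ℝ E]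
  [NormedAddCommGroup F] [NormedSpace ℝ F]

/-! Write J for integration from 0, w = v*, and L = γ J γ*, so that A = -iJ and K = -iL. At z = 0
the system reads β' = vγ, γ' = -wβ, and its coefficient jV is skew-Hermitian, so u(x,0) is unitary:
γγ* = I and βγ* = 0. The product rule then gives β J γ* = J v L and L = J - J w β J γ*, hence (1 + J
w J v) L = J. The operator 1 + J w J v is injective by Gronwall, so identities between functions are
proved by checking that both sides solve the same Volterra equation
(`IsDiracPair.ae_eq_of_volterra_eq`).

Existence of E. Take E = 1 + N, where N has the kernel ε(x - t, t) and ε, π solve a Goursat problem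
(`exists_isGoursatSolution`). Its integrated equations say, for the operator Π with kernel π(x - t,
t), that Π = J v E and N(a + Jg) = J(Ng - wΠ(a + Jg)) for a constant a. Together: (1 + J w J v) E(a
+ Jg) = a + J E g. With a = 0, injectivity gives EJ = LE, that is EA = KE; with g = 0 it shows that
E sends the constant columns of I to those of γ₂. N is quasinilpotent, so E is invertible.

Recovery of β from any normalized E. Since γ'γ* = -wβγ* = 0, ρ is constant and invertible. Hence E
and, by Gronwall, E⁻¹ are causal: both preserve ker P_x. As γ₁(0) = 0 and β₁(0) = I for the first
block column β₁ of β, one finds γ₁ = -L v*, so E⁻¹γ₁ = -J E⁻¹v*. This is Lipschitz because E⁻¹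
preserves boundedness, and Φ₁' = -E⁻¹v*. Causality makes P_x E* P_x* P_x E P_x* the inverse of S_x
(`isUnit_compression`), and S_x⁻¹ P_x Φ₁' = -P_x E* P_x* P_x v*. Pairing with [Φ₁ I] = E⁻¹γ moves E*
across the inner product (`inner_compression`) and leaves -∫₀ˣ vγ = β(0) - β(x). -/

theorem stronglyMeasurable_intervalIntegral {α : Type*} [MeasurableSpace α] {f : α → ℝ → E}
    (hf : StronglyMeasurable (Function.uncurry f)) {a b : α → ℝ} (ha : Measurable a)
    (hb : Measurable b) : StronglyMeasurable fun p => ∫ t in a p..b p, f p t := by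
  have key : ∀ {a b : α → ℝ}, Measurable a → Measurable b →
      StronglyMeasurable fun p => ∫ t in Ioc (a p) (b p), f p t := by
    intro a b ha hb
    -- The variable limits are absorbed into an indicator on the product, leaving an integral
    -- against a fixed measure.
    have hS : MeasurableSet {q : α × ℝ | a q.1 < q.2 ∧ q.2 ≤ b q.1} :=
      (measurableSet_lt (ha.comp measurable_fst) measurable_snd).inter
        (measurableSet_le measurable_snd (hb.comp measurable_fst))
    have h := (hf.indicator hS).integral_prod_right' (ν := volume)
    convert! h using 2 with p
    rw [← integral_indicator measurableSet_Ioc]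
    rfl
  exact (key ha hb).sub (key hb ha)

theorem intervalIntegral_triangle_swap {f : ℝ → ℝ → E} {h₁ h₂ : ℝ → ℝ} {x : ℝ} (hx : 0 ≤ x)
    (hf : AEStronglyMeasurable (Function.uncurry f)
      ((volume.restrict (Ioc 0 x)).prod (volume.restrict (Ioc 0 x))))
    (hh₁ : IntegrableOn h₁ (Ioc 0 x)) (hh₂ : IntegrableOn h₂ (Ioc 0 x))
    (hb : ∀ s ∈ Ioc 0 x, ∀ t ∈ Ioc 0 s, ‖f s t‖ ≤ h₁ s * h₂ t) :
    ∫ s in (0 : ℝ)..x, ∫ t in (0 : ℝ)..s, f s t = ∫ t in (0 : ℝ)..x, ∫ s in t..x, f s t := by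
  set μ := volume.restrict (Ioc 0 x) with hμ
  -- The domination is assumed only on the triangle t ≤ s, so `f` is cut off there before Fubini is
  -- applied on the square.
  let G : ℝ → ℝ → E := fun s t => if t ≤ s then f s t else 0
  have hS : MeasurableSet {q : ℝ × ℝ | q.2 ≤ q.1} := measurableSet_le measurable_snd measurable_fst
  have hG : Integrable (Function.uncurry G) (μ.prod μ) := by
    refine (hh₁.mul_prod hh₂).norm.mono' (hf.indicator hS) ?_
    rw [Measure.prod_restrict, ae_restrict_iff' (measurableSet_Ioc.prod measurableSet_Ioc)]
    refine Filter.Eventually.of_forall fun q hq => ?_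
    by_cases hle : q.2 ≤ q.1
    · simp only [G, Function.uncurry_def, hle, if_true]
      exact (hb q.1 hq.1 q.2 ⟨hq.2.1, hle⟩).trans (le_abs_self _)
    · simp [G, Function.uncurry_def, hle, mul_nonneg, abs_nonneg]
  have hswap := integral_integral_swap hG
  rw [intervalIntegral.integral_of_le hx, intervalIntegral.integral_of_le hx]
  convert hswap using 1
  · refine setIntegral_congr_fun measurableSet_Ioc fun s hs => ?_
    simp only [intervalIntegral.integral_of_le hs.1.le, G]
    have : (fun t => if t ≤ s then f s t else 0) = (Iic s).indicator (f s) := by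
      funext t; simp [indicator]
    rw [this, integral_indicator measurableSet_Iic, hμ, Measure.restrict_restrict measurableSet_Iic]
    congr 2
    ext t; simp only [mem_Ioc, mem_inter_iff, mem_Iic]; have := hs.2; grind
  · refine setIntegral_congr_fun measurableSet_Ioc fun t ht => ?_
    simp only [intervalIntegral.integral_of_le ht.2, G]
    have : (fun s => if t ≤ s then f s t else 0) = (Ici t).indicator (fun s => f s t) := by
      funext s; simp [indicator]
    -- The cut-off leaves the closed interval from t to x; its left endpoint is a null set.
    rw [this, integral_indicator measurableSet_Ici, hμ, Measure.restrict_restrict measurableSet_Ici,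
      ← integral_Icc_eq_integral_Ioc]
    congr 2
    ext s; simp only [mem_Icc, mem_inter_iff, mem_Ici, mem_Ioc]; have := ht.1; grind

/-- The triangle r + t ≤ x is sliced along the lines r + t = s. This converts integrals in the
Goursat coordinates (r, t) into integrals over s of a Volterra integral with kernel evaluated at (s
- t, t). -/
theorem intervalIntegral_shear {f : ℝ → ℝ → E} {h : ℝ → ℝ} {x : ℝ} (hx : 0 ≤ x)
    (hf : StronglyMeasurable (Function.uncurry f)) (hh : IntegrableOn h (Ioc 0 x))
    (hb : ∀ r ∈ Icc 0 x, ∀ t ∈ Icc 0 x, ‖f r t‖ ≤ h t) :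
    ∫ t in (0 : ℝ)..x, ∫ r in (0 : ℝ)..(x - t), f r t =
      ∫ s in (0 : ℝ)..x, ∫ t in (0 : ℝ)..s, f (s - t) t := by
  have h1 : IntegrableOn (fun _ : ℝ => (1 : ℝ)) (Ioc 0 x) := by simp
  rw [intervalIntegral_triangle_swap hx (h₁ := fun _ => 1) (h₂ := h) _ h1 hh]
  · refine intervalIntegral.integral_congr fun t _ => ?_
    simp only [intervalIntegral.integral_comp_sub_right (fun r => f r t), sub_self]
  · intro s hs t ht
    simpa using hb (s - t) ⟨by linarith [ht.2], by linarith [ht.1, hs.2]⟩ t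
      ⟨ht.1.le, ht.2.trans hs.2⟩
  · exact (hf.comp_measurable
      ((measurable_fst.sub measurable_snd).prodMk measurable_snd)).aestronglyMeasurable

/-- The substitution r = x - s puts the left side in triangular form; swapping the order then gives
the left side of `intervalIntegral_shear`. -/
theorem intervalIntegral_shear' {f : ℝ → ℝ → E} {h : ℝ → ℝ} {x : ℝ} (hx : 0 ≤ x)
    (hf : StronglyMeasurable (Function.uncurry f)) (hh : IntegrableOn h (Ioc 0 x))
    (hb : ∀ r ∈ Icc 0 x, ∀ t ∈ Icc 0 x, ‖f r t‖ ≤ h t) :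
    ∫ r in (0 : ℝ)..x, ∫ t in (0 : ℝ)..(x - r), f r t =
      ∫ s in (0 : ℝ)..x, ∫ t in (0 : ℝ)..s, f (s - t) t := by
  have h1 : IntegrableOn (fun _ : ℝ => (1 : ℝ)) (Ioc 0 x) := by simp
  have hL : ∫ r in (0 : ℝ)..x, ∫ t in (0 : ℝ)..(x - r), f r t =
      ∫ s in (0 : ℝ)..x, ∫ t in (0 : ℝ)..s, f (x - s) t := by
    have := intervalIntegral.integral_comp_sub_left
      (fun s => ∫ t in (0 : ℝ)..s, f (x - s) t) x (a := 0) (b := x)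
    simpa using this
  rw [hL, ← intervalIntegral_shear hx hf hh hb,
    intervalIntegral_triangle_swap hx (h₁ := fun _ => 1) (h₂ := h) _ h1 hh]
  · refine intervalIntegral.integral_congr fun t _ => ?_
    simp only [intervalIntegral.integral_comp_sub_left (fun r => f r t), sub_self]
  · intro s hs t ht
    simpa using hb (x - s) ⟨by linarith [hs.2], by linarith [hs.1]⟩ t ⟨ht.1.le, ht.2.trans hs.2⟩
  · exact (hf.comp_measurable
      ((measurable_const.sub measurable_fst).prodMk measurable_snd)).aestronglyMeasurable

end Fubini

/-! ### Product rule for primitives -/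

section Product

variable {E F : Type*} [NormedAddCommGroup E] [NormedSpace ℂ E] [CompleteSpace E]
  [NormedAddCommGroup F] [NormedSpace ℂ F] [CompleteSpace F]

/-- The product of two primitives is a double integral over a square, and the two summands are its
two triangles. Fubini thus replaces differentiation, and integrability of both factors is enough. -/
theorem intervalIntegral_clm_apply_intervalIntegral {a : ℝ → E →L[ℂ] F} {g : ℝ → E} {x : ℝ}
    (hx : 0 ≤ x) (ha : IntegrableOn a (Ioc 0 x)) (hg : IntegrableOn g (Ioc 0 x)) :
    (∫ t in (0 : ℝ)..x, a t) (∫ t in (0 : ℝ)..x, g t) =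
      ∫ y in (0 : ℝ)..x,
        (a y (∫ t in (0 : ℝ)..y, g t) + (∫ t in (0 : ℝ)..y, a t) (g y)) := by
  have hga : IntervalIntegrable g volume 0 x := (intervalIntegrable_iff_integrableOn_Ioc_of_le hx).2 hg
  have haa : IntervalIntegrable a volume 0 x := (intervalIntegrable_iff_integrableOn_Ioc_of_le hx).2 ha
  have sub : ∀ {y z}, y ∈ Icc 0 x → z ∈ Icc 0 x → uIcc y z ⊆ uIcc 0 x := fun hy hz =>
    uIcc_subset_uIcc (by simpa [uIcc_of_le hx] using hy) (by simpa [uIcc_of_le hx] using hz)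
  have hGc : ContinuousOn (fun y => ∫ t in (0 : ℝ)..y, g t) (uIcc 0 x) :=
    intervalIntegral.continuousOn_primitive_interval' hga (by simp)
  have hAc : ContinuousOn (fun y => ∫ t in (0 : ℝ)..y, a t) (uIcc 0 x) :=
    intervalIntegral.continuousOn_primitive_interval' haa (by simp)
  obtain ⟨CG, hCG⟩ := isCompact_uIcc.exists_bound_of_continuousOn hGc
  obtain ⟨CA, hCA⟩ := isCompact_uIcc.exists_bound_of_continuousOn hAc
  have hsub : Ioc 0 x ⊆ uIcc 0 x := by rw [uIcc_of_le hx]; exact Ioc_subset_Icc_self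
  have happ : Continuous fun q : (E →L[ℂ] F) × E => q.1 q.2 :=
    isBoundedBilinearMap_apply.continuous
  have hi1 : IntegrableOn (fun y => a y (∫ t in (0 : ℝ)..y, g t)) (Ioc 0 x) := by
    refine (ha.norm.mul_const CG).mono' (happ.comp_aestronglyMeasurable
      (ha.aestronglyMeasurable.prodMk
        ((hGc.mono hsub).aestronglyMeasurable measurableSet_Ioc))) ?_
    rw [ae_restrict_iff' measurableSet_Ioc]
    refine Filter.Eventually.of_forall fun y hy => ?_
    exact (ContinuousLinearMap.le_opNorm _ _).trans
      (mul_le_mul_of_nonneg_left (hCG y (hsub hy)) (norm_nonneg _))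
  have hi2 : IntegrableOn (fun y => (∫ t in (0 : ℝ)..y, a t) (g y)) (Ioc 0 x) := by
    refine (hg.norm.const_mul CA).mono' (happ.comp_aestronglyMeasurable
      (((hAc.mono hsub).aestronglyMeasurable measurableSet_Ioc).prodMk
        hg.aestronglyMeasurable)) ?_
    rw [ae_restrict_iff' measurableSet_Ioc]
    refine Filter.Eventually.of_forall fun y hy => ?_
    exact (ContinuousLinearMap.le_opNorm _ _).trans
      (mul_le_mul_of_nonneg_right (hCA y (hsub hy)) (norm_nonneg _))
  have hmeas : AEStronglyMeasurable (Function.uncurry fun s t => a t (g s))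
      ((volume.restrict (Ioc 0 x)).prod (volume.restrict (Ioc 0 x))) :=
    happ.comp_aestronglyMeasurable
      (ha.aestronglyMeasurable.comp_snd.prodMk hg.aestronglyMeasurable.comp_fst)
  have hswap := intervalIntegral_triangle_swap (f := fun s t => a t (g s)) hx hmeas hg.norm ha.norm
    (fun s _ t _ => by rw [mul_comm]; exact ContinuousLinearMap.le_opNorm _ _)
  have e1 : ∫ y in (0 : ℝ)..x, (∫ t in (0 : ℝ)..y, a t) (g y) =
      ∫ s in (0 : ℝ)..x, ∫ t in (0 : ℝ)..s, a t (g s) := by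
    refine intervalIntegral.integral_congr fun y hy => ?_
    rw [uIcc_of_le hx] at hy
    exact ContinuousLinearMap.intervalIntegral_apply
      (haa.mono_set (sub ⟨le_rfl, hx⟩ hy)) _
  have e2 : ∀ t ∈ uIcc 0 x, ∫ s in t..x, a t (g s) =
      a t (∫ s in (0 : ℝ)..x, g s) - a t (∫ s in (0 : ℝ)..t, g s) := by
    intro t ht
    rw [uIcc_of_le hx] at ht
    have i1 := hga.mono_set (sub ⟨le_rfl, hx⟩ ht)
    have i2 := hga.mono_set (sub ht ⟨hx, le_rfl⟩)
    rw [ContinuousLinearMap.intervalIntegral_comp_comm _ i2, ← map_sub,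
      ← intervalIntegral.integral_add_adjacent_intervals i1 i2, add_sub_cancel_left]
  rw [intervalIntegral.integral_add
    ((intervalIntegrable_iff_integrableOn_Ioc_of_le hx).2 hi1)
    ((intervalIntegrable_iff_integrableOn_Ioc_of_le hx).2 hi2), e1, hswap,
    intervalIntegral.integral_congr e2, intervalIntegral.integral_sub,
    ContinuousLinearMap.intervalIntegral_apply haa]
  · abel
  · exact (intervalIntegrable_iff_integrableOn_Ioc_of_le hx).2
      ((ContinuousLinearMap.apply ℂ F (∫ s in (0 : ℝ)..x, g s)).integrable_comp ha)
  · exact (intervalIntegrable_iff_integrableOn_Ioc_of_le hx).2 hi1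

end Product

/-! ### Gronwall's inequality in integrated form -/

section Gronwall

/-- Each substitution of the bound into the inequality integrates a power of y once more, which
produces the factorial. The primitive of `h` is estimated because `h` itself is controlled only
almost everywhere. -/
theorem intervalIntegral_le_pow_div_factorial {h : ℝ → ℝ} {C x : ℝ} (hC : 0 ≤ C)
    (hh : IntegrableOn h (Ioc 0 x)) (h0 : ∀ᵐ y ∂volume.restrict (Ioc 0 x), 0 ≤ h y)
    (hle : ∀ᵐ y ∂volume.restrict (Ioc 0 x), h y ≤ C * ∫ t in (0 : ℝ)..y, h t) (n : ℕ) :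
    ∀ y ∈ Icc 0 x, ∫ t in (0 : ℝ)..y, h t ≤
      (∫ t in (0 : ℝ)..x, h t) * ((C * y) ^ n / n.factorial) := by
  intro y hy
  have hx : 0 ≤ x := hy.1.trans hy.2
  have hi := (intervalIntegrable_iff_integrableOn_Ioc_of_le hx).2 hh
  have sub : ∀ {y}, y ∈ Icc 0 x → uIcc 0 y ⊆ uIcc 0 x := fun hy =>
    uIcc_subset_uIcc (by simp) (by simpa [uIcc_of_le hx] using hy)
  induction n generalizing y with
  | zero =>
    simp only [pow_zero, Nat.factorial_zero, Nat.cast_one, div_one, mul_one]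
    exact intervalIntegral.integral_mono_interval le_rfl hy.1 hy.2 h0 hi
  | succ n ih =>
    have hA : 0 ≤ ∫ t in (0 : ℝ)..x, h t := by
      rw [intervalIntegral.integral_of_le hx]; exact integral_nonneg_of_ae h0
    calc ∫ t in (0 : ℝ)..y, h t
        ≤ ∫ t in (0 : ℝ)..y, C * ((∫ t in (0 : ℝ)..x, h t) * ((C * t) ^ n / n.factorial)) := by
          refine intervalIntegral.integral_mono_ae_restrict hy.1 (hi.mono_set (sub hy))
            (Continuous.intervalIntegrable (by fun_prop) _ _) ?_
          rw [restrict_Ioc_eq_restrict_Icc.symm] 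
          have := ae_restrict_of_ae_restrict_of_subset (Ioc_subset_Ioc_right hy.2) hle
          filter_upwards [this, ae_restrict_mem measurableSet_Ioc] with t ht ht'
          exact ht.trans (mul_le_mul_of_nonneg_left
            (ih t ⟨ht'.1.le, ht'.2.trans hy.2⟩) hC)
      _ = (∫ t in (0 : ℝ)..x, h t) * ((C * y) ^ (n + 1) / (n + 1).factorial) := by
          have : ∀ t, C * ((∫ t in (0 : ℝ)..x, h t) * ((C * t) ^ n / n.factorial)) =
              (C ^ (n + 1) * (∫ t in (0 : ℝ)..x, h t) / n.factorial) * t ^ n := by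
            intro t; rw [mul_pow]; ring
          simp only [this]
          rw [intervalIntegral.integral_const_mul, integral_pow, Nat.factorial_succ]
          push_cast
          have : (n.factorial : ℝ) ≠ 0 := by positivity
          field_simp
          ring

theorem ae_eq_zero_of_le_intervalIntegral {h : ℝ → ℝ} {C x : ℝ} (hC : 0 ≤ C)
    (hh : IntegrableOn h (Ioc 0 x)) (h0 : ∀ᵐ y ∂volume.restrict (Ioc 0 x), 0 ≤ h y)
    (hle : ∀ᵐ y ∂volume.restrict (Ioc 0 x), h y ≤ C * ∫ t in (0 : ℝ)..y, h t) :
    ∀ᵐ y ∂volume.restrict (Ioc 0 x), h y = 0 := by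
  have key : ∀ y ∈ Icc 0 x, ∫ t in (0 : ℝ)..y, h t ≤ 0 := by
    intro y hy
    have lim := (FloorSemiring.tendsto_pow_div_factorial_atTop (C * y)).const_mul
      (∫ t in (0 : ℝ)..x, h t)
    rw [mul_zero] at lim
    exact ge_of_tendsto' lim fun n => intervalIntegral_le_pow_div_factorial hC hh h0 hle n y hy
  filter_upwards [h0, hle, ae_restrict_mem measurableSet_Ioc] with y hy hy' hmem
  exact le_antisymm (hy'.trans (mul_nonpos_of_nonneg_of_nonpos hC
    (key y (Ioc_subset_Icc_self hmem)))) hy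

end Gronwall

/-! ### The Goursat problem by Picard iteration -/

section Goursat

variable {H₁ H₂ : Type*} [NormedAddCommGroup H₁] [NormedSpace ℂ H₁]
  [NormedAddCommGroup H₂] [NormedSpace ℂ H₂]

/-- The integrated Goursat problem `∂ᵣ π = v(t + r) ε`, `∂ₜ ε = -w(t + r) π` on `[0, l]²` with
data `π(0, t) = v(t)`, `ε(r, 0) = 0`. -/
structure IsGoursatSolution (l : ℝ) (v : ℝ → H₂ →L[ℂ] H₁) (w : ℝ → H₁ →L[ℂ] H₂)
    (ε : ℝ → ℝ → H₂ →L[ℂ] H₂) (π : ℝ → ℝ → H₂ →L[ℂ] H₁) : Prop where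
  measurable_ε : StronglyMeasurable (Function.uncurry ε)
  measurable_π : StronglyMeasurable (Function.uncurry π)
  bounded_ε : ∃ C, ∀ r t, ‖ε r t‖ ≤ C
  bounded_π : ∃ C, ∀ r t, ‖π r t‖ ≤ C
  eq_π : ∀ r ∈ Icc 0 l, ∀ t ∈ Icc 0 l,
    π r t = v t + ∫ σ in (0 : ℝ)..r, (v (t + σ)).comp (ε σ t)
  eq_ε : ∀ r ∈ Icc 0 l, ∀ t ∈ Icc 0 l,
    ε r t = ∫ τ in (0 : ℝ)..t, -(w (τ + r)).comp (π r τ)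

theorem stronglyMeasurable_clm_comp {α : Type*} [MeasurableSpace α] {E F G : Type*}
    [NormedAddCommGroup E] [NormedSpace ℂ E] [NormedAddCommGroup F] [NormedSpace ℂ F]
    [NormedAddCommGroup G] [NormedSpace ℂ G] {a : α → F →L[ℂ] G} {b : α → E →L[ℂ] F}
    (ha : StronglyMeasurable a) (hb : StronglyMeasurable b) :
    StronglyMeasurable fun x => (a x).comp (b x) :=
  (isBoundedBilinearMap_comp (𝕜 := ℂ) (E := E) (F := F) (G := G)).continuous.comp_stronglyMeasurable
    (ha.prodMk hb)

theorem stronglyMeasurable_clm_apply {α : Type*} [MeasurableSpace α] {E F : Type*}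
    [NormedAddCommGroup E] [NormedSpace ℂ E] [NormedAddCommGroup F] [NormedSpace ℂ F]
    {a : α → E →L[ℂ] F} {b : α → E}
    (ha : StronglyMeasurable a) (hb : StronglyMeasurable b) :
    StronglyMeasurable fun x => a x (b x) :=
  (isBoundedBilinearMap_apply (𝕜 := ℂ) (E := E) (F := F)).continuous.comp_stronglyMeasurable
    (ha.prodMk hb)

/-- The `ε`-component of the Goursat problem determined by the `π`-component. -/
noncomputable def goursatEps (w : ℝ → H₁ →L[ℂ] H₂) (π : ℝ → ℝ → H₂ →L[ℂ] H₁) (r t : ℝ) :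
    H₂ →L[ℂ] H₂ :=
  ∫ τ in (0 : ℝ)..t, -(w (τ + r)).comp (π r τ)

/-- The terms of the Picard series of the Goursat problem. -/
noncomputable def goursatTerm (v : ℝ → H₂ →L[ℂ] H₁) (w : ℝ → H₁ →L[ℂ] H₂) :
    ℕ → ℝ → ℝ → H₂ →L[ℂ] H₁
  | 0 => fun _ t => v t
  | n + 1 => fun r t => ∫ σ in (0 : ℝ)..r, (v (t + σ)).comp (goursatEps w (goursatTerm v w n) σ t)

variable {v : ℝ → H₂ →L[ℂ] H₁} {w : ℝ → H₁ →L[ℂ] H₂} {M l : ℝ}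

theorem stronglyMeasurable_goursatEps (hw : StronglyMeasurable w) {π : ℝ → ℝ → H₂ →L[ℂ] H₁}
    (hπ : StronglyMeasurable (Function.uncurry π)) :
    StronglyMeasurable (Function.uncurry (goursatEps w π)) := by
  refine stronglyMeasurable_intervalIntegral (α := ℝ × ℝ) (b := fun p => p.2)
    (f := fun p τ => -(w (τ + p.1)).comp (π p.1 τ)) ?_ measurable_const measurable_snd
  refine (stronglyMeasurable_clm_comp (hw.comp_measurable ?_)
    (hπ.comp_measurable (g := fun q : (ℝ × ℝ) × ℝ => (q.1.1, q.2)) ?_)).neg <;> fun_prop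

theorem stronglyMeasurable_goursatTerm (hv : StronglyMeasurable v) (hw : StronglyMeasurable w)
    (n : ℕ) : StronglyMeasurable (Function.uncurry (goursatTerm v w n)) := by
  induction n with
  | zero => exact hv.comp_measurable measurable_snd
  | succ n ih =>
    refine stronglyMeasurable_intervalIntegral (α := ℝ × ℝ) (b := fun p => p.1)
      (f := fun p σ => (v (p.2 + σ)).comp (goursatEps w (goursatTerm v w n) σ p.2)) ?_
      measurable_const measurable_fst
    refine stronglyMeasurable_clm_comp (hv.comp_measurable ?_)
      ((stronglyMeasurable_goursatEps hw ih).comp_measurable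
        (g := fun q : (ℝ × ℝ) × ℝ => (q.2, q.1.2)) ?_) <;> fun_prop

/-- One Picard step integrates in both variables. Only the integration in t is used for the
factorial; the one in r is estimated by the length `l`, whence the factor `M ^ 2 * l * t`. -/
theorem norm_goursatTerm_le (hvM : ∀ x, ‖v x‖ ≤ M) (hwM : ∀ x, ‖w x‖ ≤ M) (n : ℕ) :
    ∀ r ∈ Icc 0 l, ∀ t ∈ Icc 0 l,
      ‖goursatTerm v w n r t‖ ≤ M * ((M ^ 2 * l * t) ^ n / n.factorial) := by
  have hM : 0 ≤ M := (norm_nonneg _).trans (hvM 0)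
  induction n with
  | zero => intro r _ t _; simpa [goursatTerm] using hvM t
  | succ n ih =>
    intro r hr t ht
    have hl : 0 ≤ l := hr.1.trans hr.2
    have hε : ∀ σ ∈ Icc 0 l, ‖goursatEps w (goursatTerm v w n) σ t‖ ≤
        M ^ 2 * (M ^ 2 * l) ^ n * t ^ (n + 1) / (n + 1).factorial := by
      intro σ hσ
      have : ‖goursatEps w (goursatTerm v w n) σ t‖ ≤
          ∫ τ in (0 : ℝ)..t, M * (M * ((M ^ 2 * l * τ) ^ n / n.factorial)) := by
        refine intervalIntegral.norm_integral_le_of_norm_le ht.1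
          (Filter.Eventually.of_forall fun τ hτ => ?_)
          (Continuous.intervalIntegrable (by fun_prop) _ _)
        rw [norm_neg]
        refine (ContinuousLinearMap.opNorm_comp_le _ _).trans
          (mul_le_mul (hwM _) (ih σ hσ τ ⟨hτ.1.le, hτ.2.trans ht.2⟩) (norm_nonneg _) hM)
      refine this.trans (le_of_eq ?_)
      have e : ∀ τ : ℝ, M * (M * ((M ^ 2 * l * τ) ^ n / n.factorial)) =
          (M ^ 2 * (M ^ 2 * l) ^ n / n.factorial) * τ ^ n := by
        intro τ; rw [mul_pow]; ring
      simp only [e]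
      rw [intervalIntegral.integral_const_mul, integral_pow, Nat.factorial_succ]
      push_cast
      have : (n.factorial : ℝ) ≠ 0 := by positivity
      field_simp
      ring
    have h := intervalIntegral.norm_integral_le_of_norm_le_const (a := 0) (b := r)
      (f := fun σ => (v (t + σ)).comp (goursatEps w (goursatTerm v w n) σ t))
      (C := M * (M ^ 2 * (M ^ 2 * l) ^ n * t ^ (n + 1) / (n + 1).factorial)) (fun σ hσ => by
        rw [uIoc_of_le hr.1] at hσ
        exact (ContinuousLinearMap.opNorm_comp_le _ _).trans
          (mul_le_mul (hvM _) (hε σ ⟨hσ.1.le, hσ.2.trans hr.2⟩) (norm_nonneg _) hM))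
    refine h.trans ?_
    rw [sub_zero, abs_of_nonneg hr.1]
    have ht0 := ht.1
    calc _ ≤ M * (M ^ 2 * (M ^ 2 * l) ^ n * t ^ (n + 1) / (n + 1).factorial) * l :=
          mul_le_mul_of_nonneg_left hr.2 (by positivity)
      _ = _ := by rw [mul_pow (M ^ 2 * l) t, pow_succ (M ^ 2 * l)]; ring

theorem exists_isGoursatSolution [CompleteSpace H₁] (hl : 0 ≤ l) (hv : StronglyMeasurable v)
    (hw : StronglyMeasurable w) (hvM : ∀ x, ‖v x‖ ≤ M) (hwM : ∀ x, ‖w x‖ ≤ M) :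
    ∃ ε π, IsGoursatSolution l v w ε π := by
  have hM : 0 ≤ M := (norm_nonneg _).trans (hvM 0)
  -- Clamping the arguments to [0, l] turns bounds valid on the square into the global bounds
  -- required of a solution.
  let cl : ℝ → ℝ := fun x => max 0 (min x l)
  have hclm : Measurable cl := by fun_prop
  have hcl : ∀ x, cl x ∈ Icc 0 l := fun x => ⟨le_max_left _ _, max_le hl (min_le_right _ _)⟩
  have hcl' : ∀ x ∈ Icc 0 l, cl x = x := fun x hx => by simp [cl, hx.1, hx.2]
  let b : ℕ → ℝ := fun n => M * ((M ^ 2 * l * l) ^ n / n.factorial)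
  have hb : Summable b := (Real.summable_pow_div_factorial _).mul_left M
  have hterm : ∀ n, ∀ r ∈ Icc 0 l, ∀ t ∈ Icc 0 l, ‖goursatTerm v w n r t‖ ≤ b n := by
    intro n r hr t ht
    refine (norm_goursatTerm_le hvM hwM n r hr t ht).trans ?_
    have := ht.1
    have := ht.2
    simp only [b]
    gcongr
  let Pf : ℝ → ℝ → H₂ →L[ℂ] H₁ := fun r t => ∑' n, goursatTerm v w n (cl r) (cl t)
  have hsum : ∀ r t, HasSum (fun n => goursatTerm v w n (cl r) (cl t)) (Pf r t) := fun r t =>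
    (Summable.of_norm_bounded hb fun n => hterm n _ (hcl r) _ (hcl t)).hasSum
  have hsum' : ∀ r ∈ Icc 0 l, ∀ t ∈ Icc 0 l,
      HasSum (fun n => goursatTerm v w n r t) (Pf r t) := by
    intro r hr t ht
    have := hsum r t
    rwa [hcl' r hr, hcl' t ht] at this
  have hPfm : StronglyMeasurable (Function.uncurry Pf) := by
    refine stronglyMeasurable_of_tendsto Filter.atTop
      (f := fun N (p : ℝ × ℝ) => ∑ n ∈ Finset.range N, goursatTerm v w n (cl p.1) (cl p.2)) ?_ ?_
    · intro N
      refine Finset.stronglyMeasurable_fun_sum _ fun n _ => ?_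
      exact (stronglyMeasurable_goursatTerm hv hw n).comp_measurable
        (g := fun p : ℝ × ℝ => (cl p.1, cl p.2)) (by fun_prop)
    · rw [tendsto_pi_nhds]
      exact fun p => (hsum p.1 p.2).tendsto_sum_nat
  have hPfb : ∀ r t, ‖Pf r t‖ ≤ ∑' n, b n := fun r t =>
    tsum_of_norm_bounded hb.hasSum fun n => hterm n _ (hcl r) _ (hcl t)
  let ε : ℝ → ℝ → H₂ →L[ℂ] H₂ := fun r t => goursatEps w Pf (cl r) (cl t)
  have hεb : ∀ π : ℝ → ℝ → H₂ →L[ℂ] H₁, ∀ B, ∀ r ∈ Icc 0 l, ∀ t ∈ Icc 0 l,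
      (∀ τ ∈ Icc 0 l, ‖π r τ‖ ≤ B) → ‖goursatEps w π r t‖ ≤ M * B * l := by
    intro π B r hr t ht hB
    have := intervalIntegral.norm_integral_le_of_norm_le_const (a := 0) (b := t)
      (f := fun τ => -(w (τ + r)).comp (π r τ)) (C := M * B) (fun τ hτ => by
        rw [uIoc_of_le ht.1] at hτ
        rw [norm_neg]
        exact (ContinuousLinearMap.opNorm_comp_le _ _).trans
          (mul_le_mul (hwM _) (hB τ ⟨hτ.1.le, hτ.2.trans ht.2⟩) (norm_nonneg _) hM))
    refine this.trans ?_
    rw [sub_zero, abs_of_nonneg ht.1]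
    exact mul_le_mul_of_nonneg_left ht.2
      (mul_nonneg hM ((norm_nonneg _).trans (hB 0 ⟨le_rfl, hl⟩)))
  have hεsum : ∀ r ∈ Icc 0 l, ∀ t ∈ Icc 0 l,
      HasSum (fun n => goursatEps w (goursatTerm v w n) r t) (goursatEps w Pf r t) := by
    intro r hr t ht
    refine intervalIntegral.hasSum_integral_of_dominated_convergence (fun n _ => M * b n)
      (fun n => ?_) (fun n => ?_) ?_ ?_ ?_
    · refine (stronglyMeasurable_clm_comp (hw.comp_measurable (by fun_prop))
        ((stronglyMeasurable_goursatTerm hv hw n).comp_measurable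
          (g := fun τ => (r, τ)) (by fun_prop))).neg.aestronglyMeasurable
    · refine Filter.Eventually.of_forall fun τ hτ => ?_
      rw [uIoc_of_le ht.1] at hτ
      rw [norm_neg]
      exact (ContinuousLinearMap.opNorm_comp_le _ _).trans
          (mul_le_mul (hwM _) (hterm n r hr τ ⟨hτ.1.le, hτ.2.trans ht.2⟩) (norm_nonneg _) hM)
    · exact Filter.Eventually.of_forall fun _ _ => hb.mul_left M
    · exact intervalIntegrable_const
    · refine Filter.Eventually.of_forall fun τ hτ => ?_
      rw [uIoc_of_le ht.1] at hτ
      exact (((ContinuousLinearMap.compL ℂ H₂ H₁ H₂ (w (τ + r))).hasSum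
        (hsum' r hr τ ⟨hτ.1.le, hτ.2.trans ht.2⟩))).neg
  refine ⟨ε, Pf, ⟨?_, hPfm, ⟨M * (∑' n, b n) * l, fun r t => ?_⟩, ⟨_, hPfb⟩, ?_, ?_⟩⟩
  · exact (stronglyMeasurable_goursatEps hw hPfm).comp_measurable
      (g := fun p : ℝ × ℝ => (cl p.1, cl p.2)) (by fun_prop)
  · exact hεb Pf _ _ (hcl r) _ (hcl t) fun τ _ => hPfb _ _
  · intro r hr t ht
    -- Splitting off the zeroth term `v t` leaves the shifted series, which is the termwise integral
    -- of the series for ε.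
    have h1 := (hasSum_nat_add_iff' 1).2 (hsum' r hr t ht)
    have h2 : HasSum (fun n => goursatTerm v w (n + 1) r t)
        (∫ σ in (0 : ℝ)..r, (v (t + σ)).comp (ε σ t)) := by
      refine intervalIntegral.hasSum_integral_of_dominated_convergence
        (fun n _ => M * (M * b n * l)) (fun n => ?_) (fun n => ?_) ?_ ?_ ?_
      · exact (stronglyMeasurable_clm_comp (hv.comp_measurable (by fun_prop))
          ((stronglyMeasurable_goursatEps hw
            (stronglyMeasurable_goursatTerm hv hw n)).comp_measurable
            (g := fun σ => (σ, t)) (by fun_prop))).aestronglyMeasurable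
      · refine Filter.Eventually.of_forall fun σ hσ => ?_
        rw [uIoc_of_le hr.1] at hσ
        have hσ' : σ ∈ Icc 0 l := ⟨hσ.1.le, hσ.2.trans hr.2⟩
        exact (ContinuousLinearMap.opNorm_comp_le _ _).trans
          (mul_le_mul (hvM _) (hεb _ _ σ hσ' t ht fun τ hτ => hterm n σ hσ' τ hτ)
            (norm_nonneg _) hM)
      · exact Filter.Eventually.of_forall fun _ _ => ((hb.mul_left M).mul_right l).mul_left M
      · exact intervalIntegrable_const
      · refine Filter.Eventually.of_forall fun σ hσ => ?_
        rw [uIoc_of_le hr.1] at hσ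
        have hσ' : σ ∈ Icc 0 l := ⟨hσ.1.le, hσ.2.trans hr.2⟩
        have := hεsum σ hσ' t ht
        simp only [ε, hcl' σ hσ', hcl' t ht]
        exact (ContinuousLinearMap.compL ℂ H₂ H₂ H₁ (v (t + σ))).hasSum this
    have := h1.unique h2
    simp only [Finset.range_one, Finset.sum_singleton, goursatTerm] at this
    rw [← this]; abel
  · intro r hr t ht
    simp only [ε, hcl' r hr, hcl' t ht]
    rfl

end Goursat

/-! ### Volterra operators in the coordinates (x - t, t) -/

section Transmutation

variable {E F : Type*} [NormedAddCommGroup E] [NormedSpace ℂ E]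
  [NormedAddCommGroup F] [NormedSpace ℂ F]

/-- The Volterra operator `(N f)(x) = ∫₀ˣ k(x - t, t) f(t) dt`. -/
noncomputable def diffKernelOp (k : ℝ → ℝ → E →L[ℂ] F) (f : ℝ → E) (x : ℝ) : F :=
  ∫ t in (0 : ℝ)..x, k (x - t) t (f t)

variable {k : ℝ → ℝ → E →L[ℂ] F} {f : ℝ → E} {C l : ℝ}

theorem stronglyMeasurable_diffKernelOp (hk : StronglyMeasurable (Function.uncurry k))
    (hf : StronglyMeasurable f) : StronglyMeasurable (diffKernelOp k f) := by
  refine stronglyMeasurable_intervalIntegral (α := ℝ) (b := fun x => x)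
    (f := fun x t => k (x - t) t (f t)) ?_ measurable_const measurable_id
  exact stronglyMeasurable_clm_apply (hk.comp_measurable (g := fun q : ℝ × ℝ => (q.1 - q.2, q.2))
    (by fun_prop)) (hf.comp_measurable measurable_snd)

theorem intervalIntegrable_of_mem_Icc {G : Type*} [NormedAddCommGroup G] {f : ℝ → G} {l x y : ℝ}
    (hf : IntegrableOn f (Ioc 0 l)) (hx : x ∈ Icc 0 l) (hy : y ∈ Icc 0 l) :
    IntervalIntegrable f volume x y := by
  have hl : 0 ≤ l := hx.1.trans hx.2
  refine ((intervalIntegrable_iff_integrableOn_Ioc_of_le hl).2 hf).mono_set ?_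
  exact uIcc_subset_uIcc (by simpa [uIcc_of_le hl] using hx) (by simpa [uIcc_of_le hl] using hy)

theorem norm_diffKernelOp_le (hkC : ∀ r t, ‖k r t‖ ≤ C) (hfi : IntegrableOn f (Ioc 0 l)) :
    ∀ x ∈ Icc 0 l, ‖diffKernelOp k f x‖ ≤ C * ∫ t in (0 : ℝ)..l, ‖f t‖ := by
  intro x hx
  have hl : 0 ≤ l := hx.1.trans hx.2
  have hC : 0 ≤ C := (norm_nonneg _).trans (hkC 0 0)
  have h0 : (0 : ℝ) ∈ Icc 0 l := ⟨le_rfl, hl⟩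
  rw [← intervalIntegral.integral_const_mul]
  refine (intervalIntegral.norm_integral_le_of_norm_le hx.1 (g := fun t => C * ‖f t‖)
    (Filter.Eventually.of_forall fun t _ => ?_)
    ((intervalIntegrable_of_mem_Icc hfi h0 hx).norm.const_mul C)).trans ?_
  · exact (ContinuousLinearMap.le_opNorm _ _).trans
      (mul_le_mul_of_nonneg_right (hkC _ _) (norm_nonneg _))
  · exact intervalIntegral.integral_mono_interval le_rfl hx.1 hx.2
      (Filter.Eventually.of_forall fun t => by positivity)
      ((intervalIntegrable_of_mem_Icc hfi h0 ⟨hl, le_rfl⟩).norm.const_mul C)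

theorem integrableOn_diffKernelOp (hk : StronglyMeasurable (Function.uncurry k))
    (hkC : ∀ r t, ‖k r t‖ ≤ C) (hf : StronglyMeasurable f) (hfi : IntegrableOn f (Ioc 0 l)) :
    IntegrableOn (diffKernelOp k f) (Ioc 0 l) := by
  refine Integrable.mono' (g := fun _ => C * ∫ t in (0 : ℝ)..l, ‖f t‖) (integrable_const _)
    (stronglyMeasurable_diffKernelOp hk hf).aestronglyMeasurable ?_
  rw [ae_restrict_iff' measurableSet_Ioc]
  exact Filter.Eventually.of_forall fun x hx =>
    norm_diffKernelOp_le hkC hfi x (Ioc_subset_Icc_self hx)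

theorem integrableOn_clm_apply {a : ℝ → E →L[ℂ] F} {M : ℝ} (ha : StronglyMeasurable a)
    (haM : ∀ x, ‖a x‖ ≤ M) (hfi : IntegrableOn f (Ioc 0 l)) :
    IntegrableOn (fun x => a x (f x)) (Ioc 0 l) := by
  refine (hfi.norm.const_mul M).mono'
    ((isBoundedBilinearMap_apply (𝕜 := ℂ) (E := E) (F := F)).continuous.comp_aestronglyMeasurable
      (ha.aestronglyMeasurable.prodMk hfi.aestronglyMeasurable))
    (Filter.Eventually.of_forall fun x => ?_)
  exact (ContinuousLinearMap.le_opNorm _ _).trans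
    (mul_le_mul_of_nonneg_right (haM _) (norm_nonneg _))

end Transmutation

/-! ### The Goursat equations as operator identities -/

namespace IsGoursatSolution

variable {H₁ H₂ : Type*} [NormedAddCommGroup H₁] [NormedSpace ℂ H₁] [CompleteSpace H₁]
  [NormedAddCommGroup H₂] [NormedSpace ℂ H₂] [CompleteSpace H₂]
  {v : ℝ → H₂ →L[ℂ] H₁} {w : ℝ → H₁ →L[ℂ] H₂} {M l : ℝ}
  {ε : ℝ → ℝ → H₂ →L[ℂ] H₂} {π : ℝ → ℝ → H₂ →L[ℂ] H₁}

/-- On the line r + t = s the coefficient v(t + r) is v(s) and leaves the inner integral;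
`intervalIntegral_shear` collects these lines. In operator form, Π = J v (1 + N). -/
theorem diffKernelOp_π (hG : IsGoursatSolution l v w ε π) (hv : StronglyMeasurable v)
    (hvM : ∀ x, ‖v x‖ ≤ M) {g : ℝ → H₂} (hg : StronglyMeasurable g)
    (hgi : IntegrableOn g (Ioc 0 l)) {x : ℝ} (hx : x ∈ Icc 0 l) :
    diffKernelOp π g x = ∫ s in (0 : ℝ)..x, v s (g s + diffKernelOp ε g s) := by
  obtain ⟨C, hC⟩ := hG.bounded_ε
  have hM : 0 ≤ M := (norm_nonneg _).trans (hvM 0)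
  have h0 : (0 : ℝ) ∈ Icc 0 l := ⟨le_rfl, hx.1.trans hx.2⟩
  have hsub : Ioc 0 x ⊆ Ioc 0 l := Ioc_subset_Ioc_right hx.2
  have hvεm : StronglyMeasurable fun q : ℝ × ℝ => (v (q.1 + q.2)).comp (ε q.2 q.1) :=
    stronglyMeasurable_clm_comp (hv.comp_measurable (by fun_prop))
      (hG.measurable_ε.comp_measurable (g := fun q : ℝ × ℝ => (q.2, q.1)) (by fun_prop))
  have hvεb : ∀ t σ, ‖(v (t + σ)).comp (ε σ t)‖ ≤ M * C := fun t σ =>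
    (ContinuousLinearMap.opNorm_comp_le _ _).trans
      (mul_le_mul (hvM _) (hC _ _) (norm_nonneg _) hM)
  let f : ℝ → ℝ → H₁ := fun r t => (v (t + r)).comp (ε r t) (g t)
  have hfm : StronglyMeasurable (Function.uncurry f) :=
    stronglyMeasurable_clm_apply (hvεm.comp_measurable measurable_swap)
      (hg.comp_measurable measurable_snd)
  have hint : ∀ t ∈ Icc 0 x, ∀ y, IntervalIntegrable (fun σ => (v (t + σ)).comp (ε σ t))
      volume 0 y := by
    intro t _ y
    refine (intervalIntegrable_const (c := M * C)).mono_fun'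
      (hvεm.comp_measurable (g := fun σ => (t, σ)) (by fun_prop)).aestronglyMeasurable
      (Filter.Eventually.of_forall fun σ => hvεb t σ)
  have e1 : diffKernelOp π g x =
      ∫ t in (0 : ℝ)..x, (v t (g t) + ∫ r in (0 : ℝ)..(x - t), f r t) := by
    refine intervalIntegral.integral_congr fun t ht => ?_
    rw [uIcc_of_le hx.1] at ht
    rw [hG.eq_π (x - t) ⟨by linarith [ht.2], by linarith [ht.1, hx.2]⟩ t ⟨ht.1, ht.2.trans hx.2⟩,
      add_apply, ContinuousLinearMap.intervalIntegral_apply (hint t ht _)]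
  have hi1 : IntervalIntegrable (fun t => v t (g t)) volume 0 x :=
    intervalIntegrable_of_mem_Icc (integrableOn_clm_apply hv hvM hgi) h0 hx
  have hi2 : IntervalIntegrable (fun t => v t (diffKernelOp ε g t)) volume 0 x :=
    intervalIntegrable_of_mem_Icc (integrableOn_clm_apply hv hvM
      (integrableOn_diffKernelOp hG.measurable_ε hC hg hgi)) h0 hx
  have hi3 : IntervalIntegrable (fun t => ∫ r in (0 : ℝ)..(x - t), f r t) volume 0 x := by
    rw [intervalIntegrable_iff_integrableOn_Ioc_of_le hx.1]
    refine Integrable.mono' (g := fun t => M * C * ‖g t‖ * x)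
      (((hgi.mono_set hsub).norm.const_mul _).mul_const _) ?_ ?_
    · exact (stronglyMeasurable_intervalIntegral (f := fun t r => f r t) (b := fun t => x - t)
        (hfm.comp_measurable measurable_swap) measurable_const
        (by fun_prop)).aestronglyMeasurable
    · rw [ae_restrict_iff' measurableSet_Ioc]
      refine Filter.Eventually.of_forall fun t ht => ?_
      refine (intervalIntegral.norm_integral_le_of_norm_le_const (C := M * C * ‖g t‖)
        (fun r _ => ?_)).trans ?_
      · exact (ContinuousLinearMap.le_opNorm _ _).trans
          (mul_le_mul_of_nonneg_right (hvεb _ _) (norm_nonneg _))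
      · have hC0 : 0 ≤ C := (norm_nonneg _).trans (hC 0 0)
        rw [sub_zero, abs_of_nonneg (by linarith [ht.2])]
        exact mul_le_mul_of_nonneg_left (by linarith [ht.1]) (by positivity)
  have hshear := intervalIntegral_shear (f := f) (h := fun t => M * C * ‖g t‖) hx.1 hfm
    ((hgi.mono_set hsub).norm.const_mul _) (fun r _ t _ =>
      (ContinuousLinearMap.le_opNorm _ _).trans
        (mul_le_mul_of_nonneg_right (hvεb _ _) (norm_nonneg _)))
  rw [e1, intervalIntegral.integral_add hi1 hi3, hshear]
  simp only [map_add]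
  rw [intervalIntegral.integral_add hi1 hi2]
  congr 1
  refine intervalIntegral.integral_congr fun s hs => ?_
  rw [uIcc_of_le hx.1] at hs
  have hgs := intervalIntegrable_of_mem_Icc hgi h0 ⟨hs.1, hs.2.trans hx.2⟩
  simp only [f, diffKernelOp]
  rw [← ContinuousLinearMap.intervalIntegral_comp_comm]
  · simp
  · rw [intervalIntegrable_iff_integrableOn_Ioc_of_le hs.1] at hgs ⊢
    refine (hgs.norm.const_mul C).mono' (stronglyMeasurable_clm_apply
      (hG.measurable_ε.comp_measurable (g := fun t : ℝ => (s - t, t)) (by fun_prop))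
      hg).aestronglyMeasurable (Filter.Eventually.of_forall fun t => ?_)
    exact (ContinuousLinearMap.le_opNorm _ _).trans
        (mul_le_mul_of_nonneg_right (hC _ _) (norm_nonneg _))

/-- This plays the role of differentiating N(c + Jg) in x, which is unavailable since the kernel is
differentiable only in the integrated sense. With r = x - t as outer variable, the integrand becomes
a product of two primitives in the second variable. -/
theorem diffKernelOp_ε_primitive (hG : IsGoursatSolution l v w ε π) (hw : StronglyMeasurable w)
    (hwM : ∀ x, ‖w x‖ ≤ M) {g : ℝ → H₂} (hg : StronglyMeasurable g)
    (hgi : IntegrableOn g (Ioc 0 l)) (c : H₂) {x : ℝ} (hx : x ∈ Icc 0 l) :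
    diffKernelOp ε (fun y => c + ∫ t in (0 : ℝ)..y, g t) x =
      ∫ s in (0 : ℝ)..x, (diffKernelOp ε g s -
        w s (diffKernelOp π (fun y => c + ∫ t in (0 : ℝ)..y, g t) s)) := by
  set h : ℝ → H₂ := fun y => c + ∫ t in (0 : ℝ)..y, g t with hh
  obtain ⟨C, hC⟩ := hG.bounded_ε
  obtain ⟨D, hD⟩ := hG.bounded_π
  have hM : 0 ≤ M := (norm_nonneg _).trans (hwM 0)
  have h0 : (0 : ℝ) ∈ Icc 0 l := ⟨le_rfl, hx.1.trans hx.2⟩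
  have hsub : Ioc 0 x ⊆ Ioc 0 l := Ioc_subset_Ioc_right hx.2
  have hhm : StronglyMeasurable h := stronglyMeasurable_const.add
    (stronglyMeasurable_intervalIntegral (f := fun _ => g) (b := fun y => y)
      (hg.comp_measurable measurable_snd) measurable_const measurable_id)
  obtain ⟨B, hB⟩ : ∃ B, ∀ y ∈ Icc 0 x, ‖h y‖ ≤ B := by
    have : ContinuousOn h (uIcc 0 x) := continuousOn_const.add
      (intervalIntegral.continuousOn_primitive_interval'
        (intervalIntegrable_of_mem_Icc hgi h0 hx) (by simp))
    rw [uIcc_of_le hx.1] at this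
    exact isCompact_Icc.exists_bound_of_continuousOn this
  have hwπm : StronglyMeasurable fun q : ℝ × ℝ => -(w (q.2 + q.1)).comp (π q.1 q.2) :=
    (stronglyMeasurable_clm_comp (hw.comp_measurable (by fun_prop)) hG.measurable_π).neg
  have hwπb : ∀ r τ, ‖-(w (τ + r)).comp (π r τ)‖ ≤ M * D := fun r τ => by
    rw [norm_neg]
    exact (ContinuousLinearMap.opNorm_comp_le _ _).trans
      (mul_le_mul (hwM _) (hD _ _) (norm_nonneg _) hM)
  have hwπi : ∀ r y, IntervalIntegrable (fun τ => -(w (τ + r)).comp (π r τ)) volume 0 y := by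
    intro r y
    refine (intervalIntegrable_const (c := M * D)).mono_fun'
      (hwπm.comp_measurable (g := fun τ => (r, τ)) (by fun_prop)).aestronglyMeasurable
      (Filter.Eventually.of_forall fun σ => hwπb _ _)
  let f : ℝ → ℝ → H₂ := fun r y => (-(w (y + r)).comp (π r y)) (h y) + ε r y (g y)
  have hfm : StronglyMeasurable (Function.uncurry f) :=
    (stronglyMeasurable_clm_apply hwπm (hhm.comp_measurable measurable_snd)).add
      (stronglyMeasurable_clm_apply hG.measurable_ε (hg.comp_measurable measurable_snd))
  have hshear := intervalIntegral_shear' (f := f) (h := fun t => M * D * B + C * ‖g t‖) hx.1 hfm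
    ((integrable_const _).add ((hgi.mono_set hsub).norm.const_mul _)) (fun r _ t ht =>
      (norm_add_le _ _).trans (add_le_add ((ContinuousLinearMap.le_opNorm _ _).trans
        (mul_le_mul (hwπb _ _) (hB t ht) (norm_nonneg _) ((norm_nonneg _).trans (hwπb 0 0))))
        ((ContinuousLinearMap.le_opNorm _ _).trans
        (mul_le_mul_of_nonneg_right (hC _ _) (norm_nonneg _)))))
  -- Product rule in the second variable for fixed r. Since ε(r, 0) = 0 there is no boundary term,
  -- not even from the constant `c`.
  have hprod : ∀ r ∈ Icc 0 x, ε r (x - r) (h (x - r)) = ∫ y in (0 : ℝ)..(x - r), f r y := by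
    intro r hr
    have hY : x - r ∈ Icc 0 l := ⟨by linarith [hr.2], by linarith [hr.1, hx.2]⟩
    have hr' : r ∈ Icc 0 l := ⟨hr.1, hr.2.trans hx.2⟩
    have hp := intervalIntegral_clm_apply_intervalIntegral (a := fun τ => -(w (τ + r)).comp (π r τ))
      (g := g) hY.1 ((intervalIntegrable_iff_integrableOn_Ioc_of_le hY.1).1 (hwπi r _))
      (hgi.mono_set (Ioc_subset_Ioc_right hY.2))
    have hεi : IntervalIntegrable (fun y => ε r y (g y)) volume 0 (x - r) :=
      intervalIntegrable_of_mem_Icc (integrableOn_clm_apply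
        (hG.measurable_ε.comp_measurable (g := fun y => (r, y)) (by fun_prop))
        (fun y => hC r y) hgi) h0 hY
    have hai : ∀ q : ℝ → H₂, StronglyMeasurable q → ∀ B, (∀ y ∈ Icc 0 x, ‖q y‖ ≤ B) →
        IntervalIntegrable (fun y => (-(w (y + r)).comp (π r y)) (q y)) volume 0 (x - r) := by
      intro q hq B hB
      rw [intervalIntegrable_iff_integrableOn_Ioc_of_le hY.1]
      refine Integrable.mono' (g := fun _ => M * D * B) (integrable_const _)
        (stronglyMeasurable_clm_apply (hwπm.comp_measurable (g := fun τ => (r, τ)) (by fun_prop))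
          hq).aestronglyMeasurable ?_
      rw [ae_restrict_iff' measurableSet_Ioc]
      refine Filter.Eventually.of_forall fun y hy => ?_
      exact (ContinuousLinearMap.le_opNorm _ _).trans
        (mul_le_mul (hwπb _ _) (hB y ⟨hy.1.le, by linarith [hy.2, hr.1]⟩) (norm_nonneg _)
          ((norm_nonneg _).trans (hwπb 0 0)))
    have hGm : StronglyMeasurable fun y => ∫ t in (0 : ℝ)..y, g t := by
      have := hhm.sub (stronglyMeasurable_const (b := c))
      convert! this using 1
      funext y; simp [h]
    rw [hG.eq_ε r hr' _ hY, hh]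
    simp only [map_add]
    rw [hp, ContinuousLinearMap.intervalIntegral_apply (hwπi r _), ← intervalIntegral.integral_add]
    · refine intervalIntegral.integral_congr fun y hy => ?_
      rw [uIcc_of_le hY.1] at hy
      simp only [f, h, map_add]
      rw [← hG.eq_ε r hr' y ⟨hy.1, hy.2.trans hY.2⟩]
      abel
    · exact hai (fun _ => c) stronglyMeasurable_const ‖c‖ fun _ _ => le_rfl
    · refine (hai _ hGm (B + ‖c‖) fun y hy => ?_).add (hεi.congr fun y hy => ?_)
      · have : ∫ t in (0 : ℝ)..y, g t = h y - c := by simp [h]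
        rw [this]
        exact (norm_sub_le _ _).trans (add_le_add_left (hB y hy) _)
      · rw [uIoc_of_le hY.1] at hy
        rw [← hG.eq_ε r hr' y ⟨hy.1.le, hy.2.trans hY.2⟩]
  have hhi : IntegrableOn h (Ioc 0 x) := by
    refine Integrable.mono' (g := fun _ => B) (integrable_const _) hhm.aestronglyMeasurable ?_
    rw [ae_restrict_iff' measurableSet_Ioc]
    exact Filter.Eventually.of_forall fun y hy => hB y (Ioc_subset_Icc_self hy)
  calc diffKernelOp ε h x = ∫ r in (0 : ℝ)..x, ε r (x - r) (h (x - r)) := by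
        have := intervalIntegral.integral_comp_sub_left (fun t => ε (x - t) t (h t)) x
          (a := 0) (b := x)
        simp only [sub_sub_cancel, sub_self, sub_zero] at this
        exact this.symm
    _ = ∫ r in (0 : ℝ)..x, ∫ y in (0 : ℝ)..(x - r), f r y := by
        refine intervalIntegral.integral_congr fun r hr => ?_
        rw [uIcc_of_le hx.1] at hr
        exact hprod r hr
    _ = ∫ s in (0 : ℝ)..x, ∫ t in (0 : ℝ)..s, f (s - t) t := hshear
    _ = _ := by
        refine intervalIntegral.integral_congr fun s hs => ?_
        rw [uIcc_of_le hx.1] at hs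
        have hs' : s ∈ Icc 0 l := ⟨hs.1, hs.2.trans hx.2⟩
        have i1 : IntervalIntegrable (fun t => π (s - t) t (h t)) volume 0 s :=
          intervalIntegrable_of_mem_Icc (integrableOn_clm_apply (hG.measurable_π.comp_measurable
            (g := fun t => (s - t, t)) (by fun_prop)) (fun t => hD _ _) hhi) ⟨le_rfl, hx.1⟩ hs
        have i2 : IntervalIntegrable (fun t => ε (s - t) t (g t)) volume 0 s :=
          intervalIntegrable_of_mem_Icc (integrableOn_clm_apply (hG.measurable_ε.comp_measurable
            (g := fun t => (s - t, t)) (by fun_prop)) (fun t => hC _ _) hgi) h0 hs'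
        have i3 : IntervalIntegrable (fun t => -(w s (π (s - t) t (h t)))) volume 0 s := by
          rw [intervalIntegrable_iff_integrableOn_Ioc_of_le hs.1] at i1 ⊢
          exact ((w s).integrable_comp i1).neg
        simp only [f, diffKernelOp, add_sub_cancel, neg_apply,
          ContinuousLinearMap.comp_apply]
        rw [intervalIntegral.integral_add i3 i2, intervalIntegral.integral_neg,
          ContinuousLinearMap.intervalIntegral_comp_comm _ i1]
        abel

end IsGoursatSolution

/-! ### Volterra operators on L² -/

section L2Volterra

variable {H : Type*} [NormedAddCommGroup H] {l : ℝ}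

theorem integrableOn_Lp_two (f : Lp H 2 (volume.restrict (Ioo 0 l))) :
    IntegrableOn f (Ioc 0 l) := by
  rw [integrableOn_Ioc_iff_integrableOn_Ioo]
  exact (Lp.memLp f).integrable one_le_two

theorem exists_integral_norm_le_mul_norm (hl : 0 ≤ l) :
    ∃ D : ℝ, 0 ≤ D ∧ ∀ f : Lp H 2 (volume.restrict (Ioo 0 l)),
      ∫ t in (0 : ℝ)..l, ‖f t‖ ≤ D * ‖f‖ := by
  set μ := volume.restrict (Ioo 0 l)
  refine ⟨(μ univ ^ (1 / (1 : ENNReal).toReal - 1 / (2 : ENNReal).toReal)).toReal,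
    ENNReal.toReal_nonneg, fun f => ?_⟩
  have hf := (Lp.memLp f).integrable one_le_two
  have h := eLpNorm_le_eLpNorm_mul_rpow_measure_univ (p := 1) (q := 2) one_le_two
    (Lp.aestronglyMeasurable f)
  rw [intervalIntegral.integral_of_le hl, ← restrict_Ioo_eq_restrict_Ioc,
    integral_norm_eq_lintegral_enorm (Lp.aestronglyMeasurable f), ← eLpNorm_one_eq_lintegral_enorm,
    Lp.norm_def, mul_comm, ← ENNReal.toReal_mul]
  exact ENNReal.toReal_mono (ENNReal.mul_ne_top (Lp.eLpNorm_ne_top f)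
    (ENNReal.rpow_ne_top_of_nonneg (by norm_num) (measure_ne_top _ _))) h

variable [NormedSpace ℂ H]

/-- `N` is quasinilpotent: pointwise bounds on its powers acquire a factorial, so some power of -N
has norm below 1. Then 1 - (-N)ⁿ⁺¹ is a unit, and it factors as 1 + N times a geometric sum
commuting with it. -/
theorem isUnit_one_add_of_le_intervalIntegral [CompleteSpace H] (hl : 0 ≤ l) {C : ℝ} (hC : 0 ≤ C)
    (N : Lp H 2 (volume.restrict (Ioo 0 l)) →L[ℂ] Lp H 2 (volume.restrict (Ioo 0 l)))
    (hN : ∀ f, ∀ᵐ x ∂volume.restrict (Ioo 0 l), ‖N f x‖ ≤ C * ∫ t in (0 : ℝ)..x, ‖f t‖) :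
    IsUnit (1 + N) := by
  have h0 : (0 : ℝ) ∈ Icc 0 l := ⟨le_rfl, hl⟩
  -- The first application of `N` is spent on passing from the L¹ norm to a pointwise bound, hence
  -- the exponent n + 1 against n!.
  have hpow : ∀ n : ℕ, ∀ f, ∀ᵐ x ∂volume.restrict (Ioo 0 l), ‖(N ^ (n + 1)) f x‖ ≤
      C * (∫ t in (0 : ℝ)..l, ‖f t‖) * ((C * x) ^ n / n.factorial) := by
    intro n f
    induction n with
    | zero =>
      filter_upwards [hN f, ae_restrict_mem measurableSet_Ioo] with x hx hxm
      simp only [zero_add, pow_one, pow_zero, Nat.factorial_zero, Nat.cast_one, div_one, mul_one]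
      refine hx.trans (mul_le_mul_of_nonneg_left ?_ hC)
      exact intervalIntegral.integral_mono_interval le_rfl hxm.1.le hxm.2.le
        (Filter.Eventually.of_forall fun t => norm_nonneg _)
        (intervalIntegrable_of_mem_Icc (integrableOn_Lp_two f).norm h0 ⟨hl, le_rfl⟩)
    | succ n ih =>
      rw [pow_succ']
      filter_upwards [hN ((N ^ (n + 1)) f), ae_restrict_mem measurableSet_Ioo] with x hx hxm
      refine hx.trans ?_
      have hxl : x ∈ Icc 0 l := Ioo_subset_Icc_self hxm
      have : ∫ t in (0 : ℝ)..x, ‖(N ^ (n + 1)) f t‖ ≤ ∫ t in (0 : ℝ)..x,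
          C * (∫ t in (0 : ℝ)..l, ‖f t‖) * ((C * t) ^ n / n.factorial) := by
        refine intervalIntegral.integral_mono_ae_restrict hxm.1.le
          (intervalIntegrable_of_mem_Icc (integrableOn_Lp_two _).norm h0 hxl)
          (Continuous.intervalIntegrable (by fun_prop) _ _) ?_
        rw [restrict_Ioo_eq_restrict_Icc.symm]
        exact ae_restrict_of_ae_restrict_of_subset (Ioo_subset_Ioo_right hxm.2.le) ih
      refine (mul_le_mul_of_nonneg_left this hC).trans (le_of_eq ?_)
      have e : ∀ t : ℝ, C * (∫ t in (0 : ℝ)..l, ‖f t‖) * ((C * t) ^ n / n.factorial) =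
          (C * (∫ t in (0 : ℝ)..l, ‖f t‖) * C ^ n / n.factorial) * t ^ n := by
        intro t; rw [mul_pow]; ring
      simp only [e]
      rw [intervalIntegral.integral_const_mul, integral_pow, Nat.factorial_succ]
      push_cast
      have : (n.factorial : ℝ) ≠ 0 := by positivity
      field_simp
      ring
  obtain ⟨D, hD, hDf⟩ := exists_integral_norm_le_mul_norm (H := H) hl
  set V := (measureUnivNNReal (volume.restrict (Ioo 0 l)) : ℝ) ^ (2 : ENNReal).toReal⁻¹ with hV
  have hV0 : 0 ≤ V := by positivity
  have hnorm : ∀ n : ℕ, ‖(-N) ^ (n + 1)‖ ≤ V * C * D * ((C * l) ^ n / n.factorial) := by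
    intro n
    rw [neg_pow]
    have : ‖(-1 : Lp H 2 (volume.restrict (Ioo 0 l)) →L[ℂ] Lp H 2 (volume.restrict (Ioo 0 l))) ^ (n + 1) * N ^ (n + 1)‖ = ‖N ^ (n + 1)‖ := by
      rcases neg_one_pow_eq_or (Lp H 2 (volume.restrict (Ioo 0 l)) →L[ℂ] Lp H 2 (volume.restrict (Ioo 0 l))) (n + 1) with h | h <;> simp [h]
    rw [this]
    refine ContinuousLinearMap.opNorm_le_bound _ (by positivity) fun f => ?_
    have hA : 0 ≤ ∫ t in (0 : ℝ)..l, ‖f t‖ :=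
      intervalIntegral.integral_nonneg hl fun _ _ => norm_nonneg _
    refine (Lp.norm_le_of_ae_bound
      (C := C * (D * ‖f‖) * ((C * l) ^ n / n.factorial)) (by positivity) ?_).trans
      (le_of_eq (by ring))
    filter_upwards [hpow n f, ae_restrict_mem measurableSet_Ioo] with x hx hxm
    refine hx.trans ?_
    have := hxm.1.le
    have := hxm.2.le
    gcongr
    exact hDf f
  have hlim : Filter.Tendsto (fun n : ℕ => V * C * D * ((C * l) ^ n / n.factorial)) Filter.atTop
      (nhds 0) := by
    simpa using (FloorSemiring.tendsto_pow_div_factorial_atTop (C * l)).const_mul (V * C * D)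
  obtain ⟨n, hn⟩ := (hlim.eventually (gt_mem_nhds one_pos)).exists
  have hu := isUnit_one_sub_of_norm_lt_one ((hnorm n).trans_lt hn)
  rw [← mul_neg_geom_sum] at hu
  have hcomm : Commute (1 - -N) (∑ i ∈ Finset.range (n + 1), (-N) ^ i) :=
    (mul_neg_geom_sum (-N) (n + 1)).trans (geom_sum_mul_neg (-N) (n + 1)).symm
  simpa [sub_neg_eq_add] using (hcomm.isUnit_mul_iff.1 hu).1

variable {k : ℝ → ℝ → H →L[ℂ] H} {C : ℝ}

theorem norm_volterra_le {f : ℝ → H} (hkC : ∀ x ∈ Ioo 0 l, ∀ t ∈ Ioo 0 l, ‖k x t‖ ≤ C)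
    (hf : IntegrableOn f (Ioc 0 l)) {x : ℝ} (hx : x ∈ Ioo 0 l) :
    ‖∫ t in (0 : ℝ)..x, k x t (f t)‖ ≤ C * ∫ t in (0 : ℝ)..x, ‖f t‖ := by
  rw [← intervalIntegral.integral_const_mul]
  refine intervalIntegral.norm_integral_le_of_norm_le hx.1.le ?_
    ((intervalIntegrable_of_mem_Icc hf ⟨le_rfl, hx.1.le.trans hx.2.le⟩
      (Ioo_subset_Icc_self hx)).norm.const_mul C)
  exact Filter.Eventually.of_forall fun t ht => (ContinuousLinearMap.le_opNorm _ _).trans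
      (mul_le_mul_of_nonneg_right (hkC _ hx _ ⟨ht.1, ht.2.trans_lt hx.2⟩) (norm_nonneg _))

theorem intervalIntegrable_volterra {f : ℝ → H} (hk : StronglyMeasurable (Function.uncurry k))
    (hkC : ∀ x ∈ Ioo 0 l, ∀ t ∈ Ioo 0 l, ‖k x t‖ ≤ C)
    (hf : IntegrableOn f (Ioc 0 l)) {x : ℝ} (hx : x ∈ Ioo 0 l) :
    IntervalIntegrable (fun t => k x t (f t)) volume 0 x := by
  have hi := intervalIntegrable_of_mem_Icc hf ⟨le_rfl, hx.1.le.trans hx.2.le⟩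
      (Ioo_subset_Icc_self hx)
  rw [intervalIntegrable_iff_integrableOn_Ioc_of_le hx.1.le] at hi ⊢
  refine (hi.norm.const_mul C).mono'
    ((isBoundedBilinearMap_apply (𝕜 := ℂ) (E := H) (F := H)).continuous.comp_aestronglyMeasurable
      ((hk.comp_measurable
        (g := fun t => (x, t)) (by fun_prop)).aestronglyMeasurable.prodMk
          hi.aestronglyMeasurable)) ?_
  rw [ae_restrict_iff' measurableSet_Ioc]
  exact Filter.Eventually.of_forall fun t ht => (ContinuousLinearMap.le_opNorm _ _).trans
      (mul_le_mul_of_nonneg_right (hkC _ hx _ ⟨ht.1, ht.2.trans_lt hx.2⟩) (norm_nonneg _))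

/-- On a finite interval L² embeds in L¹, a bounded Volterra kernel takes L¹ to bounded functions,
and these lie in L². -/
theorem exists_volterra_clm [CompleteSpace H] (hl : 0 ≤ l) (hk : StronglyMeasurable (Function.uncurry k))
    (hkC : ∀ x ∈ Ioo 0 l, ∀ t ∈ Ioo 0 l, ‖k x t‖ ≤ C) (hC : 0 ≤ C) :
    ∃ N : Lp H 2 (volume.restrict (Ioo 0 l)) →L[ℂ] Lp H 2 (volume.restrict (Ioo 0 l)),
      ∀ f, ∀ᵐ x ∂volume.restrict (Ioo 0 l), N f x = ∫ t in (0 : ℝ)..x, k x t (f t) := by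
  set μ := volume.restrict (Ioo 0 l) with hμ
  obtain ⟨D, hD, hDf⟩ := exists_integral_norm_le_mul_norm (H := H) hl
  have hbd : ∀ f : Lp H 2 μ, ∀ᵐ x ∂μ, ‖∫ t in (0 : ℝ)..x, k x t (f t)‖ ≤ C * (D * ‖f‖) := by
    intro f
    filter_upwards [ae_restrict_mem measurableSet_Ioo] with x hx
    refine (norm_volterra_le hkC (integrableOn_Lp_two f) hx).trans
      (mul_le_mul_of_nonneg_left (le_trans ?_ (hDf f)) hC)
    exact intervalIntegral.integral_mono_interval le_rfl hx.1.le hx.2.le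
        (Filter.Eventually.of_forall fun t => norm_nonneg _)
        (intervalIntegrable_of_mem_Icc (integrableOn_Lp_two f).norm ⟨le_rfl, hl⟩ ⟨hl, le_rfl⟩)
  have hmem : ∀ f : Lp H 2 μ, MemLp (fun x => ∫ t in (0 : ℝ)..x, k x t (f t)) 2 μ := by
    intro f
    refine MemLp.of_bound ?_ _ (hbd f)
    exact (stronglyMeasurable_intervalIntegral (f := fun x t => k x t (f t)) (b := fun x => x)
      (stronglyMeasurable_clm_apply hk ((Lp.stronglyMeasurable f).comp_measurable measurable_snd))
      measurable_const measurable_id).aestronglyMeasurable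
  -- Representatives of sums and multiples agree with the pointwise ones only almost everywhere, so
  -- they must be exchanged under the integral.
  have hcongr : ∀ (f : Lp H 2 μ) (g : ℝ → H), f =ᵐ[μ] g → ∀ x ∈ Ioo 0 l,
      ∫ t in (0 : ℝ)..x, k x t (f t) = ∫ t in (0 : ℝ)..x, k x t (g t) := by
    intro f g hfg x hx
    refine intervalIntegral.integral_congr_ae_restrict ?_
    rw [uIoc_of_le hx.1.le, restrict_Ioo_eq_restrict_Ioc.symm]
    filter_upwards [ae_restrict_of_ae_restrict_of_subset (Ioo_subset_Ioo_right hx.2.le) hfg]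
      with t ht
    rw [ht]
  let N₀ : Lp H 2 μ →ₗ[ℂ] Lp H 2 μ :=
    { toFun := fun f => (hmem f).toLp _
      map_add' := by
        intro f g
        refine Lp.ext ?_
        filter_upwards [(hmem (f + g)).coeFn_toLp, (hmem f).coeFn_toLp, (hmem g).coeFn_toLp,
          Lp.coeFn_add ((hmem f).toLp _) ((hmem g).toLp _), ae_restrict_mem measurableSet_Ioo]
          with x h1 h2 h3 h4 hx
        rw [h1, h4, Pi.add_apply, h2, h3, hcongr (f + g) _ (Lp.coeFn_add f g) x hx,
          ← intervalIntegral.integral_add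
            (intervalIntegrable_volterra hk hkC (integrableOn_Lp_two f) hx)
            (intervalIntegrable_volterra hk hkC (integrableOn_Lp_two g) hx)]
        simp
      map_smul' := by
        intro c f
        refine Lp.ext ?_
        filter_upwards [(hmem (c • f)).coeFn_toLp, (hmem f).coeFn_toLp,
          Lp.coeFn_smul c ((hmem f).toLp _), ae_restrict_mem measurableSet_Ioo]
          with x h1 h2 h3 hx
        rw [h1, RingHom.id_apply, h3, Pi.smul_apply, h2, hcongr (c • f) _ (Lp.coeFn_smul c f) x hx,
          ← intervalIntegral.integral_smul]
        simp }
  refine ⟨N₀.mkContinuous ((measureUnivNNReal μ : ℝ) ^ (2 : ENNReal).toReal⁻¹ * (C * D)) ?_, ?_⟩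
  · intro f
    refine (Lp.norm_le_of_ae_bound (C := C * (D * ‖f‖)) (by positivity) ?_).trans
      (le_of_eq (by ring))
    filter_upwards [hbd f, (hmem f).coeFn_toLp] with x hx h1
    change ‖(hmem f).toLp _ x‖ ≤ _
    rw [h1]
    exact hx
  · exact fun f => (hmem f).coeFn_toLp

end L2Volterra

/-! ### The Volterra equation satisfied by L = c J d -/

section DiracPair

variable {H₁ H₂ K : Type*} [NormedAddCommGroup H₁] [NormedSpace ℂ H₁] [CompleteSpace H₁]
  [NormedAddCommGroup H₂] [NormedSpace ℂ H₂] [CompleteSpace H₂]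
  [NormedAddCommGroup K] [NormedSpace ℂ K] [CompleteSpace K]

/-- The integrated Dirac system at `z = 0`: `b' = v c`, `c' = -w b`, together with a pointwise right
inverse `d` of `c` annihilated by `b`. -/
structure IsDiracPair (l M : ℝ) (v : ℝ → H₂ →L[ℂ] H₁) (w : ℝ → H₁ →L[ℂ] H₂)
    (b : ℝ → K →L[ℂ] H₁) (c : ℝ → K →L[ℂ] H₂) (d : ℝ → H₂ →L[ℂ] K) : Prop where
  measurable_v : StronglyMeasurable v
  measurable_w : StronglyMeasurable w
  norm_v_le : ∀ x, ‖v x‖ ≤ M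
  norm_w_le : ∀ x, ‖w x‖ ≤ M
  continuousOn_b : ContinuousOn b (Icc 0 l)
  continuousOn_c : ContinuousOn c (Icc 0 l)
  continuousOn_d : ContinuousOn d (Icc 0 l)
  eq_b : ∀ x ∈ Icc 0 l, b x = b 0 + ∫ t in (0 : ℝ)..x, (v t).comp (c t)
  eq_c : ∀ x ∈ Icc 0 l, c x = c 0 + ∫ t in (0 : ℝ)..x, -(w t).comp (b t)
  c_comp_d : ∀ x ∈ Icc 0 l, (c x).comp (d x) = ContinuousLinearMap.id ℂ H₂
  b_comp_d : ∀ x ∈ Icc 0 l, (b x).comp (d x) = 0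

theorem integrableOn_continuousOn_clm_apply {E F : Type*} [NormedAddCommGroup E] [NormedSpace ℂ E]
    [NormedAddCommGroup F] [NormedSpace ℂ F] {l : ℝ} {a : ℝ → E →L[ℂ] F} {f : ℝ → E}
    (ha : ContinuousOn a (Icc 0 l)) (hf : IntegrableOn f (Ioc 0 l)) :
    IntegrableOn (fun x => a x (f x)) (Ioc 0 l) := by
  obtain ⟨C, hC⟩ := isCompact_Icc.exists_bound_of_continuousOn ha
  refine (hf.norm.const_mul C).mono'
    ((isBoundedBilinearMap_apply (𝕜 := ℂ) (E := E) (F := F)).continuous.comp_aestronglyMeasurable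
      (((ha.mono Ioc_subset_Icc_self).aestronglyMeasurable measurableSet_Ioc).prodMk
        hf.aestronglyMeasurable)) ?_
  rw [ae_restrict_iff' measurableSet_Ioc]
  exact Filter.Eventually.of_forall fun x hx => (ContinuousLinearMap.le_opNorm _ _).trans
    (mul_le_mul_of_nonneg_right (hC x (Ioc_subset_Icc_self hx)) (norm_nonneg _))

theorem integrableOn_clm_comp {E F G : Type*} [NormedAddCommGroup E] [NormedSpace ℂ E]
    [NormedAddCommGroup F] [NormedSpace ℂ F] [NormedAddCommGroup G] [NormedSpace ℂ G] {l M : ℝ}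
    {v : ℝ → F →L[ℂ] G} {a : ℝ → E →L[ℂ] F} (hv : StronglyMeasurable v) (hvM : ∀ x, ‖v x‖ ≤ M)
    (ha : IntegrableOn a (Ioc 0 l)) : IntegrableOn (fun x => (v x).comp (a x)) (Ioc 0 l) := by
  refine (ha.norm.const_mul M).mono'
    ((isBoundedBilinearMap_comp (𝕜 := ℂ) (E := E) (F := F)
      (G := G)).continuous.comp_aestronglyMeasurable
      (hv.aestronglyMeasurable.prodMk ha.aestronglyMeasurable))
      (Filter.Eventually.of_forall fun x => ?_)
  exact (ContinuousLinearMap.opNorm_comp_le _ _).trans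
    (mul_le_mul_of_nonneg_right (hvM x) (norm_nonneg _))

theorem integrableOn_primitive {E : Type*} [NormedAddCommGroup E] [NormedSpace ℂ E]
    {l : ℝ} {f : ℝ → E} (hl : 0 ≤ l) (hf : IntegrableOn f (Ioc 0 l)) :
    IntegrableOn (fun x => ∫ t in (0 : ℝ)..x, f t) (Ioc 0 l) := by
  have : ContinuousOn (fun y => ∫ t in (0 : ℝ)..y, f t) (uIcc 0 l) :=
    intervalIntegral.continuousOn_primitive_interval'
      ((intervalIntegrable_iff_integrableOn_Ioc_of_le hl).2 hf) (by simp)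
  rw [uIcc_of_le hl] at this
  exact (this.integrableOn_Icc).mono_set Ioc_subset_Icc_self

namespace IsDiracPair

variable {l M : ℝ} {v : ℝ → H₂ →L[ℂ] H₁} {w : ℝ → H₁ →L[ℂ] H₂}
    {b : ℝ → K →L[ℂ] H₁} {c : ℝ → K →L[ℂ] H₂} {d : ℝ → H₂ →L[ℂ] K}

theorem integrable_vc (h : IsDiracPair l M v w b c d) :
    IntegrableOn (fun t => (v t).comp (c t)) (Ioc 0 l) :=
  integrableOn_clm_comp h.measurable_v h.norm_v_le
    ((h.continuousOn_c.integrableOn_Icc).mono_set Ioc_subset_Icc_self)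

theorem integrable_wb (h : IsDiracPair l M v w b c d) :
    IntegrableOn (fun t => -(w t).comp (b t)) (Ioc 0 l) :=
  (integrableOn_clm_comp h.measurable_w h.norm_w_le
    ((h.continuousOn_b.integrableOn_Icc).mono_set Ioc_subset_Icc_self)).neg

/-- Formally the derivative of b J d f is b' J d f + b d f, where b' = v c and b d = 0. -/
theorem b_apply_integral (h : IsDiracPair l M v w b c d) {f : ℝ → H₂}
    (hf : IntegrableOn f (Ioc 0 l)) {x : ℝ} (hx : x ∈ Icc 0 l) :
    b x (∫ t in (0 : ℝ)..x, d t (f t)) =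
      ∫ s in (0 : ℝ)..x, v s (c s (∫ t in (0 : ℝ)..s, d t (f t))) := by
  have hl : 0 ≤ l := hx.1.trans hx.2
  have h0 : (0 : ℝ) ∈ Icc 0 l := ⟨le_rfl, hl⟩
  have hsub : Ioc 0 x ⊆ Ioc 0 l := Ioc_subset_Ioc_right hx.2
  have hdf := integrableOn_continuousOn_clm_apply h.continuousOn_d hf
  have hG := integrableOn_primitive hl hdf
  have hprod := intervalIntegral_clm_apply_intervalIntegral (a := fun t => (v t).comp (c t))
    hx.1 (h.integrable_vc.mono_set hsub) (hdf.mono_set hsub)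
  have i1 : IntervalIntegrable (fun y => ((v y).comp (c y)) (∫ t in (0 : ℝ)..y, d t (f t)))
      volume 0 x := by
    have := integrableOn_clm_apply h.measurable_v h.norm_v_le
      (integrableOn_continuousOn_clm_apply h.continuousOn_c hG)
    exact intervalIntegrable_of_mem_Icc this h0 hx
  have i2 : IntervalIntegrable (fun y => b y (d y (f y))) volume 0 x :=
    intervalIntegrable_of_mem_Icc (integrableOn_continuousOn_clm_apply h.continuousOn_b hdf) h0 hx
  have i3 : IntervalIntegrable (fun y => b 0 (d y (f y))) volume 0 x :=
    intervalIntegrable_of_mem_Icc ((b 0).integrable_comp hdf) h0 hx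
  rw [h.eq_b x hx, add_apply, hprod, ← ContinuousLinearMap.intervalIntegral_comp_comm _
    (intervalIntegrable_of_mem_Icc hdf h0 hx)]
  have e : ∀ y ∈ Icc 0 x, (∫ t in (0 : ℝ)..y, (v t).comp (c t)) (d y (f y)) =
      b y (d y (f y)) - b 0 (d y (f y)) := by
    intro y hy
    rw [h.eq_b y ⟨hy.1, hy.2.trans hx.2⟩, add_apply, add_sub_cancel_left]
  rw [intervalIntegral.integral_add i1]
  · rw [intervalIntegral.integral_congr (f := fun y => (∫ t in (0 : ℝ)..y, (v t).comp (c t))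
      (d y (f y))) (fun y hy => e y (by rwa [uIcc_of_le hx.1] at hy)),
      intervalIntegral.integral_sub i2 i3]
    have : ∫ y in (0 : ℝ)..x, b y (d y (f y)) = 0 := by
      refine intervalIntegral.integral_zero_ae (Filter.Eventually.of_forall fun y hy => ?_)
      rw [uIoc_of_le hx.1] at hy
      exact DFunLike.congr_fun (h.b_comp_d y ⟨hy.1.le, hy.2.trans hx.2⟩) (f y)
    rw [this]
    simp
  · refine (i2.sub i3).congr fun y hy => ?_
    rw [uIoc_of_le hx.1] at hy
    exact (e y (Ioc_subset_Icc_self hy)).symm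

/-- Formally the derivative of c J d f is c' J d f + c d f, where c' = -w b and c d = 1. With
`b_apply_integral` this gives (1 + J w J v) L = J. -/
theorem c_apply_integral (h : IsDiracPair l M v w b c d) {f : ℝ → H₂}
    (hf : IntegrableOn f (Ioc 0 l)) {x : ℝ} (hx : x ∈ Icc 0 l) :
    c x (∫ t in (0 : ℝ)..x, d t (f t)) = (∫ t in (0 : ℝ)..x, f t) -
      ∫ s in (0 : ℝ)..x, w s (b s (∫ t in (0 : ℝ)..s, d t (f t))) := by
  have hl : 0 ≤ l := hx.1.trans hx.2
  have h0 : (0 : ℝ) ∈ Icc 0 l := ⟨le_rfl, hl⟩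
  have hsub : Ioc 0 x ⊆ Ioc 0 l := Ioc_subset_Ioc_right hx.2
  have hdf := integrableOn_continuousOn_clm_apply h.continuousOn_d hf
  have hG := integrableOn_primitive hl hdf
  have hprod := intervalIntegral_clm_apply_intervalIntegral (a := fun t => -(w t).comp (b t))
    hx.1 (h.integrable_wb.mono_set hsub) (hdf.mono_set hsub)
  have i1 : IntervalIntegrable (fun y => (-(w y).comp (b y)) (∫ t in (0 : ℝ)..y, d t (f t)))
      volume 0 x := by
    have := (integrableOn_clm_apply h.measurable_w h.norm_w_le
      (integrableOn_continuousOn_clm_apply h.continuousOn_b hG)).neg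
    exact intervalIntegrable_of_mem_Icc this h0 hx
  have i2 : IntervalIntegrable (fun y => c y (d y (f y))) volume 0 x :=
    intervalIntegrable_of_mem_Icc (integrableOn_continuousOn_clm_apply h.continuousOn_c hdf) h0 hx
  have i3 : IntervalIntegrable (fun y => c 0 (d y (f y))) volume 0 x :=
    intervalIntegrable_of_mem_Icc ((c 0).integrable_comp hdf) h0 hx
  rw [h.eq_c x hx, add_apply, hprod, ← ContinuousLinearMap.intervalIntegral_comp_comm _
    (intervalIntegrable_of_mem_Icc hdf h0 hx)]
  have e : ∀ y ∈ Icc 0 x, (∫ t in (0 : ℝ)..y, -(w t).comp (b t)) (d y (f y)) =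
      c y (d y (f y)) - c 0 (d y (f y)) := by
    intro y hy
    rw [h.eq_c y ⟨hy.1, hy.2.trans hx.2⟩, add_apply, add_sub_cancel_left]
  rw [intervalIntegral.integral_add i1]
  · rw [intervalIntegral.integral_congr (f := fun y => (∫ t in (0 : ℝ)..y, -(w t).comp (b t))
      (d y (f y))) (fun y hy => e y (by rwa [uIcc_of_le hx.1] at hy)),
      intervalIntegral.integral_sub i2 i3]
    have : ∫ y in (0 : ℝ)..x, c y (d y (f y)) = ∫ y in (0 : ℝ)..x, f y := by
      refine intervalIntegral.integral_congr fun y hy => ?_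
      rw [uIcc_of_le hx.1] at hy
      exact DFunLike.congr_fun (h.c_comp_d y ⟨hy.1, hy.2.trans hx.2⟩) (f y)
    rw [this]
    simp only [neg_apply, ContinuousLinearMap.comp_apply, intervalIntegral.integral_neg]
    abel
  · refine (i2.sub i3).congr fun y hy => ?_
    rw [uIoc_of_le hx.1] at hy
    exact (e y (Ioc_subset_Icc_self hy)).symm

/-- The Volterra equation `z = -∫₀ˣ w(s) ∫₀ˢ v(t) z(t) dt ds` has only the zero solution. -/
theorem ae_eq_zero_of_eq_neg_integral (hl : 0 ≤ l) (hvM : ∀ x, ‖v x‖ ≤ M) (hwM : ∀ x, ‖w x‖ ≤ M)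
    {z : ℝ → H₂} (hz : IntegrableOn z (Ioc 0 l))
    (hzeq : ∀ᵐ x ∂volume.restrict (Ioc 0 l),
      z x = -∫ s in (0 : ℝ)..x, w s (∫ t in (0 : ℝ)..s, v t (z t))) :
    ∀ᵐ x ∂volume.restrict (Ioc 0 l), z x = 0 := by
  have hM : 0 ≤ M := (norm_nonneg _).trans (hvM 0)
  have h0 : (0 : ℝ) ∈ Icc 0 l := ⟨le_rfl, hl⟩
  have key := ae_eq_zero_of_le_intervalIntegral (h := fun x => ‖z x‖) (C := M * M * l) (x := l)
    (by positivity) hz.norm (Filter.Eventually.of_forall fun _ => norm_nonneg _) ?_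
  · filter_upwards [key] with x hx using norm_eq_zero.1 hx
  · filter_upwards [hzeq, ae_restrict_mem measurableSet_Ioc] with x hx hxm
    have hxl : x ∈ Icc 0 l := Ioc_subset_Icc_self hxm
    have hA : 0 ≤ ∫ t in (0 : ℝ)..x, ‖z t‖ :=
      intervalIntegral.integral_nonneg hxl.1 fun _ _ => norm_nonneg _
    rw [hx, norm_neg]
    refine (intervalIntegral.norm_integral_le_of_norm_le_const
      (C := M * (M * ∫ t in (0 : ℝ)..x, ‖z t‖)) fun s hs => ?_).trans ?_
    · rw [uIoc_of_le hxl.1] at hs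
      refine (ContinuousLinearMap.le_opNorm _ _).trans
        (mul_le_mul (hwM s) ?_ (norm_nonneg _) hM)
      rw [← intervalIntegral.integral_const_mul]
      refine (intervalIntegral.norm_integral_le_of_norm_le hs.1.le (g := fun t => M * ‖z t‖)
        (Filter.Eventually.of_forall fun t _ => (ContinuousLinearMap.le_opNorm _ _).trans
          (mul_le_mul_of_nonneg_right (hvM t) (norm_nonneg _)))
        ((intervalIntegrable_of_mem_Icc hz h0
          ⟨hs.1.le, hs.2.trans hxl.2⟩).norm.const_mul M)).trans ?_
      exact intervalIntegral.integral_mono_interval le_rfl hs.1.le hs.2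
        (Filter.Eventually.of_forall fun t => by positivity)
        ((intervalIntegrable_of_mem_Icc hz h0 hxl).norm.const_mul M)
    · rw [sub_zero, abs_of_nonneg hxl.1]
      calc M * (M * ∫ t in (0 : ℝ)..x, ‖z t‖) * x
          ≤ M * (M * ∫ t in (0 : ℝ)..x, ‖z t‖) * l :=
            mul_le_mul_of_nonneg_left hxl.2 (by positivity)
        _ = M * M * l * ∫ t in (0 : ℝ)..x, ‖z t‖ := by ring

/-- Injectivity of 1 + J w J v, in the form in which it is used: two solutions with the same
right-hand side `r` coincide. -/
theorem ae_eq_of_volterra_eq (hl : 0 ≤ l) (hv : StronglyMeasurable v) (hw : StronglyMeasurable w)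
    (hvM : ∀ x, ‖v x‖ ≤ M) (hwM : ∀ x, ‖w x‖ ≤ M)
    {y z r : ℝ → H₂} (hy : IntegrableOn y (Ioc 0 l)) (hz : IntegrableOn z (Ioc 0 l))
    (hyeq : ∀ x ∈ Icc 0 l,
      y x = r x - ∫ s in (0 : ℝ)..x, w s (∫ t in (0 : ℝ)..s, v t (y t)))
    (hzeq : ∀ x ∈ Icc 0 l,
      z x = r x - ∫ s in (0 : ℝ)..x, w s (∫ t in (0 : ℝ)..s, v t (z t))) :
    ∀ᵐ x ∂volume.restrict (Ioc 0 l), y x = z x := by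
  have h0 : (0 : ℝ) ∈ Icc 0 l := ⟨le_rfl, hl⟩
  have iv : ∀ {f : ℝ → H₂}, IntegrableOn f (Ioc 0 l) →
      IntegrableOn (fun t => v t (f t)) (Ioc 0 l) := integrableOn_clm_apply hv hvM
  have iw : ∀ {f : ℝ → H₂}, IntegrableOn f (Ioc 0 l) →
      IntegrableOn (fun s => w s (∫ t in (0 : ℝ)..s, v t (f t))) (Ioc 0 l) := fun hf =>
    integrableOn_clm_apply hw hwM (integrableOn_primitive hl (iv hf))
  have key := ae_eq_zero_of_eq_neg_integral hl hvM hwM (z := fun x => y x - z x) (hy.sub hz) ?_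
  · filter_upwards [key] with x hx using sub_eq_zero.1 hx
  · filter_upwards [ae_restrict_mem measurableSet_Ioc] with x hxm
    have hx : x ∈ Icc 0 l := Ioc_subset_Icc_self hxm
    rw [hyeq x hx, hzeq x hx, sub_sub_sub_cancel_left, ← neg_sub, neg_inj,
      ← intervalIntegral.integral_sub (intervalIntegrable_of_mem_Icc (iw hy) h0 hx)
        (intervalIntegrable_of_mem_Icc (iw hz) h0 hx)]
    refine intervalIntegral.integral_congr fun s hs => ?_
    rw [uIcc_of_le hx.1] at hs
    have hs' : s ∈ Icc 0 l := ⟨hs.1, hs.2.trans hx.2⟩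
    rw [← map_sub, ← intervalIntegral.integral_sub (intervalIntegrable_of_mem_Icc (iv hy) h0 hs')
        (intervalIntegrable_of_mem_Icc (iv hz) h0 hs')]
    simp only [map_sub]

variable {ε : ℝ → ℝ → H₂ →L[ℂ] H₂} {π : ℝ → ℝ → H₂ →L[ℂ] H₁}

/-- Eliminating π between the two Goursat identities gives (1 + J w J v) E(a + Jg) = a + J E g. The
constant `a` is kept so that a = 0 yields the intertwining relation and g = 0 the action of E on
constants. -/
theorem goursat_volterra_eq (h : IsDiracPair l M v w b c d) (hG : IsGoursatSolution l v w ε π)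
    {g : ℝ → H₂} (hg : StronglyMeasurable g) (hgi : IntegrableOn g (Ioc 0 l)) (a : H₂) {x : ℝ}
    (hx : x ∈ Icc 0 l) :
    (a + ∫ t in (0 : ℝ)..x, g t) + diffKernelOp ε (fun y => a + ∫ t in (0 : ℝ)..y, g t) x =
      (a + ∫ t in (0 : ℝ)..x, (g t + diffKernelOp ε g t)) -
      ∫ s in (0 : ℝ)..x, w s (∫ t in (0 : ℝ)..s, v t
        ((a + ∫ t in (0 : ℝ)..t, g t) +
          diffKernelOp ε (fun y => a + ∫ t in (0 : ℝ)..y, g t) t)) := by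
  have hl : 0 ≤ l := hx.1.trans hx.2
  have h0 : (0 : ℝ) ∈ Icc 0 l := ⟨le_rfl, hl⟩
  obtain ⟨C, hC⟩ := hG.bounded_ε
  obtain ⟨D, hD⟩ := hG.bounded_π
  set q : ℝ → H₂ := fun y => a + ∫ t in (0 : ℝ)..y, g t with hq
  have hqm : StronglyMeasurable q := stronglyMeasurable_const.add
    (stronglyMeasurable_intervalIntegral (f := fun _ => g) (b := fun y => y)
      (hg.comp_measurable measurable_snd) measurable_const measurable_id)
  have hqi : IntegrableOn q (Ioc 0 l) := (integrable_const a).add (integrableOn_primitive hl hgi)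
  rw [hG.diffKernelOp_ε_primitive h.measurable_w h.norm_w_le hg hgi a hx]
  have e : ∀ s ∈ Icc 0 x, w s (diffKernelOp π q s) =
      w s (∫ t in (0 : ℝ)..s, v t (q t + diffKernelOp ε q t)) := by
    intro s hs
    rw [hG.diffKernelOp_π h.measurable_v h.norm_v_le hqm hqi ⟨hs.1, hs.2.trans hx.2⟩]
  have i1 : IntervalIntegrable (diffKernelOp ε g) volume 0 x := intervalIntegrable_of_mem_Icc
    (integrableOn_diffKernelOp hG.measurable_ε hC hg hgi) h0 hx
  have i2 : IntervalIntegrable (fun s => w s (diffKernelOp π q s)) volume 0 x :=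
    intervalIntegrable_of_mem_Icc (integrableOn_clm_apply h.measurable_w h.norm_w_le
      (integrableOn_diffKernelOp hG.measurable_π hD hqm hqi)) h0 hx
  rw [intervalIntegral.integral_sub i1 i2, intervalIntegral.integral_add
    (intervalIntegrable_of_mem_Icc hgi h0 hx) i1,
    intervalIntegral.integral_congr (fun s hs => e s (by rwa [uIcc_of_le hx.1] at hs))]
  abel

/-- `E J = L E` for `E = 1 + N`, `J` integration and `L = c J d`. -/
theorem goursat_intertwines (h : IsDiracPair l M v w b c d) (hG : IsGoursatSolution l v w ε π)
    (hl : 0 ≤ l) {g : ℝ → H₂} (hg : StronglyMeasurable g) (hgi : IntegrableOn g (Ioc 0 l)) :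
    ∀ᵐ x ∂volume.restrict (Ioc 0 l),
      (∫ t in (0 : ℝ)..x, g t) + diffKernelOp ε (fun y => ∫ t in (0 : ℝ)..y, g t) x =
        c x (∫ t in (0 : ℝ)..x, d t (g t + diffKernelOp ε g t)) := by
  have h0 : (0 : ℝ) ∈ Icc 0 l := ⟨le_rfl, hl⟩
  obtain ⟨C, hC⟩ := hG.bounded_ε
  have hEg : IntegrableOn (fun t => g t + diffKernelOp ε g t) (Ioc 0 l) :=
    hgi.add (integrableOn_diffKernelOp hG.measurable_ε hC hg hgi)
  have hJm : StronglyMeasurable fun y => ∫ t in (0 : ℝ)..y, g t :=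
    stronglyMeasurable_intervalIntegral (f := fun _ => g) (b := fun y => y)
      (hg.comp_measurable measurable_snd) measurable_const measurable_id
  have hJi := integrableOn_primitive hl hgi
  -- Both E J g and L E g solve (1 + J w J v) y = J E g.
  refine ae_eq_of_volterra_eq hl h.measurable_v h.measurable_w h.norm_v_le h.norm_w_le
    (r := fun x => ∫ t in (0 : ℝ)..x, (g t + diffKernelOp ε g t))
    (hJi.add (integrableOn_diffKernelOp hG.measurable_ε hC hJm hJi))
    (integrableOn_continuousOn_clm_apply h.continuousOn_c
      (integrableOn_primitive hl (integrableOn_continuousOn_clm_apply h.continuousOn_d hEg)))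
    (fun x hx => ?_) (fun x hx => ?_)
  · simpa only [zero_add] using h.goursat_volterra_eq hG hg hgi 0 hx
  · rw [h.c_apply_integral hEg hx]
    congr 1
    refine intervalIntegral.integral_congr fun s hs => ?_
    rw [uIcc_of_le hx.1] at hs
    rw [h.b_apply_integral hEg ⟨hs.1, hs.2.trans hx.2⟩]

/-- `E` maps the constant `c(0) κ` to `c κ` when `b(0) κ = 0`. -/
theorem goursat_const (h : IsDiracPair l M v w b c d) (hG : IsGoursatSolution l v w ε π)
    (hl : 0 ≤ l) {κ : K} (hκ : b 0 κ = 0) :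
    ∀ᵐ x ∂volume.restrict (Ioc 0 l),
      c 0 κ + diffKernelOp ε (fun _ => c 0 κ) x = c x κ := by
  have h0 : (0 : ℝ) ∈ Icc 0 l := ⟨le_rfl, hl⟩
  obtain ⟨C, hC⟩ := hG.bounded_ε
  have hci : IntegrableOn (fun x => c x κ) (Ioc 0 l) :=
    integrableOn_continuousOn_clm_apply h.continuousOn_c (integrable_const κ)
  -- The function c κ solves (1 + J w J v) y = c(0) κ because b κ = J v c κ when b(0) κ = 0.
  refine ae_eq_of_volterra_eq hl h.measurable_v h.measurable_w h.norm_v_le h.norm_w_le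
    (r := fun x => c 0 κ) ((integrable_const _).add (integrableOn_diffKernelOp hG.measurable_ε hC
      stronglyMeasurable_const (integrable_const _))) hci
    (fun x hx => ?_) (fun x hx => ?_)
  · have := h.goursat_volterra_eq hG (g := fun _ => 0) stronglyMeasurable_const
      (integrable_const _) (c 0 κ) hx
    simpa [diffKernelOp] using this
  · rw [h.eq_c x hx, add_apply, ContinuousLinearMap.intervalIntegral_apply
      (intervalIntegrable_of_mem_Icc h.integrable_wb h0 hx), sub_eq_add_neg,
      ← intervalIntegral.integral_neg]
    congr 1
    refine intervalIntegral.integral_congr fun s hs => ?_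
    rw [uIcc_of_le hx.1] at hs
    have hs' : s ∈ Icc 0 l := ⟨hs.1, hs.2.trans hx.2⟩
    simp only [neg_apply, ContinuousLinearMap.comp_apply]
    rw [h.eq_b s hs', add_apply, hκ, zero_add, ContinuousLinearMap.intervalIntegral_apply
      (intervalIntegrable_of_mem_Icc h.integrable_vc h0 hs')]
    rfl

end IsDiracPair

end DiracPair

/-! ### Matrices as operators on Euclidean space -/

section MatCLM

variable {m n p : Type*} [Fintype m] [Fintype n] [DecidableEq n] [Fintype p] [DecidableEq p]

/-- A matrix as an operator between Euclidean spaces; an isometry for the operator norm. -/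
noncomputable def matCLM :
    Matrix m n ℂ ≃ₗᵢ[ℂ] (EuclideanSpace ℂ n →L[ℂ] EuclideanSpace ℂ m) where
  toLinearEquiv := Matrix.toEuclideanLin.trans LinearMap.toContinuousLinearMap
  norm_map' _ := rfl

theorem matCLM_apply (A : Matrix m n ℂ) (x : EuclideanSpace ℂ n) :
    matCLM A x = WithLp.toLp 2 (A *ᵥ x.ofLp) := rfl

theorem matCLM_mul [DecidableEq m] (A : Matrix p m ℂ) (B : Matrix m n ℂ) :
    matCLM (A * B) = (matCLM A).comp (matCLM B) := by
  ext1 x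
  simp [matCLM_apply, Matrix.mulVec_mulVec]

theorem matCLM_one : matCLM (1 : Matrix n n ℂ) = ContinuousLinearMap.id ℂ _ := by
  ext1 x
  simp [matCLM_apply]

theorem toEuclideanCLM_eq_matCLM (A : Matrix n n ℂ) :
    Matrix.toEuclideanCLM (𝕜 := ℂ) A = matCLM A := rfl

theorem continuous_matCLM : Continuous (matCLM : Matrix m n ℂ → _) := matCLM.continuous

/-- Left multiplication by a fixed matrix, as a continuous linear map. -/
noncomputable def mulLeftCLM (A : Matrix p m ℂ) : Matrix m n ℂ →L[ℂ] Matrix p n ℂ :=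
  LinearMap.toContinuousLinearMap
    { toFun := fun B => A * B
      map_add' := fun _ _ => Matrix.mul_add _ _ _
      map_smul' := fun _ _ => Matrix.mul_smul _ _ _ }

/-- The entry functional, as a continuous linear map. -/
noncomputable def entryCLM (i : m) (j : n) : Matrix m n ℂ →L[ℂ] ℂ :=
  LinearMap.toContinuousLinearMap
    { toFun := fun B => B i j
      map_add' := fun _ _ => rfl
      map_smul' := fun _ _ => rfl }

end MatCLM

/-! ### Absolutely continuous functions as primitives -/

section AbsCont

variable {E : Type*} [NormedAddCommGroup E] [NormedSpace ℝ E] [CompleteSpace E]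

theorem lipschitzOnWith_primitive {f : ℝ → E} {l C : ℝ} (hC : 0 ≤ C)
    (hf : IntegrableOn f (Ioc 0 l)) (hfC : ∀ᵐ x ∂volume.restrict (Ioo 0 l), ‖f x‖ ≤ C) :
    LipschitzOnWith C.toNNReal (fun x => ∫ t in (0 : ℝ)..x, f t) (Icc 0 l) := by
  refine LipschitzOnWith.of_dist_le_mul fun x hx y hy => ?_
  have h0 : (0 : ℝ) ∈ Icc 0 l := ⟨le_rfl, hx.1.trans hx.2⟩
  rw [dist_eq_norm, Real.coe_toNNReal C hC,
    intervalIntegral.integral_interval_sub_left (intervalIntegrable_of_mem_Icc hf h0 hx)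
      (intervalIntegrable_of_mem_Icc hf h0 hy), Real.dist_eq]
  refine intervalIntegral.norm_integral_le_of_norm_le_const_ae ?_
  rw [restrict_Ioo_eq_restrict_Ioc, ae_restrict_iff' measurableSet_Ioc] at hfC
  filter_upwards [hfC] with t ht htm
  refine ht ?_
  rw [uIoc] at htm
  exact ⟨(le_min hy.1 hx.1).trans_lt htm.1, htm.2.trans (max_le hy.2 hx.2)⟩

/-- The bound on `f'` makes its primitive Lipschitz; the difference with `f` is then absolutely
continuous with derivative 0 almost everywhere, hence constant. -/
theorem AbsolutelyContinuousOnInterval.eq_add_integral {f f' : ℝ → E} {l C : ℝ} (hl : 0 ≤ l)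
    (hC : 0 ≤ C) (hf : AbsolutelyContinuousOnInterval f 0 l) (hi : IntegrableOn f' (Ioc 0 l))
    (hfC : ∀ᵐ x ∂volume.restrict (Ioo 0 l), ‖f' x‖ ≤ C)
    (hd : ∀ᵐ x ∂volume.restrict (Ioo 0 l), HasDerivAt f (f' x) x) :
    ∀ x ∈ Icc 0 l, f x = f 0 + ∫ t in (0 : ℝ)..x, f' t := by
  have hI : AbsolutelyContinuousOnInterval (fun x => ∫ t in (0 : ℝ)..x, f' t) 0 l := by
    refine LipschitzOnWith.absolutelyContinuousOnInterval (K := C.toNNReal) ?_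
    rw [uIcc_of_le hl]
    exact lipschitzOnWith_primitive hC hi hfC
  have hder : ∀ᵐ x, x ∈ uIcc 0 l →
      HasDerivAt (f - fun x => ∫ t in (0 : ℝ)..x, f' t) 0 x := by
    rw [← ae_restrict_iff' measurableSet_uIcc, uIcc_of_le hl, ← restrict_Ioo_eq_restrict_Icc]
    have h1 := ((intervalIntegrable_iff_integrableOn_Ioc_of_le hl).2 hi).ae_hasDerivAt_integral
    filter_upwards [hd, ae_restrict_of_ae h1, ae_restrict_mem measurableSet_Ioo] with x hx hx' hxm
    have := hx.sub (hx' (by rw [uIcc_of_le hl]; exact Ioo_subset_Icc_self hxm) 0 (by simp))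
    rwa [sub_self] at this
  obtain ⟨c, hc⟩ := (hf.sub hI).const_of_ae_hasDerivAt_zero hder
  intro x hx
  have e0 := hc 0 (by simp)
  have ex := hc x (by rwa [uIcc_of_le hl])
  simp only [Pi.sub_apply, intervalIntegral.integral_same, sub_zero] at e0 ex
  rw [e0, ← ex]; abel

end AbsCont

/-- Products of absolutely continuous functions with values in a normed ring. -/
theorem _root_.AbsolutelyContinuousOnInterval.normedRing_mul {R : Type*} [NormedRing R]
    {f g : ℝ → R} {a b : ℝ} (hf : AbsolutelyContinuousOnInterval f a b)
    (hg : AbsolutelyContinuousOnInterval g a b) :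
    AbsolutelyContinuousOnInterval (fun x => f x * g x) a b := by
  obtain ⟨C, hC⟩ := hf.exists_bound
  obtain ⟨D, hD⟩ := hg.exists_bound
  unfold AbsolutelyContinuousOnInterval at hf hg ⊢
  refine squeeze_zero' (Filter.Eventually.of_forall fun _ => Finset.sum_nonneg fun _ _ =>
    dist_nonneg) ?_ (by simpa using (hg.const_mul C).add (hf.const_mul D))
  rw [Filter.eventually_inf_principal]
  filter_upwards with ⟨n, I⟩ hnI
  simp only [Finset.mul_sum, ← Finset.sum_add_distrib]
  refine Finset.sum_le_sum fun i hi => ?_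
  have e : f (I i).1 * g (I i).1 - f (I i).2 * g (I i).2 =
      f (I i).1 * (g (I i).1 - g (I i).2) + (f (I i).1 - f (I i).2) * g (I i).2 := by noncomm_ring
  simp only [dist_eq_norm]
  rw [e, mul_comm D]
  exact (norm_add_le _ _).trans (add_le_add
    ((norm_mul_le _ _).trans (mul_le_mul_of_nonneg_right (hC _ (hnI.1 i hi).1) (norm_nonneg _)))
    ((norm_mul_le _ _).trans (mul_le_mul_of_nonneg_left (hD _ (hnI.1 i hi).2) (norm_nonneg _))))

/-! ### The Dirac system at z = 0 -/

section Dirac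

variable {m₁ m₂ : ℕ} {l M : ℝ} {v : ℝ → Matrix (Fin m₁) (Fin m₂) ℂ}
  {u : ℝ → ℂ → Matrix (Fin m₁ ⊕ Fin m₂) (Fin m₁ ⊕ Fin m₂) ℂ}

/-- The Goursat problem evaluates the potential at t + r, possibly beyond l, and asks for
measurability and a bound everywhere. A measurable version set to zero wherever it exceeds `M`
provides both. -/
theorem exists_stronglyMeasurable_bounded {E : Type*} [NormedAddCommGroup E] {f : ℝ → E}
    {s : Set ℝ} (hM0 : 0 ≤ M) (hs : MeasurableSet s)
    (hf : AEStronglyMeasurable f (volume.restrict s)) (hfM : ∀ x ∈ s, ‖f x‖ ≤ M) :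
    ∃ g : ℝ → E, StronglyMeasurable g ∧ (∀ x, ‖g x‖ ≤ M) ∧ f =ᵐ[volume.restrict s] g := by
  have hT : MeasurableSet {x | ‖hf.mk f x‖ ≤ M} :=
    measurableSet_le hf.stronglyMeasurable_mk.norm.measurable measurable_const
  refine ⟨{x | ‖hf.mk f x‖ ≤ M}.indicator (hf.mk f), hf.stronglyMeasurable_mk.indicator hT,
    fun x => ?_, ?_⟩
  · by_cases hx : x ∈ {x | ‖hf.mk f x‖ ≤ M}
    · rw [indicator_of_mem hx]; exact hx
    · rw [indicator_of_notMem hx]; simpa using hM0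
  · filter_upwards [hf.ae_eq_mk, ae_restrict_mem hs] with x hx hxs
    have : x ∈ {x | ‖hf.mk f x‖ ≤ M} := by
      change ‖hf.mk f x‖ ≤ M
      rw [← hx]; exact hfM x hxs
    rw [indicator_of_mem this, hx]

theorem jMat_mul_vMat (a : Matrix (Fin m₁) (Fin m₂) ℂ) :
    jMat m₁ m₂ * vMat a = Matrix.fromBlocks 0 a (-aᴴ) 0 := by
  simp [jMat, vMat, Matrix.fromBlocks_multiply]

/-- The block row `[I 0]`. -/
abbrev rowLeft (m₁ m₂ : ℕ) : Matrix (Fin m₁) (Fin m₁ ⊕ Fin m₂) ℂ := Matrix.fromCols 1 0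

/-- The block row `[0 I]`. -/
abbrev rowRight (m₁ m₂ : ℕ) : Matrix (Fin m₂) (Fin m₁ ⊕ Fin m₂) ℂ := Matrix.fromCols 0 1

theorem beta_eq (x : ℝ) : beta u x = rowLeft m₁ m₂ * u x 0 := rfl

theorem gamma_eq (x : ℝ) : gamma u x = rowRight m₁ m₂ * u x 0 := rfl

theorem rowLeft_mul_jMat_mul_vMat (a : Matrix (Fin m₁) (Fin m₂) ℂ) :
    rowLeft m₁ m₂ * (jMat m₁ m₂ * vMat a) = a * rowRight m₁ m₂ := by
  rw [jMat_mul_vMat, Matrix.fromCols_mul_fromBlocks, Matrix.mul_fromCols]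
  simp

theorem rowRight_mul_jMat_mul_vMat (a : Matrix (Fin m₁) (Fin m₂) ℂ) :
    rowRight m₁ m₂ * (jMat m₁ m₂ * vMat a) = -(aᴴ * rowLeft m₁ m₂) := by
  rw [jMat_mul_vMat, Matrix.fromCols_mul_fromBlocks, Matrix.mul_fromCols]
  ext i (j | j) <;> simp

theorem IsFundamentalSolution.hasDerivAt_zero (hu : IsFundamentalSolution l v u) :
    ∀ᵐ x ∂volume.restrict (Ioo 0 l),
      HasDerivAt (fun x => u x 0) (jMat m₁ m₂ * vMat (v x) * u x 0) x := by
  filter_upwards [hu.ode 0] with x hx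
  simpa using hx

theorem conjTranspose_jMat_mul_vMat (a : Matrix (Fin m₁) (Fin m₂) ℂ) :
    (jMat m₁ m₂ * vMat a)ᴴ = -(jMat m₁ m₂ * vMat a) := by
  rw [jMat_mul_vMat, Matrix.fromBlocks_conjTranspose, Matrix.fromBlocks_neg]
  simp

/-- jV is skew-Hermitian, so u*u has derivative 0 almost everywhere; being absolutely continuous, it
keeps its initial value. -/
theorem IsFundamentalSolution.unitary (hl : 0 ≤ l) (hu : IsFundamentalSolution l v u) :
    ∀ x ∈ Icc 0 l, u x 0 * (u x 0)ᴴ = 1 := by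
  have hac := hu.absCont 0
  have hac' : AbsolutelyContinuousOnInterval (fun x => (u x 0)ᴴ) 0 l := by
    have hiso : ∀ A B : Matrix (Fin m₁ ⊕ Fin m₂) (Fin m₁ ⊕ Fin m₂) ℂ,
        dist Aᴴ Bᴴ = dist A B := fun A B => by
      rw [dist_eq_norm, dist_eq_norm, ← Matrix.conjTranspose_sub, Matrix.l2_opNorm_conjTranspose]
    rw [absolutelyContinuousOnInterval_iff] at hac ⊢
    simpa only [hiso] using hac
  have hprod := hac'.normedRing_mul hac
  have hder : ∀ᵐ x, x ∈ uIcc 0 l →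
      HasDerivAt (fun x => (u x 0)ᴴ * u x 0) 0 x := by
    rw [← ae_restrict_iff' measurableSet_uIcc, uIcc_of_le hl, ← restrict_Ioo_eq_restrict_Icc]
    filter_upwards [hu.hasDerivAt_zero] with x hx
    have h1 : HasDerivAt (fun x => (u x 0)ᴴ) ((jMat m₁ m₂ * vMat (v x) * u x 0)ᴴ) x := hx.star
    have h2 := h1.mul hx
    convert! h2 using 1
    rw [Matrix.conjTranspose_mul, conjTranspose_jMat_mul_vMat]
    simp [Matrix.mul_assoc]
  obtain ⟨c, hc⟩ := hprod.const_of_ae_hasDerivAt_zero hder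
  intro x hx
  have e0 := hc 0 (by simp)
  have ex := hc x (by rwa [uIcc_of_le hl])
  rw [hu.initial 0] at e0
  simp only [Matrix.conjTranspose_one, mul_one] at e0
  -- What was shown is u*u = 1; for square matrices the order can be reversed.
  exact mul_eq_one_comm.1 (by rw [ex, ← e0])

theorem gamma_mul_conjTranspose (hl : 0 ≤ l) (hu : IsFundamentalSolution l v u) {x : ℝ}
    (hx : x ∈ Icc 0 l) : gamma u x * (gamma u x)ᴴ = 1 := by
  rw [gamma_eq, Matrix.conjTranspose_mul, Matrix.mul_assoc, ← Matrix.mul_assoc (u x 0),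
    hu.unitary hl x hx, Matrix.one_mul, Matrix.conjTranspose_fromCols_eq_fromRows_conjTranspose,
    Matrix.fromCols_mul_fromRows]
  simp

theorem beta_mul_conjTranspose_gamma (hl : 0 ≤ l) (hu : IsFundamentalSolution l v u) {x : ℝ}
    (hx : x ∈ Icc 0 l) : beta u x * (gamma u x)ᴴ = 0 := by
  rw [gamma_eq, beta_eq, Matrix.conjTranspose_mul, Matrix.mul_assoc, ← Matrix.mul_assoc (u x 0),
    hu.unitary hl x hx, Matrix.one_mul, Matrix.conjTranspose_fromCols_eq_fromRows_conjTranspose,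
    Matrix.fromCols_mul_fromRows]
  simp

theorem hasDerivAt_beta (hu : IsFundamentalSolution l v u) :
    ∀ᵐ x ∂volume.restrict (Ioo 0 l), HasDerivAt (beta u) (v x * gamma u x) x := by
  filter_upwards [hu.hasDerivAt_zero] with x hx
  have := ((mulLeftCLM (n := Fin m₁ ⊕ Fin m₂) (rowLeft m₁ m₂)).restrictScalars ℝ).hasFDerivAt.comp_hasDerivAt x hx
  convert! this using 1
  change _ = rowLeft m₁ m₂ * (jMat m₁ m₂ * vMat (v x) * u x 0)
  rw [← Matrix.mul_assoc, rowLeft_mul_jMat_mul_vMat, Matrix.mul_assoc, gamma_eq]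

theorem hasDerivAt_gamma (hu : IsFundamentalSolution l v u) :
    ∀ᵐ x ∂volume.restrict (Ioo 0 l), HasDerivAt (gamma u) (-((v x)ᴴ * beta u x)) x := by
  filter_upwards [hu.hasDerivAt_zero] with x hx
  have := ((mulLeftCLM (n := Fin m₁ ⊕ Fin m₂) (rowRight m₁ m₂)).restrictScalars ℝ).hasFDerivAt.comp_hasDerivAt x hx
  convert! this using 1
  change _ = rowRight m₁ m₂ * (jMat m₁ m₂ * vMat (v x) * u x 0)
  rw [← Matrix.mul_assoc, rowRight_mul_jMat_mul_vMat, Matrix.neg_mul, Matrix.mul_assoc,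
    beta_eq]

theorem absolutelyContinuous_mulLeft {p : Type*} [Fintype p] [DecidableEq p]
    (hu : IsFundamentalSolution l v u) (A : Matrix p (Fin m₁ ⊕ Fin m₂) ℂ) :
    AbsolutelyContinuousOnInterval (fun x => A * u x 0) 0 l := by
  have hac := hu.absCont 0
  rw [absolutelyContinuousOnInterval_iff] at hac ⊢
  intro ε hε
  obtain ⟨δ, hδ, h⟩ := hac (ε / (‖A‖ + 1)) (by positivity)
  refine ⟨δ, hδ, fun E hE hEδ => ?_⟩
  have := h E hE hEδ
  rw [lt_div_iff₀ (by positivity)] at this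
  refine lt_of_le_of_lt ?_ this
  rw [Finset.sum_mul]
  refine Finset.sum_le_sum fun i _ => ?_
  rw [dist_eq_norm, dist_eq_norm, ← Matrix.mul_sub, mul_comm]
  exact (Matrix.l2_opNorm_mul _ _).trans (mul_le_mul_of_nonneg_right (by linarith) (norm_nonneg _))

theorem continuousOn_beta (hl : 0 ≤ l) (hu : IsFundamentalSolution l v u) :
    ContinuousOn (beta u) (Icc 0 l) := by
  have := (absolutelyContinuous_mulLeft hu (rowLeft m₁ m₂)).continuousOn
  rwa [uIcc_of_le hl] at this

theorem continuousOn_gamma (hl : 0 ≤ l) (hu : IsFundamentalSolution l v u) :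
    ContinuousOn (gamma u) (Icc 0 l) := by
  have := (absolutelyContinuous_mulLeft hu (rowRight m₁ m₂)).continuousOn
  rwa [uIcc_of_le hl] at this

/-- The equation for ρ thereby reduces to ρ' = 0. It allows ρ = 1 in the construction of E, and
makes ρ constant for an arbitrary similarity operator. -/
theorem deriv_gamma_mul_conjTranspose_gamma (hl : 0 ≤ l) (hu : IsFundamentalSolution l v u) :
    ∀ᵐ x ∂volume.restrict (Ioo 0 l), deriv (gamma u) x * (gamma u x)ᴴ = 0 := by
  filter_upwards [hasDerivAt_gamma hu, ae_restrict_mem measurableSet_Ioo] with x hx hxm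
  rw [hx.deriv, Matrix.neg_mul, Matrix.mul_assoc,
    beta_mul_conjTranspose_gamma hl hu (Ioo_subset_Icc_self hxm)]
  simp

variable {v' : ℝ → Matrix (Fin m₁) (Fin m₂) ℂ}

theorem integrableOn_mul_continuousOn {p q : ℕ} {s : Type*} [Fintype s] [DecidableEq s]
    {a : ℝ → Matrix (Fin p) (Fin q) ℂ} {g : ℝ → Matrix (Fin q) s ℂ}
    (ha : StronglyMeasurable a) (haM : ∀ x, ‖a x‖ ≤ M) (hg : ContinuousOn g (Icc 0 l)) :
    IntegrableOn (fun x => a x * g x) (Ioc 0 l) ∧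
      ∃ C, 0 ≤ C ∧ ∀ᵐ x ∂volume.restrict (Ioo 0 l), ‖a x * g x‖ ≤ C := by
  obtain ⟨C, hC⟩ := isCompact_Icc.exists_bound_of_continuousOn hg
  have hM : 0 ≤ M := (norm_nonneg _).trans (haM 0)
  have hb : ∀ x ∈ Icc 0 l, ‖a x * g x‖ ≤ M * max C 0 := fun x hx =>
    (Matrix.l2_opNorm_mul _ _).trans
      (mul_le_mul (haM x) ((hC x hx).trans (le_max_left _ _)) (norm_nonneg _) hM)
  refine ⟨?_, M * max C 0, by positivity, ?_⟩
  · refine Integrable.mono' (g := fun _ => M * max C 0) (integrable_const _) ?_ ?_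
    · exact (continuous_fst.matrix_mul continuous_snd :
        Continuous fun q : Matrix (Fin p) (Fin q) ℂ × Matrix (Fin q) s ℂ =>
          q.1 * q.2).comp_aestronglyMeasurable
        (ha.aestronglyMeasurable.prodMk
          ((hg.mono Ioc_subset_Icc_self).aestronglyMeasurable measurableSet_Ioc))
    · rw [ae_restrict_iff' measurableSet_Ioc]
      exact Filter.Eventually.of_forall fun x hx => hb x (Ioc_subset_Icc_self hx)
  · rw [ae_restrict_iff' measurableSet_Ioo]
    exact Filter.Eventually.of_forall fun x hx => hb x (Ioo_subset_Icc_self hx)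

theorem beta_eq_add_integral (hl : 0 ≤ l) (hu : IsFundamentalSolution l v u)
    (hv' : StronglyMeasurable v') (hM' : ∀ x, ‖v' x‖ ≤ M)
    (hvv' : v =ᵐ[volume.restrict (Ioo 0 l)] v') :
    ∀ x ∈ Icc 0 l, beta u x = beta u 0 + ∫ t in (0 : ℝ)..x, v' t * gamma u t := by
  obtain ⟨hi, C, hC, hb⟩ := integrableOn_mul_continuousOn hv' hM' (continuousOn_gamma hl hu)
  refine AbsolutelyContinuousOnInterval.eq_add_integral hl hC
    (absolutelyContinuous_mulLeft hu _) hi hb ?_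
  filter_upwards [hasDerivAt_beta hu, hvv'] with x hx hx'
  rwa [hx'] at hx

theorem gamma_eq_add_integral (hl : 0 ≤ l) (hu : IsFundamentalSolution l v u)
    (hv' : StronglyMeasurable v') (hM' : ∀ x, ‖v' x‖ ≤ M)
    (hvv' : v =ᵐ[volume.restrict (Ioo 0 l)] v') :
    ∀ x ∈ Icc 0 l, gamma u x = gamma u 0 + ∫ t in (0 : ℝ)..x, -((v' t)ᴴ * beta u t) := by
  have hw' : StronglyMeasurable fun x => (v' x)ᴴ :=
    continuous_id.matrix_conjTranspose.comp_stronglyMeasurable hv'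
  obtain ⟨hi, C, hC, hb⟩ := integrableOn_mul_continuousOn hw'
    (fun x => (Matrix.l2_opNorm_conjTranspose (v' x)).trans_le (hM' x)) (continuousOn_beta hl hu)
  refine AbsolutelyContinuousOnInterval.eq_add_integral hl hC
    (absolutelyContinuous_mulLeft hu _) hi.neg (by simpa only [norm_neg] using hb) ?_
  filter_upwards [hasDerivAt_gamma hu, hvv'] with x hx hx'
  rwa [hx'] at hx

theorem beta_zero (hu : IsFundamentalSolution l v u) : beta u 0 = Matrix.fromCols 1 0 := by
  rw [beta_eq, hu.initial, Matrix.mul_one]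

theorem gamma_zero (hu : IsFundamentalSolution l v u) : gamma u 0 = Matrix.fromCols 0 1 := by
  rw [gamma_eq, hu.initial, Matrix.mul_one]

/-- Unitarity supplies the right inverse: γ* satisfies γγ* = 1 and βγ* = 0. -/
theorem isDiracPair (hl : 0 ≤ l) (hu : IsFundamentalSolution l v u)
    (hv' : StronglyMeasurable v') (hM' : ∀ x, ‖v' x‖ ≤ M)
    (hvv' : v =ᵐ[volume.restrict (Ioo 0 l)] v') :
    IsDiracPair l M (fun x => matCLM (v' x)) (fun x => matCLM (v' x)ᴴ)
      (fun x => matCLM (beta u x)) (fun x => matCLM (gamma u x))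
      (fun x => matCLM (gamma u x)ᴴ) where
  measurable_v := continuous_matCLM.comp_stronglyMeasurable hv'
  measurable_w := (continuous_matCLM.comp
    continuous_id.matrix_conjTranspose).comp_stronglyMeasurable hv'
  norm_v_le x := by rw [LinearIsometryEquiv.norm_map]; exact hM' x
  norm_w_le x := by
    rw [LinearIsometryEquiv.norm_map, Matrix.l2_opNorm_conjTranspose]; exact hM' x
  continuousOn_b := continuous_matCLM.comp_continuousOn (continuousOn_beta hl hu)
  continuousOn_c := continuous_matCLM.comp_continuousOn (continuousOn_gamma hl hu)
  continuousOn_d := (continuous_matCLM.comp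
    continuous_id.matrix_conjTranspose).comp_continuousOn (continuousOn_gamma hl hu)
  eq_b x hx := by
    obtain ⟨hi, -⟩ := integrableOn_mul_continuousOn hv' hM' (continuousOn_gamma hl hu)
    have := ContinuousLinearMap.intervalIntegral_comp_comm
      (matCLM (m := Fin m₁) (n := Fin m₁ ⊕ Fin m₂)).toContinuousLinearEquiv.toContinuousLinearMap
      (intervalIntegrable_of_mem_Icc hi ⟨le_rfl, hl⟩ hx)
    rw [beta_eq_add_integral hl hu hv' hM' hvv' x hx, map_add]
    congr 1
    refine this.symm.trans ?_
    refine intervalIntegral.integral_congr fun t _ => matCLM_mul _ _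
  eq_c x hx := by
    have hw' : StronglyMeasurable fun x => (v' x)ᴴ :=
      continuous_id.matrix_conjTranspose.comp_stronglyMeasurable hv'
    obtain ⟨hi, -⟩ := integrableOn_mul_continuousOn hw'
      (fun x => (Matrix.l2_opNorm_conjTranspose (v' x)).trans_le (hM' x)) (continuousOn_beta hl hu)
    have := ContinuousLinearMap.intervalIntegral_comp_comm
      (matCLM (m := Fin m₂) (n := Fin m₁ ⊕ Fin m₂)).toContinuousLinearEquiv.toContinuousLinearMap
      (intervalIntegrable_of_mem_Icc hi.neg ⟨le_rfl, hl⟩ hx)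
    rw [gamma_eq_add_integral hl hu hv' hM' hvv' x hx, map_add]
    congr 1
    refine this.symm.trans ?_
    refine intervalIntegral.integral_congr fun t _ => ?_
    exact (map_neg matCLM _).trans (congrArg Neg.neg (matCLM_mul _ _))
  c_comp_d x hx := by
    rw [← matCLM_mul, gamma_mul_conjTranspose hl hu hx, matCLM_one]
  b_comp_d x hx := by
    rw [← matCLM_mul, beta_mul_conjTranspose_gamma hl hu hx, map_zero]

end Dirac

/-! ### Columns of matrix functions in L² -/

section Columns

theorem intervalIntegral_congr_ae_Ioo {E : Type*} [NormedAddCommGroup E] [NormedSpace ℝ E]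
    {f g : ℝ → E} {l : ℝ} (h : f =ᵐ[volume.restrict (Ioo 0 l)] g) {x : ℝ} (hx : x ∈ Icc 0 l) :
    ∫ t in (0 : ℝ)..x, f t = ∫ t in (0 : ℝ)..x, g t := by
  refine intervalIntegral.integral_congr_ae_restrict ?_
  rw [uIoc_of_le hx.1, restrict_Ioo_eq_restrict_Ioc.symm]
  exact ae_restrict_of_ae_restrict_of_subset (Ioo_subset_Ioo_right hx.2) h

variable {p q : ℕ} {μ : Measure ℝ}

theorem column_eq_of_ae_eq {Ψ : ℝ → Matrix (Fin p) (Fin q) ℂ} {k : Fin q}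
    {f : Lp (EuclideanSpace ℂ (Fin p)) 2 μ}
    (hf : f =ᵐ[μ] fun t => (WithLp.toLp 2 (fun i => Ψ t i k) : EuclideanSpace ℂ (Fin p))) :
    column μ Ψ k = f := by
  have hmem : MemLp (fun t => (WithLp.toLp 2 (fun i => Ψ t i k) : EuclideanSpace ℂ (Fin p))) 2 μ :=
    (memLp_congr_ae hf).1 (Lp.memLp f)
  rw [column, dif_pos hmem]
  exact Lp.ext (hmem.coeFn_toLp.trans hf.symm)

theorem column_coeFn {Ψ : ℝ → Matrix (Fin p) (Fin q) ℂ} {k : Fin q}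
    (hmem : MemLp (fun t => (WithLp.toLp 2 (fun i => Ψ t i k) : EuclideanSpace ℂ (Fin p))) 2 μ) :
    column μ Ψ k =ᵐ[μ] fun t => (WithLp.toLp 2 (fun i => Ψ t i k) : EuclideanSpace ℂ (Fin p)) := by
  rw [column, dif_pos hmem]
  exact hmem.coeFn_toLp

theorem toLp_column_eq {m n : Type*} [Fintype m] [Fintype n] [DecidableEq n] (A : Matrix m n ℂ)
    (k : n) : (WithLp.toLp 2 (fun i => A i k) : EuclideanSpace ℂ m) =
      matCLM A (WithLp.toLp 2 (Pi.single k 1)) := by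
  ext i
  rw [matCLM_apply]
  simp

theorem norm_toLp_column_le {m n : Type*} [Fintype m] [Fintype n] [DecidableEq n]
    (A : Matrix m n ℂ) (k : n) : ‖(WithLp.toLp 2 (fun i => A i k) : EuclideanSpace ℂ m)‖ ≤ ‖A‖ := by
  rw [toLp_column_eq]
  refine (ContinuousLinearMap.le_opNorm _ _).trans (le_of_eq ?_)
  rw [LinearIsometryEquiv.norm_map]
  simp

theorem continuous_toLp_column {m n : Type*} [Fintype m] [Fintype n] [DecidableEq n] (k : n) :
    Continuous fun A : Matrix m n ℂ => (WithLp.toLp 2 (fun i => A i k) : EuclideanSpace ℂ m) := by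
  simp only [toLp_column_eq]
  exact continuous_matCLM.clm_apply continuous_const

theorem memLp_column_of_bound [IsFiniteMeasure μ] {Ψ : ℝ → Matrix (Fin p) (Fin q) ℂ}
    (hΨ : AEStronglyMeasurable Ψ μ) {C : ℝ} (hC : ∀ᵐ x ∂μ, ‖Ψ x‖ ≤ C) (k : Fin q) :
    MemLp (fun t => (WithLp.toLp 2 (fun i => Ψ t i k) : EuclideanSpace ℂ (Fin p))) 2 μ := by
  refine MemLp.of_bound ((continuous_toLp_column k).comp_aestronglyMeasurable hΨ) C ?_
  filter_upwards [hC] with x hx using (norm_toLp_column_le _ _).trans hx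

end Columns

/-! ### Existence of a normalized similarity operator -/

section Existence

variable {m₁ m₂ : ℕ} {l M : ℝ} {v : ℝ → Matrix (Fin m₁) (Fin m₂) ℂ}
  {u : ℝ → ℂ → Matrix (Fin m₁ ⊕ Fin m₂) (Fin m₁ ⊕ Fin m₂) ℂ}

theorem exists_isIntegration (n : ℕ) (hl : 0 ≤ l) : ∃ A : L2 n l →L[ℂ] L2 n l, IsIntegration A := by
  obtain ⟨A, hA⟩ := exists_volterra_clm (H := EuclideanSpace ℂ (Fin n)) (l := l) (C := 1)
    (k := fun _ _ => (-Complex.I) • ContinuousLinearMap.id ℂ _) hl stronglyMeasurable_const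
    (fun _ _ _ _ => by
      rw [norm_smul, norm_neg, Complex.norm_I, one_mul]
      exact ContinuousLinearMap.norm_id_le) zero_le_one
  refine ⟨A, fun f => ?_⟩
  filter_upwards [hA f] with x hx
  rw [hx, ← intervalIntegral.integral_smul]
  rfl

theorem exists_isVolterra {n : ℕ} {ι : Type} [Fintype ι] [DecidableEq ι] (hl : 0 ≤ l)
    {F : ℝ → Matrix (Fin n) ι ℂ} {G : ℝ → Matrix ι (Fin n) ℂ} (hF : ContinuousOn F (Icc 0 l))
    (hG : ContinuousOn G (Icc 0 l)) : ∃ K : L2 n l →L[ℂ] L2 n l, IsVolterra F G K := by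
  let cl : ℝ → ℝ := fun x => max 0 (min x l)
  have hclc : Continuous cl := by fun_prop
  have hcl : ∀ x, cl x ∈ Icc 0 l := fun x => ⟨le_max_left _ _, max_le hl (min_le_right _ _)⟩
  have hcl' : ∀ x ∈ Icc 0 l, cl x = x := fun x hx => by simp [cl, hx.1, hx.2]
  obtain ⟨CF, hCF⟩ := isCompact_Icc.exists_bound_of_continuousOn hF
  obtain ⟨CG, hCG⟩ := isCompact_Icc.exists_bound_of_continuousOn hG
  have hCF0 : 0 ≤ CF := (norm_nonneg _).trans (hCF 0 ⟨le_rfl, hl⟩)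
  have hCG0 : 0 ≤ CG := (norm_nonneg _).trans (hCG 0 ⟨le_rfl, hl⟩)
  have hFc : Continuous fun x => F (cl x) := hF.comp_continuous hclc hcl
  have hGc : Continuous fun x => G (cl x) := hG.comp_continuous hclc hcl
  obtain ⟨K, hK⟩ := exists_volterra_clm (H := EuclideanSpace ℂ (Fin n)) (l := l) (C := CF * CG)
    (k := fun x t => Matrix.toEuclideanCLM (𝕜 := ℂ) (F (cl x) * G (cl t))) hl
    (by
      have : Continuous fun q : ℝ × ℝ => (matCLM (F (cl q.1) * G (cl q.2)) :
          EuclideanSpace ℂ (Fin n) →L[ℂ] EuclideanSpace ℂ (Fin n)) :=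
        continuous_matCLM.comp ((hFc.comp continuous_fst).matrix_mul (hGc.comp continuous_snd))
      exact this.stronglyMeasurable)
    (fun x _ t _ => by
      rw [Matrix.l2_opNorm_toEuclideanCLM]
      exact (Matrix.l2_opNorm_mul _ _).trans
        (mul_le_mul (hCF _ (hcl x)) (hCG _ (hcl t)) (norm_nonneg _) hCF0)) (by positivity)
  refine ⟨K, fun f => ?_⟩
  filter_upwards [hK f, ae_restrict_mem measurableSet_Ioo] with x hx hxm
  rw [hx]
  refine intervalIntegral.integral_congr fun t ht => ?_
  rw [uIcc_of_le hxm.1.le] at ht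
  rw [hcl' x (Ioo_subset_Icc_self hxm), hcl' t ⟨ht.1, ht.2.trans hxm.2.le⟩]

theorem exists_isNormalizedSimilarity (hl : 0 ≤ l) (hM0 : 0 ≤ M)
    (hv : AEStronglyMeasurable v (volume.restrict (Ioo 0 l)))
    (hM : ∀ x ∈ Ioo 0 l, ‖v x‖ ≤ M) (hu : IsFundamentalSolution l v u) :
    ∃ E : L2 m₂ l ≃L[ℂ] L2 m₂ l, IsNormalizedSimilarity (gamma u) E := by
  obtain ⟨v', hv'm, hv'M, hvv'⟩ := exists_stronglyMeasurable_bounded hM0 measurableSet_Ioo hv hM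
  have hD := isDiracPair hl hu hv'm hv'M hvv'
  obtain ⟨ε, π, hG⟩ := exists_isGoursatSolution hl hD.measurable_v hD.measurable_w
    hD.norm_v_le hD.norm_w_le
  obtain ⟨C, hC⟩ := hG.bounded_ε
  have hC0 : 0 ≤ C := (norm_nonneg _).trans (hC 0 0)
  have hkm : StronglyMeasurable (Function.uncurry fun x t => ε (x - t) t) :=
    hG.measurable_ε.comp_measurable (g := fun q : ℝ × ℝ => (q.1 - q.2, q.2)) (by fun_prop)
  obtain ⟨N, hN⟩ := exists_volterra_clm hl hkm (fun x _ t _ => hC (x - t) t) hC0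
  have hunit : IsUnit (1 + N) := isUnit_one_add_of_le_intervalIntegral hl hC0 N fun f => by
    filter_upwards [hN f, ae_restrict_mem measurableSet_Ioo] with x hx hxm
    rw [hx]
    exact norm_volterra_le (fun x _ t _ => hC (x - t) t) (integrableOn_Lp_two f) hxm
  obtain ⟨U, hU⟩ := hunit
  let E : L2 m₂ l ≃L[ℂ] L2 m₂ l := ContinuousLinearEquiv.ofUnit U
  have hEU : ∀ f, E f = f + N f := fun f => by
    change (U : L2 m₂ l →L[ℂ] L2 m₂ l) f = _
    rw [hU]; rfl
  have hEdiff : ∀ (f : L2 m₂ l) (g : ℝ → EuclideanSpace ℂ (Fin m₂)),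
      f =ᵐ[volume.restrict (Ioo 0 l)] g →
      ∀ᵐ x ∂volume.restrict (Ioo 0 l), E f x = g x + diffKernelOp ε g x := by
    intro f g hfg
    rw [hEU]
    filter_upwards [Lp.coeFn_add f (N f), hN f, hfg, ae_restrict_mem measurableSet_Ioo]
      with x h1 h2 h3 hxm
    rw [h1, Pi.add_apply, h2, h3, diffKernelOp]
    congr 1
    refine intervalIntegral_congr_ae_Ioo (l := l) ?_ (Ioo_subset_Icc_self hxm)
    filter_upwards [hfg] with t ht
    rw [ht]
  obtain ⟨A, hA⟩ := exists_isIntegration m₂ hl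
  have hGc : ContinuousOn (fun t => (-Complex.I) • (gamma u t)ᴴ) (Icc 0 l) :=
    (by fun_prop : Continuous fun X : Matrix (Fin m₂) (Fin m₁ ⊕ Fin m₂) ℂ =>
      (-Complex.I) • Xᴴ).comp_continuousOn (continuousOn_gamma hl hu)
  obtain ⟨K, hK⟩ := exists_isVolterra (F := gamma u) (G := fun t => (-Complex.I) • (gamma u t)ᴴ) hl
    (continuousOn_gamma hl hu) hGc
  -- This is E J = L E multiplied by -i; the factor is absorbed into `g`.
  have hKE : ∀ f, K (E f) = E (A f) := by
    intro f
    refine Lp.ext ?_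
    let g : ℝ → EuclideanSpace ℂ (Fin m₂) := fun t => (-Complex.I) • f t
    have hgm : StronglyMeasurable g := (Lp.stronglyMeasurable f).const_smul (-Complex.I)
    have hgi : IntegrableOn g (Ioc 0 l) := (integrableOn_Lp_two f).smul (-Complex.I)
    have hint := hD.goursat_intertwines hG hl hgm hgi
    rw [← restrict_Ioo_eq_restrict_Ioc] at hint
    have hAf : A f =ᵐ[volume.restrict (Ioo 0 l)] fun x => ∫ t in (0 : ℝ)..x, g t := by
      filter_upwards [hA f] with x hx
      rw [hx, ← intervalIntegral.integral_smul]
    filter_upwards [hint, hEdiff _ _ hAf, hK (E f), ae_restrict_mem measurableSet_Ioo]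
      with x h1 h2 h3 hxm
    have hx : x ∈ Icc 0 l := Ioo_subset_Icc_self hxm
    have hEg : IntegrableOn (fun t => g t + diffKernelOp ε g t) (Ioc 0 l) :=
      hgi.add (integrableOn_diffKernelOp hG.measurable_ε hC hgm hgi)
    rw [h2, h1, h3, ← ContinuousLinearMap.intervalIntegral_comp_comm _
      (intervalIntegrable_of_mem_Icc
        (integrableOn_continuousOn_clm_apply hD.continuousOn_d hEg) ⟨le_rfl, hl⟩ hx)]
    refine intervalIntegral_congr_ae_Ioo (l := l) ?_ hx
    filter_upwards [hEdiff f f Filter.EventuallyEq.rfl] with t ht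
    have hsm : g t + diffKernelOp ε g t = (-Complex.I) • (f t + diffKernelOp ε f t) := by
      simp only [g, diffKernelOp, smul_add, map_smul, intervalIntegral.integral_smul]
    rw [hsm, ← ht, toEuclideanCLM_eq_matCLM, matCLM_mul, map_smul, map_smul]
    simp
  -- E = 1 + N is triangular with ρ = 1, which is admissible because γ'γ* = 0.
  refine ⟨E, ⟨⟨⟨A, K, hA, hK, ?_⟩, ⟨fun _ => 1, fun x t => matCLM.symm (ε (x - t) t), ?_, ?_, ?_,
    ?_, ⟨C, fun x t => ?_⟩, fun f => ?_⟩⟩, ?_⟩⟩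
  · ext1 f
    have := hKE (E.symm f)
    rw [E.apply_symm_apply] at this
    exact this
  · exact (LipschitzWith.const (1 : Matrix (Fin m₂) (Fin m₂) ℂ)).lipschitzOnWith.absolutelyContinuousOnInterval
  · filter_upwards [deriv_gamma_mul_conjTranspose_gamma hl hu] with x hx
    rw [Matrix.mul_smul, hx]
    simpa using hasDerivAt_const x (1 : Matrix (Fin m₂) (Fin m₂) ℂ)
  · simp
  · exact matCLM.symm.continuous.comp_stronglyMeasurable hkm
  · rw [LinearIsometryEquiv.norm_map]; exact hC _ _
  · filter_upwards [hEdiff f f Filter.EventuallyEq.rfl] with x hx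
    rw [hx, map_one, diffKernelOp]
    simp only [toEuclideanCLM_eq_matCLM, LinearIsometryEquiv.apply_symm_apply]
    rfl
  -- A basis vector κ of the second block has γ(0)κ = e and β(0)κ = 0, so E sends the constant e to
  -- the corresponding column of γ₂.
  · have hcol : ∀ k : Fin m₂, (E.symm (column (volume.restrict (Ioo 0 l))
        (fun t => (gamma u t).toCols₂) k) : ℝ → EuclideanSpace ℂ (Fin m₂))
        =ᵐ[volume.restrict (Ioo 0 l)] fun _ => WithLp.toLp 2 (Pi.single k 1) := by
      intro k
      let e : EuclideanSpace ℂ (Fin m₂) := WithLp.toLp 2 (Pi.single k 1)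
      let κ : EuclideanSpace ℂ (Fin m₁ ⊕ Fin m₂) := WithLp.toLp 2 (Pi.single (Sum.inr k) 1)
      let f : L2 m₂ l := (memLp_const e).toLp _
      have hf : f =ᵐ[volume.restrict (Ioo 0 l)] fun _ => e := (memLp_const e).coeFn_toLp
      have hc : ∀ x, matCLM (gamma u x) κ =
          WithLp.toLp 2 (fun i => (gamma u x).toCols₂ i k) := fun x =>
        (toLp_column_eq (gamma u x) (Sum.inr k)).symm
      have hc0 : matCLM (gamma u 0) κ = e := by
        rw [hc, gamma_zero hu]
        ext i
        simp [e, Matrix.one_apply, Pi.single_apply]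
      have hb0 : matCLM (beta u 0) κ = 0 := by
        rw [← toLp_column_eq (beta u 0) (Sum.inr k), beta_zero hu]
        ext i
        simp
      have hgc := hD.goursat_const hG hl hb0
      rw [← restrict_Ioo_eq_restrict_Ioc] at hgc
      have : column (volume.restrict (Ioo 0 l)) (fun t => (gamma u t).toCols₂) k = E f := by
        refine column_eq_of_ae_eq ?_
        filter_upwards [hEdiff f _ hf, hgc] with x h1 h2
        rw [h1, ← hc, ← h2, hc0]
      rw [this, E.symm_apply_apply]
      exact hf
    filter_upwards [ae_all_iff.2 hcol] with x hx
    ext i k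
    have := congrArg (fun w : EuclideanSpace ℂ (Fin m₂) => w i) (hx k)
    simpa [applyColumns, Matrix.one_apply, Pi.single_apply] using this

end Existence

/-! ### Compressions by a coisometry whose kernel is invariant -/

section Compression

variable {X Y : Type*} [NormedAddCommGroup X] [InnerProductSpace ℂ X] [CompleteSpace X]
  [NormedAddCommGroup Y] [InnerProductSpace ℂ Y] [CompleteSpace Y]

open ContinuousLinearMap

theorem apply_adjoint_apply {P : X →L[ℂ] Y} (hP : P ∘L adjoint P = 1) (y : Y) :
    P (adjoint P y) = y := DFunLike.congr_fun hP y

/-- If `T` preserves `ker P`, with `P` a coisometry, then `P T = P T P* P`. -/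
theorem comp_adjoint_comp_of_ker {P : X →L[ℂ] Y} (hP : P ∘L adjoint P = 1) {T : X →L[ℂ] X}
    (hT : ∀ f, P f = 0 → P (T f) = 0) (f : X) : P (T (adjoint P (P f))) = P (T f) := by
  have h : P (f - adjoint P (P f)) = 0 := by
    rw [map_sub, apply_adjoint_apply hP, sub_self]
  have h2 := hT _ h
  rw [map_sub, map_sub, sub_eq_zero] at h2
  exact h2.symm

/-- T* preserves the orthogonal complement of ker P, which is the range of P*, and P*P is the
identity there. -/
theorem adjoint_adjoint_apply_of_ker {P : X →L[ℂ] Y} (hP : P ∘L adjoint P = 1) {T : X →L[ℂ] X}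
    (hT : ∀ f, P f = 0 → P (T f) = 0) (y : Y) :
    adjoint P (P (adjoint T (adjoint P y))) = adjoint T (adjoint P y) := by
  refine ext_inner_right ℂ fun f => ?_
  rw [adjoint_inner_left, ← adjoint_inner_right P, adjoint_inner_left, adjoint_inner_left,
    adjoint_inner_left, adjoint_inner_left, comp_adjoint_comp_of_ker hP hT]

/-- The projection P*P may be dropped after E*P*, so E* cancels against its inverse; it may also be
dropped under P E⁻¹. The choice d = E P*y gives a right inverse of the compression, and d = a column
of v* evaluates S_x⁻¹Φ₁'. -/
theorem compression_mul_compression {P : X →L[ℂ] Y} (hP : P ∘L adjoint P = 1) (E : X ≃L[ℂ] X)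
    (hE : ∀ f, P f = 0 → P (E f) = 0) (hE' : ∀ f, P f = 0 → P (E.symm f) = 0) (d : X) :
    (P ∘L ((E.symm : X →L[ℂ] X) ∘L adjoint (E.symm : X →L[ℂ] X)) ∘L adjoint P)
      (P (adjoint (E : X →L[ℂ] X) (adjoint P (P d)))) = P (E.symm d) := by
  have hinv : ∀ y, adjoint (E.symm : X →L[ℂ] X) (adjoint (E : X →L[ℂ] X) y) = y := by
    intro y
    refine ext_inner_right ℂ fun f => ?_
    rw [adjoint_inner_left, adjoint_inner_left]
    simp
  simp only [comp_apply]
  rw [adjoint_adjoint_apply_of_ker hP (T := (E : X →L[ℂ] X)) hE, hinv]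
  exact comp_adjoint_comp_of_ker hP (T := (E.symm : X →L[ℂ] X)) hE' d

theorem isUnit_compression {P : X →L[ℂ] Y} (hP : P ∘L adjoint P = 1) (E : X ≃L[ℂ] X)
    (hE : ∀ f, P f = 0 → P (E f) = 0) (hE' : ∀ f, P f = 0 → P (E.symm f) = 0) :
    IsUnit (P ∘L ((E.symm : X →L[ℂ] X) ∘L adjoint (E.symm : X →L[ℂ] X)) ∘L adjoint P) := by
  set S := P ∘L ((E.symm : X →L[ℂ] X) ∘L adjoint (E.symm : X →L[ℂ] X)) ∘L adjoint P with hS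
  let R : Y →L[ℂ] Y :=
    P ∘L adjoint (E : X →L[ℂ] X) ∘L adjoint P ∘L P ∘L (E : X →L[ℂ] X) ∘L adjoint P
  have hSR : S * R = 1 := by
    ext1 y
    have := compression_mul_compression hP E hE hE' (E (adjoint P y))
    rw [E.symm_apply_apply, apply_adjoint_apply hP] at this
    exact this
  -- Both S and R are self-adjoint, so taking adjoints turns the right inverse into a left inverse.
  have hSa : adjoint S = S := by
    simp only [hS, adjoint_comp, adjoint_adjoint, ContinuousLinearMap.comp_assoc]
  have hRa : adjoint R = R := by
    simp only [R, adjoint_comp, adjoint_adjoint, ContinuousLinearMap.comp_assoc]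
  have hRS : R * S = 1 := by
    have h := congrArg adjoint hSR
    change adjoint (S ∘L R) = adjoint 1 at h
    rw [adjoint_comp, hSa, hRa] at h
    refine Eq.trans h ?_
    exact star_one (Y →L[ℂ] Y)
  exact ⟨⟨S, R, hSR, hRS⟩, rfl⟩

theorem ringInverse_apply_eq {S : Y →L[ℂ] Y} (hS : IsUnit S) {x y : Y} (h : S x = y) :
    Ring.inverse S y = x := by
  rw [← h]
  exact DFunLike.congr_fun (Ring.inverse_mul_cancel S hS) x

/-- Since T*P* stays in the range of P*, the outer projection is invisible and T* moves across the
inner product uncompressed. -/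
theorem inner_compression {P : X →L[ℂ] Y} (hP : P ∘L adjoint P = 1) {T : X →L[ℂ] X}
    (hT : ∀ f, P f = 0 → P (T f) = 0) (d g : X) :
    inner ℂ (P (adjoint T (adjoint P (P d)))) (P g) = inner ℂ (P d) (P (T g)) := by
  rw [← adjoint_inner_left P, adjoint_adjoint_apply_of_ker hP hT, adjoint_inner_left,
    adjoint_inner_left]

end Compression

/-! ### The restriction P_x as a coisometry -/

section Restriction

variable {n : ℕ} {l x : ℝ}

theorem restrict_restrict_Ioo (hx : x ∈ Icc 0 l) :
    (volume.restrict (Ioo 0 l)).restrict (Ioo 0 x) = (volume.restrict (Ioo 0 x) : Measure ℝ) := by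
  rw [Measure.restrict_restrict measurableSet_Ioo,
    inter_eq_self_of_subset_left (Ioo_subset_Ioo_right hx.2)]

theorem opP_coeFn (f : L2 n l) :
    opP n l x f =ᵐ[(volume.restrict (Ioo 0 l)).restrict (Ioo 0 x)] f :=
  LpToLpRestrictCLM_coeFn ℂ (Ioo 0 x) f

theorem opP_eq_zero_iff (hx : x ∈ Icc 0 l) (f : L2 n l) :
    opP n l x f = 0 ↔ ∀ᵐ t ∂volume.restrict (Ioc 0 x), f t = 0 := by
  rw [Lp.eq_zero_iff_ae_eq_zero, ← restrict_Ioo_eq_restrict_Ioc, ← restrict_restrict_Ioo hx]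
  constructor
  · intro h
    filter_upwards [h, opP_coeFn (x := x) f] with t h1 h2
    rw [← h2, h1]; rfl
  · intro h
    filter_upwards [h, opP_coeFn (x := x) f] with t h1 h2
    rw [h2, h1]; rfl

theorem opP_comp_adjoint : opP n l x ∘L ContinuousLinearMap.adjoint (opP n l x) = 1 := by
  ext1 g
  have hmem : MemLp ((Ioo 0 x).indicator g) 2 (volume.restrict (Ioo 0 l)) :=
    (memLp_indicator_iff_restrict measurableSet_Ioo).2 (Lp.memLp g)
  -- The adjoint of restriction is extension by zero.
  have key : ContinuousLinearMap.adjoint (opP n l x) g = hmem.toLp _ := by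
    refine ext_inner_right ℂ fun f => ?_
    have h1 : ∀ᵐ t ∂(volume.restrict (Ioo 0 l)).restrict (Ioo 0 x),
        inner ℂ (g t) (opP n l x f t) = inner ℂ (g t) (f t) := by
      filter_upwards [opP_coeFn (x := x) f] with t ht
      rw [ht]
    rw [ContinuousLinearMap.adjoint_inner_left, L2.inner_def, L2.inner_def, integral_congr_ae h1,
      ← integral_indicator measurableSet_Ioo]
    refine integral_congr_ae ?_
    filter_upwards [hmem.coeFn_toLp] with t ht
    rw [ht]
    by_cases htx : t ∈ Ioo 0 x
    · simp [indicator_of_mem htx]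
    · simp [indicator_of_notMem htx]
  change opP n l x (ContinuousLinearMap.adjoint (opP n l x) g) = g
  rw [key]
  refine Lp.ext ?_
  filter_upwards [opP_coeFn (x := x) (hmem.toLp _), ae_restrict_of_ae hmem.coeFn_toLp,
    ae_restrict_mem measurableSet_Ioo] with t h1 h2 h3
  rw [h1, h2, indicator_of_mem h3]

end Restriction

/-- If `c(0) κ = 0` then `c κ = -L (w b(0) κ)` with `L = c J d`. -/
theorem IsDiracPair.c_apply_eq_neg {H₁ H₂ K : Type*} [NormedAddCommGroup H₁] [NormedSpace ℂ H₁]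
    [CompleteSpace H₁] [NormedAddCommGroup H₂] [NormedSpace ℂ H₂] [CompleteSpace H₂]
    [NormedAddCommGroup K] [NormedSpace ℂ K] [CompleteSpace K]
    {l M : ℝ} {v : ℝ → H₂ →L[ℂ] H₁} {w : ℝ → H₁ →L[ℂ] H₂}
    {b : ℝ → K →L[ℂ] H₁} {c : ℝ → K →L[ℂ] H₂} {d : ℝ → H₂ →L[ℂ] K}
    (h : IsDiracPair l M v w b c d) (hl : 0 ≤ l) {κ : K} (hκ : c 0 κ = 0) :
    ∀ᵐ x ∂volume.restrict (Ioc 0 l),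
      c x κ = -c x (∫ t in (0 : ℝ)..x, d t (w t (b 0 κ))) := by
  have h0 : (0 : ℝ) ∈ Icc 0 l := ⟨le_rfl, hl⟩
  have hf : IntegrableOn (fun t => w t (b 0 κ)) (Ioc 0 l) :=
    integrableOn_clm_apply h.measurable_w h.norm_w_le (integrable_const _)
  have hdf := integrableOn_continuousOn_clm_apply h.continuousOn_d hf
  have hci : IntegrableOn (fun x => c x κ) (Ioc 0 l) :=
    integrableOn_continuousOn_clm_apply h.continuousOn_c (integrable_const κ)
  have hvci : IntegrableOn (fun t => v t (c t κ)) (Ioc 0 l) :=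
    integrableOn_clm_apply h.measurable_v h.norm_v_le hci
  have hwvi : IntegrableOn (fun s => w s (∫ t in (0 : ℝ)..s, v t (c t κ))) (Ioc 0 l) :=
    integrableOn_clm_apply h.measurable_w h.norm_w_le (integrableOn_primitive hl hvci)
  -- Both sides solve (1 + J w J v) y = -J w b(0) κ.
  refine IsDiracPair.ae_eq_of_volterra_eq hl h.measurable_v h.measurable_w h.norm_v_le h.norm_w_le
    (r := fun x => -∫ t in (0 : ℝ)..x, w t (b 0 κ)) hci
    (integrableOn_continuousOn_clm_apply h.continuousOn_c (integrableOn_primitive hl hdf)).neg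
    (fun x hx => ?_) (fun x hx => ?_)
  · rw [h.eq_c x hx, add_apply, hκ, zero_add, ContinuousLinearMap.intervalIntegral_apply
      (intervalIntegrable_of_mem_Icc h.integrable_wb h0 hx), ← neg_add',
      ← intervalIntegral.integral_add (intervalIntegrable_of_mem_Icc hf h0 hx)
        (intervalIntegrable_of_mem_Icc hwvi h0 hx), ← intervalIntegral.integral_neg]
    refine intervalIntegral.integral_congr fun s hs => ?_
    rw [uIcc_of_le hx.1] at hs
    have hs' : s ∈ Icc 0 l := ⟨hs.1, hs.2.trans hx.2⟩
    simp only [neg_apply, ContinuousLinearMap.comp_apply]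
    rw [h.eq_b s hs', add_apply, ContinuousLinearMap.intervalIntegral_apply
      (intervalIntegrable_of_mem_Icc h.integrable_vc h0 hs'), map_add]
    rfl
  · have key : ∫ s in (0 : ℝ)..x, w s (∫ t in (0 : ℝ)..s,
          v t (-c t (∫ r in (0 : ℝ)..t, d r (w r (b 0 κ))))) =
        -∫ s in (0 : ℝ)..x, w s (b s (∫ r in (0 : ℝ)..s, d r (w r (b 0 κ)))) := by
      rw [← intervalIntegral.integral_neg]
      refine intervalIntegral.integral_congr fun s hs => ?_
      rw [uIcc_of_le hx.1] at hs
      simp only [map_neg, intervalIntegral.integral_neg]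
      rw [h.b_apply_integral hf ⟨hs.1, hs.2.trans hx.2⟩]
    rw [key, h.c_apply_integral hf hx]
    abel

/-! ### Causality of E and of its inverse -/

section Similarity

variable {m₁ m₂ : ℕ} {l M : ℝ} {v v' : ℝ → Matrix (Fin m₁) (Fin m₂) ℂ}
  {u : ℝ → ℂ → Matrix (Fin m₁ ⊕ Fin m₂) (Fin m₁ ⊕ Fin m₂) ℂ} {E : L2 m₂ l ≃L[ℂ] L2 m₂ l}

/-- ρ is a constant invertible matrix R, so E is R plus a bounded Volterra operator. Solving for f
through R⁻¹ bounds f by Ef and its own past, a form ready for Gronwall; no kernel for E⁻¹ is needed.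
-/
theorem IsNormalizedSimilarity.exists_bounds (hl : 0 ≤ l) (hu : IsFundamentalSolution l v u)
    (hE : IsNormalizedSimilarity (gamma u) E) : ∃ C : ℝ, 0 ≤ C ∧
      (∀ f, ∀ᵐ x ∂volume.restrict (Ioo 0 l),
        ‖E f x‖ ≤ C * (‖f x‖ + ∫ t in (0 : ℝ)..x, ‖f t‖)) ∧
      (∀ f, ∀ᵐ x ∂volume.restrict (Ioo 0 l),
        ‖f x‖ ≤ C * (‖E f x‖ + ∫ t in (0 : ℝ)..x, ‖f t‖)) := by
  obtain ⟨ρ, k, hρac, hρd, hρ0, hkm, ⟨C, hC⟩, hEf⟩ := hE.isSimilarity.triangular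
  have hder : ∀ᵐ x, x ∈ uIcc 0 l → HasDerivAt ρ 0 x := by
    rw [← ae_restrict_iff' measurableSet_uIcc, uIcc_of_le hl, ← restrict_Ioo_eq_restrict_Icc]
    filter_upwards [hρd, deriv_gamma_mul_conjTranspose_gamma hl hu] with x hx hx'
    rw [Matrix.mul_smul, hx'] at hx
    simpa using hx
  obtain ⟨R, hR⟩ := hρac.const_of_ae_hasDerivAt_zero hder
  have hR0 : R.det ≠ 0 := by rw [← hR 0 (by simp)]; exact hρ0
  have hRu : IsUnit R.det := isUnit_iff_ne_zero.2 hR0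
  have hC0 : 0 ≤ C := (norm_nonneg _).trans (hC 0 0)
  have hkC : ∀ x ∈ Ioo 0 l, ∀ t ∈ Ioo 0 l, ‖Matrix.toEuclideanCLM (𝕜 := ℂ) (k x t)‖ ≤ C :=
    fun x _ t _ => by rw [Matrix.l2_opNorm_toEuclideanCLM]; exact hC x t
  have hform : ∀ f, ∀ᵐ x ∂volume.restrict (Ioo 0 l), ∃ y : EuclideanSpace ℂ (Fin m₂),
      E f x = matCLM R (f x) + y ∧ ‖y‖ ≤ C * ∫ t in (0 : ℝ)..x, ‖f t‖ := by
    intro f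
    filter_upwards [hEf f, ae_restrict_mem measurableSet_Ioo] with x hx hxm
    refine ⟨_, ?_, norm_volterra_le hkC (integrableOn_Lp_two f) hxm⟩
    rw [hx, hR x (by rw [uIcc_of_le hl]; exact Ioo_subset_Icc_self hxm), toEuclideanCLM_eq_matCLM]
  have hI : ∀ f : L2 m₂ l, ∀ x ∈ Ioo 0 l, 0 ≤ ∫ t in (0 : ℝ)..x, ‖f t‖ := fun f x hx =>
    intervalIntegral.integral_nonneg hx.1.le fun _ _ => norm_nonneg _
  -- One constant dominating the four coefficients that occur in the two estimates.
  set B := ‖R‖ + C + ‖R⁻¹‖ + ‖R⁻¹‖ * C with hB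
  have b1 : ‖R‖ ≤ B := by
    have : 0 ≤ ‖R⁻¹‖ := norm_nonneg _
    nlinarith [mul_nonneg this hC0]
  have b2 : C ≤ B := by
    have : 0 ≤ ‖R⁻¹‖ := norm_nonneg _
    nlinarith [mul_nonneg this hC0, norm_nonneg R]
  have b3 : ‖R⁻¹‖ ≤ B := by
    have : 0 ≤ ‖R⁻¹‖ := norm_nonneg _
    nlinarith [mul_nonneg this hC0, norm_nonneg R]
  have b4 : ‖R⁻¹‖ * C ≤ B := by
    have : 0 ≤ ‖R⁻¹‖ := norm_nonneg _
    linarith [norm_nonneg R]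
  refine ⟨B, hC0.trans b2, fun f => ?_, fun f => ?_⟩
  · filter_upwards [hform f, ae_restrict_mem measurableSet_Ioo] with x ⟨y, hy, hyC⟩ hxm
    rw [hy, mul_add]
    refine (norm_add_le _ _).trans (add_le_add ?_
      (hyC.trans (mul_le_mul_of_nonneg_right b2 (hI f x hxm))))
    refine (ContinuousLinearMap.le_opNorm _ _).trans ?_
    rw [LinearIsometryEquiv.norm_map]
    exact mul_le_mul_of_nonneg_right b1 (norm_nonneg _)
  · filter_upwards [hform f, ae_restrict_mem measurableSet_Ioo] with x ⟨y, hy, hyC⟩ hxm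
    have hfx : f x = matCLM R⁻¹ (E f x) - matCLM R⁻¹ y := by
      rw [← map_sub, hy, add_sub_cancel_right, ← ContinuousLinearMap.comp_apply, ← matCLM_mul,
        Matrix.nonsing_inv_mul R hRu, matCLM_one]
      rfl
    rw [hfx, mul_add]
    refine (norm_sub_le _ _).trans (add_le_add ?_ ?_)
    · refine (ContinuousLinearMap.le_opNorm _ _).trans ?_
      rw [LinearIsometryEquiv.norm_map]
      exact mul_le_mul_of_nonneg_right b3 (norm_nonneg _)
    · refine (ContinuousLinearMap.le_opNorm _ _).trans ?_
      rw [LinearIsometryEquiv.norm_map]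
      refine (mul_le_mul_of_nonneg_left hyC (norm_nonneg _)).trans ?_
      rw [← mul_assoc]
      exact mul_le_mul_of_nonneg_right b4 (hI f x hxm)

theorem IsNormalizedSimilarity.opP_apply_eq_zero (hl : 0 ≤ l) (hu : IsFundamentalSolution l v u)
    (hE : IsNormalizedSimilarity (gamma u) E) {x : ℝ} (hx : x ∈ Icc 0 l) (f : L2 m₂ l)
    (hf : opP m₂ l x f = 0) : opP m₂ l x (E f) = 0 := by
  obtain ⟨C, hC, h1, -⟩ := hE.exists_bounds hl hu
  have hsub := ae_restrict_of_ae_restrict_of_subset (Ioo_subset_Ioo_right hx.2) (h1 f)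
  rw [opP_eq_zero_iff hx] at hf ⊢
  rw [← restrict_Ioo_eq_restrict_Ioc] at hf ⊢
  filter_upwards [hsub, hf, ae_restrict_mem measurableSet_Ioo] with t ht ht0 htm
  have : ∫ s in (0 : ℝ)..t, ‖f s‖ = 0 := by
    rw [intervalIntegral_congr_ae_Ioo (l := x) (g := fun _ => 0) _ (Ioo_subset_Icc_self htm)]
    · simp
    · filter_upwards [hf] with s hs
      rw [hs, norm_zero]
  rw [this, ht0, norm_zero, add_zero, mul_zero] at ht
  exact norm_le_zero_iff.1 ht

/-- Where f vanishes on (0, x), the norm of E⁻¹f is bounded there by a multiple of its own integral,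
so Gronwall forces it to be zero. -/
theorem IsNormalizedSimilarity.opP_symm_apply_eq_zero (hl : 0 ≤ l)
    (hu : IsFundamentalSolution l v u) (hE : IsNormalizedSimilarity (gamma u) E) {x : ℝ}
    (hx : x ∈ Icc 0 l) (f : L2 m₂ l) (hf : opP m₂ l x f = 0) : opP m₂ l x (E.symm f) = 0 := by
  obtain ⟨C, hC, -, h2⟩ := hE.exists_bounds hl hu
  have hsub := ae_restrict_of_ae_restrict_of_subset (Ioo_subset_Ioo_right hx.2) (h2 (E.symm f))
  rw [E.apply_symm_apply] at hsub
  rw [opP_eq_zero_iff hx] at hf ⊢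
  have hsub' : ∀ᵐ t ∂volume.restrict (Ioc 0 x),
      ‖E.symm f t‖ ≤ C * (‖f t‖ + ∫ s in (0 : ℝ)..t, ‖E.symm f s‖) := by
    rw [← restrict_Ioo_eq_restrict_Ioc]
    exact hsub
  have := ae_eq_zero_of_le_intervalIntegral (h := fun t => ‖E.symm f t‖) hC
    ((integrableOn_Lp_two (E.symm f)).mono_set (Ioc_subset_Ioc_right hx.2)).norm
    (Filter.Eventually.of_forall fun _ => norm_nonneg _) (by
      filter_upwards [hsub', hf] with t ht ht0
      rwa [ht0, norm_zero, zero_add] at ht)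
  filter_upwards [this] with t ht using norm_eq_zero.1 ht

/-- The integral term in the bound for E⁻¹f is finite because L² embeds in L¹. This is what makes
Φ₁' = -E⁻¹v* bounded. -/
theorem IsNormalizedSimilarity.symm_bounded (hl : 0 ≤ l)
    (hu : IsFundamentalSolution l v u) (hE : IsNormalizedSimilarity (gamma u) E) {f : L2 m₂ l}
    {B : ℝ} (hf : ∀ᵐ x ∂volume.restrict (Ioo 0 l), ‖f x‖ ≤ B) :
    ∃ D, ∀ᵐ x ∂volume.restrict (Ioo 0 l), ‖E.symm f x‖ ≤ D := by
  obtain ⟨C, hC, -, h2⟩ := hE.exists_bounds hl hu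
  have h := h2 (E.symm f)
  rw [E.apply_symm_apply] at h
  refine ⟨C * (B + ∫ t in (0 : ℝ)..l, ‖E.symm f t‖), ?_⟩
  filter_upwards [h, hf, ae_restrict_mem measurableSet_Ioo] with x hx hfx hxm
  refine hx.trans (mul_le_mul_of_nonneg_left (add_le_add hfx ?_) hC)
  exact intervalIntegral.integral_mono_interval le_rfl hxm.1.le hxm.2.le
    (Filter.Eventually.of_forall fun t => norm_nonneg _)
    (intervalIntegrable_of_mem_Icc (integrableOn_Lp_two _).norm ⟨le_rfl, hl⟩ ⟨hl, le_rfl⟩)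

theorem column_conjTranspose_coeFn (hv' : StronglyMeasurable v') (hM' : ∀ x, ‖v' x‖ ≤ M)
    (i : Fin m₁) : column (volume.restrict (Ioo 0 l)) (fun t => (v' t)ᴴ) i
      =ᵐ[volume.restrict (Ioo 0 l)] fun t => (WithLp.toLp 2 (fun a => (v' t)ᴴ a i)) :=
  column_coeFn (memLp_column_of_bound
    (continuous_id.matrix_conjTranspose.comp_stronglyMeasurable hv').aestronglyMeasurable
    (Filter.Eventually.of_forall fun x =>
      (Matrix.l2_opNorm_conjTranspose (v' x)).trans_le (hM' x)) i)

theorem column_gamma_coeFn (hl : 0 ≤ l) (hu : IsFundamentalSolution l v u) {q : ℕ}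
    (e : Fin q → Fin m₁ ⊕ Fin m₂) (i : Fin q) :
    column (volume.restrict (Ioo 0 l)) (fun t => (gamma u t).submatrix id e) i
      =ᵐ[volume.restrict (Ioo 0 l)] fun t => (WithLp.toLp 2 (fun a => gamma u t a (e i))) := by
  obtain ⟨C, hC⟩ := isCompact_Icc.exists_bound_of_continuousOn (continuousOn_gamma hl hu)
  refine column_coeFn (Ψ := fun t => (gamma u t).submatrix id e) (k := i) ?_
  refine MemLp.of_bound ((continuous_toLp_column (e i)).comp_aestronglyMeasurable
    (((continuousOn_gamma hl hu).mono Ioo_subset_Icc_self).aestronglyMeasurable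
      measurableSet_Ioo)) C ?_
  filter_upwards [ae_restrict_mem measurableSet_Ioo] with x hx
  exact (norm_toLp_column_le (gamma u x) (e i)).trans (hC x (Ioo_subset_Icc_self hx))

/-- `E⁻¹ γ₁ = -J E⁻¹ v*`, columnwise. -/
theorem IsNormalizedSimilarity.symm_column_gamma (hl : 0 ≤ l) (hu : IsFundamentalSolution l v u)
    (hE : IsNormalizedSimilarity (gamma u) E) (hv' : StronglyMeasurable v')
    (hM' : ∀ x, ‖v' x‖ ≤ M) (hvv' : v =ᵐ[volume.restrict (Ioo 0 l)] v') (i : Fin m₁) :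
    ∀ᵐ x ∂volume.restrict (Ioo 0 l),
      E.symm (column (volume.restrict (Ioo 0 l)) (fun t => (gamma u t).toCols₁) i) x =
        -∫ t in (0 : ℝ)..x,
          E.symm (column (volume.restrict (Ioo 0 l)) (fun t => (v' t)ᴴ) i) t := by
  obtain ⟨A, K, hA, hK, hKE⟩ := hE.isSimilarity.similar
  set d := column (volume.restrict (Ioo 0 l)) (fun t => (v' t)ᴴ) i with hd
  set g := column (volume.restrict (Ioo 0 l)) (fun t => (gamma u t).toCols₁) i with hg
  have hdc := column_conjTranspose_coeFn (l := l) hv' hM' i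
  have hgc : g =ᵐ[volume.restrict (Ioo 0 l)]
      fun t => (WithLp.toLp 2 (fun a => gamma u t a (Sum.inl i))) :=
    column_gamma_coeFn hl hu Sum.inl i
  have hP := isDiracPair hl hu hv' hM' hvv'
  let κ : EuclideanSpace ℂ (Fin m₁ ⊕ Fin m₂) := WithLp.toLp 2 (Pi.single (Sum.inl i) 1)
  have hc0 : matCLM (gamma u 0) κ = 0 := by
    rw [← toLp_column_eq (gamma u 0) (Sum.inl i), gamma_zero hu]
    ext a
    simp
  have hb0 : matCLM (beta u 0) κ = WithLp.toLp 2 (Pi.single i 1) := by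
    rw [← toLp_column_eq (beta u 0) (Sum.inl i), beta_zero hu]
    ext a
    simp [Matrix.one_apply, Pi.single_apply]
  have hneg := hP.c_apply_eq_neg hl hc0
  rw [← restrict_Ioo_eq_restrict_Ioc] at hneg
  -- Columnwise γ₁ = -L v*, since γ₁(0) = 0 and the first block of β(0) is I; the factor i comes
  -- from K = -iL.
  have hKd : K d = Complex.I • g := by
    refine Lp.ext ?_
    filter_upwards [hK d, hneg, hgc, Lp.coeFn_smul Complex.I g,
      ae_restrict_mem measurableSet_Ioo] with x h1 h2 h3 h4 hxm
    have hx : x ∈ Icc 0 l := Ioo_subset_Icc_self hxm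
    have hf : IntegrableOn (fun t => matCLM (v' t)ᴴ (matCLM (beta u 0) κ)) (Ioc 0 l) :=
      integrableOn_clm_apply hP.measurable_w hP.norm_w_le (integrable_const _)
    have hdf := integrableOn_continuousOn_clm_apply hP.continuousOn_d hf
    rw [h4, Pi.smul_apply, h3, toLp_column_eq (gamma u x) (Sum.inl i), h2, h1, smul_neg,
      ← neg_smul, ← map_smul, ← intervalIntegral.integral_smul,
      ← ContinuousLinearMap.intervalIntegral_comp_comm]
    · refine intervalIntegral_congr_ae_Ioo (l := l) ?_ hx
      filter_upwards [hdc] with t ht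
      rw [ht, toLp_column_eq, hb0, toEuclideanCLM_eq_matCLM, matCLM_mul, map_smul]
      rfl
    · exact (intervalIntegrable_of_mem_Icc hdf ⟨le_rfl, hl⟩ hx).smul (-Complex.I)
  have hAg : E.symm g = (-Complex.I) • A (E.symm d) := by
    have h : K d = E (A (E.symm d)) := by rw [hKE]; rfl
    rw [hKd] at h
    have h' := congrArg E.symm h
    rw [E.symm_apply_apply, map_smul] at h'
    rw [← h', smul_smul]
    simp
  filter_upwards [hA (E.symm d), Lp.coeFn_smul (-Complex.I) (A (E.symm d))] with x h1 h2
  rw [hAg, h2, Pi.smul_apply, h1, smul_smul]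
  simp

end Similarity

/-! ### Entrywise integration and columnwise operators -/

section MatrixFunctions

theorem integrable_matrix_of_entry {m n : Type*} [Fintype m] [Fintype n] [DecidableEq m]
    [DecidableEq n] {μ : Measure ℝ} {F : ℝ → Matrix m n ℂ}
    (h : ∀ i j, Integrable (fun t => F t i j) μ) : Integrable F μ := by
  have hF : F = fun t => ∑ i, ∑ j, F t i j • (Matrix.single i j 1 : Matrix m n ℂ) := by
    funext t
    conv_lhs => rw [Matrix.matrix_eq_sum_single (F t)]
    simp [Matrix.smul_single]
  rw [hF]
  exact integrable_finsetSum _ fun i _ => integrable_finsetSum _ fun j _ =>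
    (h i j).smul_const _

theorem intervalIntegral_matrix_apply {m n : Type*} [Fintype m] [Fintype n]
    [DecidableEq n] {F : ℝ → Matrix m n ℂ} {a b : ℝ} (hF : IntervalIntegrable F volume a b)
    (i : m) (j : n) : (∫ t in a..b, F t) i j = ∫ t in a..b, F t i j :=
  ((entryCLM i j).intervalIntegral_comp_comm hF).symm

theorem intervalIntegral_eq_neg_of_entry {m n : Type*} [Fintype m] [Fintype n] [DecidableEq m]
    [DecidableEq n] {F G : ℝ → Matrix m n ℂ} {l x : ℝ} (hx : x ∈ Icc 0 l)
    (hG : IntervalIntegrable G volume 0 x)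
    (h : ∀ i j, Integrable (fun t => F t i j) ((volume.restrict (Ioo 0 l)).restrict (Ioo 0 x)) ∧
      ∫ t, F t i j ∂((volume.restrict (Ioo 0 l)).restrict (Ioo 0 x)) =
        -∫ t, G t i j ∂((volume.restrict (Ioo 0 l)).restrict (Ioo 0 x))) :
    IntervalIntegrable F volume 0 x ∧ ∫ t in (0 : ℝ)..x, F t = -∫ t in (0 : ℝ)..x, G t := by
  rw [restrict_restrict_Ioo hx, restrict_Ioo_eq_restrict_Ioc] at h
  have hF : IntervalIntegrable F volume 0 x :=
    (intervalIntegrable_iff_integrableOn_Ioc_of_le hx.1).2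
      (integrable_matrix_of_entry fun i j => (h i j).1)
  refine ⟨hF, ?_⟩
  ext i j
  rw [Matrix.neg_apply, intervalIntegral_matrix_apply hF, intervalIntegral_matrix_apply hG,
    intervalIntegral.integral_of_le hx.1, intervalIntegral.integral_of_le hx.1]
  exact (h i j).2

/-- The matrix with given columns, as a continuous linear map. -/
noncomputable def ofColumnsCLM (p q : ℕ) :
    (Fin q → EuclideanSpace ℂ (Fin p)) →L[ℂ] Matrix (Fin p) (Fin q) ℂ :=
  LinearMap.toContinuousLinearMap
    { toFun := fun f => Matrix.of fun i k => f k i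
      map_add' := fun _ _ => rfl
      map_smul' := fun _ _ => rfl }

variable {p q : ℕ} {μ : Measure ℝ}
  (T : Lp (EuclideanSpace ℂ (Fin p)) 2 μ →L[ℂ] Lp (EuclideanSpace ℂ (Fin p)) 2 μ)
  (Ψ : ℝ → Matrix (Fin p) (Fin q) ℂ)

theorem applyColumns_eq_ofColumnsCLM :
    applyColumns T Ψ = fun t => ofColumnsCLM p q fun k => T (column μ Ψ k) t := rfl

theorem stronglyMeasurable_applyColumns : StronglyMeasurable (applyColumns T Ψ) := by
  rw [applyColumns_eq_ofColumnsCLM]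
  refine (ofColumnsCLM p q).continuous.comp_stronglyMeasurable ?_
  exact (measurable_pi_lambda _ fun k => (Lp.stronglyMeasurable _).measurable).stronglyMeasurable

variable {T Ψ} in
theorem applyColumns_bounded
    (h : ∀ k, ∃ D, ∀ᵐ x ∂μ, ‖T (column μ Ψ k) x‖ ≤ D) :
    ∃ C, 0 ≤ C ∧ ∀ᵐ x ∂μ, ‖applyColumns T Ψ x‖ ≤ C := by
  choose D hD using h
  have hD0 : 0 ≤ ∑ k, |D k| := Finset.sum_nonneg fun k _ => abs_nonneg _
  refine ⟨‖ofColumnsCLM p q‖ * ∑ k, |D k|, by positivity, ?_⟩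
  filter_upwards [ae_all_iff.2 hD] with x hx
  rw [applyColumns_eq_ofColumnsCLM]
  refine (ContinuousLinearMap.le_opNorm _ _).trans
    (mul_le_mul_of_nonneg_left ?_ (norm_nonneg _))
  refine (pi_norm_le_iff_of_nonneg hD0).2 fun k => (hx k).trans ((le_abs_self _).trans ?_)
  exact Finset.single_le_sum (f := fun k => |D k|) (fun k _ => abs_nonneg _) (Finset.mem_univ k)

end MatrixFunctions

/-! ### Regularity of Φ₁ and its derivative -/

section PhiOne

variable {m₁ m₂ : ℕ} {l M : ℝ} {v v' : ℝ → Matrix (Fin m₁) (Fin m₂) ℂ}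
  {u : ℝ → ℂ → Matrix (Fin m₁ ⊕ Fin m₂) (Fin m₁ ⊕ Fin m₂) ℂ} {E : L2 m₂ l ≃L[ℂ] L2 m₂ l}
  {Φ₁ : ℝ → Matrix (Fin m₂) (Fin m₁) ℂ}

/-- `E⁻¹ v*`, columnwise. -/
noncomputable def symmPotential (v' : ℝ → Matrix (Fin m₁) (Fin m₂) ℂ)
    (E : L2 m₂ l ≃L[ℂ] L2 m₂ l) : ℝ → Matrix (Fin m₂) (Fin m₁) ℂ :=
  applyColumns (E.symm : L2 m₂ l →L[ℂ] L2 m₂ l) (fun t => (v' t)ᴴ)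

theorem IsNormalizedSimilarity.symmPotential_bounded (hl : 0 ≤ l)
    (hu : IsFundamentalSolution l v u) (hE : IsNormalizedSimilarity (gamma u) E)
    (hv' : StronglyMeasurable v') (hM' : ∀ x, ‖v' x‖ ≤ M) :
    ∃ C, 0 ≤ C ∧ ∀ᵐ x ∂volume.restrict (Ioo 0 l), ‖symmPotential v' E x‖ ≤ C := by
  refine applyColumns_bounded fun k => hE.symm_bounded hl hu (B := M) ?_
  filter_upwards [column_conjTranspose_coeFn (l := l) hv' hM' k] with x hx
  rw [hx]
  exact (norm_toLp_column_le _ _).trans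
    ((Matrix.l2_opNorm_conjTranspose (v' x)).trans_le (hM' x))

theorem IsNormalizedSimilarity.integrableOn_symmPotential (hl : 0 ≤ l)
    (hu : IsFundamentalSolution l v u) (hE : IsNormalizedSimilarity (gamma u) E)
    (hv' : StronglyMeasurable v') (hM' : ∀ x, ‖v' x‖ ≤ M) :
    IntegrableOn (symmPotential v' E) (Ioc 0 l) := by
  obtain ⟨C, hC, hb⟩ := hE.symmPotential_bounded hl hu hv' hM'
  rw [restrict_Ioo_eq_restrict_Ioc] at hb
  exact Integrable.mono' (g := fun _ => C) (integrable_const _)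
    (stronglyMeasurable_applyColumns _ _).aestronglyMeasurable hb

theorem IsNormalizedSimilarity.applyColumns_gamma (hl : 0 ≤ l)
    (hu : IsFundamentalSolution l v u) (hE : IsNormalizedSimilarity (gamma u) E)
    (hv' : StronglyMeasurable v') (hM' : ∀ x, ‖v' x‖ ≤ M)
    (hvv' : v =ᵐ[volume.restrict (Ioo 0 l)] v') :
    ∀ᵐ x ∂volume.restrict (Ioo 0 l), ∫ t in (0 : ℝ)..x, -symmPotential v' E t =
      applyColumns (E.symm : L2 m₂ l →L[ℂ] L2 m₂ l) (fun t => (gamma u t).toCols₁) x := by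
  have hi := (hE.integrableOn_symmPotential hl hu hv' hM').neg
  filter_upwards [ae_all_iff.2 (hE.symm_column_gamma hl hu hv' hM' hvv'),
    ae_restrict_mem measurableSet_Ioo] with x hx hxm
  have h0 : (0 : ℝ) ∈ Icc 0 l := ⟨le_rfl, hl⟩
  have hxc : x ∈ Icc 0 l := Ioo_subset_Icc_self hxm
  ext i k
  refine (intervalIntegral_matrix_apply (intervalIntegrable_of_mem_Icc hi h0 hxc) i k).trans ?_
  have h1 := congrArg (fun w : EuclideanSpace ℂ (Fin m₂) => w i) (hx k)
  refine Eq.trans ?_ h1.symm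
  have h2 := (EuclideanSpace.proj (𝕜 := ℂ) i).intervalIntegral_comp_comm
    (intervalIntegrable_of_mem_Icc
      (integrableOn_Lp_two (E.symm (column (volume.restrict (Ioo 0 l)) (fun t => (v' t)ᴴ) k)))
      h0 hxc)
  change _ = -(EuclideanSpace.proj (𝕜 := ℂ) i (∫ t in (0 : ℝ)..x, _))
  rw [← h2, ← intervalIntegral.integral_neg]
  rfl

theorem IsNormalizedSimilarity.lipschitzOnWith_primitive_symmPotential (hl : 0 ≤ l)
    (hu : IsFundamentalSolution l v u) (hE : IsNormalizedSimilarity (gamma u) E)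
    (hv' : StronglyMeasurable v') (hM' : ∀ x, ‖v' x‖ ≤ M) :
    ∃ C, LipschitzOnWith C (fun x => ∫ t in (0 : ℝ)..x, -symmPotential v' E t) (Icc 0 l) := by
  obtain ⟨C, hC, hb⟩ := hE.symmPotential_bounded hl hu hv' hM'
  exact ⟨_, lipschitzOnWith_primitive hC (hE.integrableOn_symmPotential hl hu hv' hM').neg
    (by simpa only [norm_neg] using hb)⟩

theorem IsNormalizedSimilarity.isPhiOne_primitive (hl : 0 ≤ l)
    (hu : IsFundamentalSolution l v u) (hE : IsNormalizedSimilarity (gamma u) E)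
    (hv' : StronglyMeasurable v') (hM' : ∀ x, ‖v' x‖ ≤ M)
    (hvv' : v =ᵐ[volume.restrict (Ioo 0 l)] v') :
    IsPhiOne (gamma u) E fun x => ∫ t in (0 : ℝ)..x, -symmPotential v' E t := by
  obtain ⟨C, hlip⟩ := hE.lipschitzOnWith_primitive_symmPotential hl hu hv' hM'
  refine ⟨hE.applyColumns_gamma hl hu hv' hM' hvv', ?_, C, fun x hx => ?_⟩
  · exact LipschitzOnWith.absolutelyContinuousOnInterval (by rwa [uIcc_of_le hl])
  · exact norm_deriv_le_of_lipschitzOn (Icc_mem_nhds hx.1 hx.2) hlip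

/-- Φ₁ is prescribed only almost everywhere, but it and the primitive of -E⁻¹v* are continuous, so
they agree on the whole open interval and share their derivatives. -/
theorem IsPhiOne.deriv_ae_eq (hl : 0 ≤ l)
    (hu : IsFundamentalSolution l v u) (hE : IsNormalizedSimilarity (gamma u) E)
    (hv' : StronglyMeasurable v') (hM' : ∀ x, ‖v' x‖ ≤ M)
    (hvv' : v =ᵐ[volume.restrict (Ioo 0 l)] v') (hΦ : IsPhiOne (gamma u) E Φ₁) :
    ∀ᵐ x ∂volume.restrict (Ioo 0 l), deriv Φ₁ x = -symmPotential v' E x := by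
  obtain ⟨C, hlip⟩ := hE.lipschitzOnWith_primitive_symmPotential hl hu hv' hM'
  have hi := (hE.integrableOn_symmPotential hl hu hv' hM').neg
  have hae : Φ₁ =ᵐ[volume.restrict (Ioo 0 l)]
      fun x => ∫ t in (0 : ℝ)..x, -symmPotential v' E t := by
    filter_upwards [hΦ.eq_ae, hE.applyColumns_gamma hl hu hv' hM' hvv'] with x h1 h2
    rw [h1, h2]
  have hc := hΦ.boundedlyDifferentiable.1.continuousOn
  rw [uIcc_of_le hl] at hc
  have heq := Measure.eqOn_open_of_ae_eq hae isOpen_Ioo (hc.mono Ioo_subset_Icc_self)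
    (hlip.continuousOn.mono Ioo_subset_Icc_self)
  have h1 := ((intervalIntegrable_iff_integrableOn_Ioc_of_le hl).2 hi).ae_hasDerivAt_integral
  filter_upwards [ae_restrict_of_ae h1, ae_restrict_mem measurableSet_Ioo] with x hx hxm
  have h2 : Φ₁ =ᶠ[nhds x] fun x => ∫ t in (0 : ℝ)..x, -symmPotential v' E t :=
    heq.eventuallyEq_of_mem (isOpen_Ioo.mem_nhds hxm)
  rw [h2.deriv_eq]
  exact (hx (by rw [uIcc_of_le hl]; exact Ioo_subset_Icc_self hxm) 0 (by simp)).deriv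

/-- [Φ₁ I] = E⁻¹γ: the definition of Φ₁ and the normalization are combined so that both blocks are
treated alike later. -/
theorem IsPhiOne.exists_apply_eq_column (hl : 0 ≤ l) (hu : IsFundamentalSolution l v u)
    (hE : IsNormalizedSimilarity (gamma u) E) (hΦ : IsPhiOne (gamma u) E Φ₁)
    (κ : Fin m₁ ⊕ Fin m₂) : ∃ f : L2 m₂ l,
      (E f =ᵐ[volume.restrict (Ioo 0 l)] fun t => WithLp.toLp 2 (fun a => gamma u t a κ)) ∧
      ∀ᵐ t ∂volume.restrict (Ioo 0 l), ∀ a, f t a =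
        Matrix.fromCols (Φ₁ t) (1 : Matrix (Fin m₂) (Fin m₂) ℂ) a κ := by
  rcases κ with i | k
  · refine ⟨E.symm (column (volume.restrict (Ioo 0 l)) (fun t => (gamma u t).toCols₁) i), ?_, ?_⟩
    · rw [E.apply_symm_apply]
      exact column_gamma_coeFn hl hu Sum.inl i
    · filter_upwards [hΦ.eq_ae] with t ht a
      rw [Matrix.fromCols_apply_inl, ht]
      rfl
  · refine ⟨E.symm (column (volume.restrict (Ioo 0 l)) (fun t => (gamma u t).toCols₂) k), ?_, ?_⟩
    · rw [E.apply_symm_apply]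
      exact column_gamma_coeFn hl hu Sum.inr k
    · filter_upwards [hE.normalized] with t ht a
      rw [Matrix.fromCols_apply_inr, ← ht]
      rfl

theorem IsPhiOne.column_deriv (hl : 0 ≤ l)
    (hu : IsFundamentalSolution l v u) (hE : IsNormalizedSimilarity (gamma u) E)
    (hv' : StronglyMeasurable v') (hM' : ∀ x, ‖v' x‖ ≤ M)
    (hvv' : v =ᵐ[volume.restrict (Ioo 0 l)] v') (hΦ : IsPhiOne (gamma u) E Φ₁) (x : ℝ)
    (i : Fin m₁) :
    column ((volume.restrict (Ioo 0 l)).restrict (Ioo 0 x)) (deriv Φ₁) i =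
      -opP m₂ l x (E.symm (column (volume.restrict (Ioo 0 l)) (fun t => (v' t)ᴴ) i)) := by
  refine column_eq_of_ae_eq ?_
  filter_upwards [ae_restrict_of_ae (hΦ.deriv_ae_eq hl hu hE hv' hM' hvv'),
    opP_coeFn (x := x) (E.symm (column (volume.restrict (Ioo 0 l)) (fun t => (v' t)ᴴ) i)),
    Lp.coeFn_neg
      (opP m₂ l x (E.symm (column (volume.restrict (Ioo 0 l)) (fun t => (v' t)ᴴ) i)))]
    with t h1 h2 h3
  rw [h3, Pi.neg_apply, h2, h1]
  rfl

end PhiOne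

/-! ### Recovery of β -/

section Recovery

variable {m₁ m₂ : ℕ} {l M : ℝ} {v v' : ℝ → Matrix (Fin m₁) (Fin m₂) ℂ}
  {u : ℝ → ℂ → Matrix (Fin m₁ ⊕ Fin m₂) (Fin m₁ ⊕ Fin m₂) ℂ} {E : L2 m₂ l ≃L[ℂ] L2 m₂ l}
  {Φ₁ : ℝ → Matrix (Fin m₂) (Fin m₁) ℂ}

theorem IsNormalizedSimilarity.isUnit_opSx (hl : 0 ≤ l) (hu : IsFundamentalSolution l v u)
    (hE : IsNormalizedSimilarity (gamma u) E) {x : ℝ} (hx : x ∈ Icc 0 l) :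
    IsUnit (opSx (opS E) x) :=
  isUnit_compression opP_comp_adjoint E (hE.opP_apply_eq_zero hl hu hx)
    (hE.opP_symm_apply_eq_zero hl hu hx)

/-- S_x sends the right-hand side to -P_x E⁻¹v*, by `compression_mul_compression` with d a column of
v*, and this is P_x Φ₁'. -/
theorem IsPhiOne.inverse_column_deriv (hl : 0 ≤ l)
    (hu : IsFundamentalSolution l v u) (hE : IsNormalizedSimilarity (gamma u) E)
    (hv' : StronglyMeasurable v') (hM' : ∀ x, ‖v' x‖ ≤ M)
    (hvv' : v =ᵐ[volume.restrict (Ioo 0 l)] v') (hΦ : IsPhiOne (gamma u) E Φ₁) {x : ℝ}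
    (hx : x ∈ Icc 0 l) (i : Fin m₁) :
    Ring.inverse (opSx (opS E) x)
        (column ((volume.restrict (Ioo 0 l)).restrict (Ioo 0 x)) (deriv Φ₁) i) =
      -opP m₂ l x (ContinuousLinearMap.adjoint (E : L2 m₂ l →L[ℂ] L2 m₂ l)
        (ContinuousLinearMap.adjoint (opP m₂ l x) (opP m₂ l x
          (column (volume.restrict (Ioo 0 l)) (fun t => (v' t)ᴴ) i)))) := by
  refine ringInverse_apply_eq (hE.isUnit_opSx hl hu hx) ?_
  rw [map_neg, hΦ.column_deriv hl hu hE hv' hM' hvv']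
  exact congrArg Neg.neg (compression_mul_compression opP_comp_adjoint E
    (hE.opP_apply_eq_zero hl hu hx) (hE.opP_symm_apply_eq_zero hl hu hx) _)

/-- The integrand is the pointwise inner product of a column of S_x⁻¹Φ₁' with a column of P_x E⁻¹γ,
hence integrable. Moving E* to the second factor cancels E⁻¹ and leaves minus the pairing of v* with
γ on (0, x). -/
theorem IsPhiOne.entry_integral (hl : 0 ≤ l)
    (hu : IsFundamentalSolution l v u) (hE : IsNormalizedSimilarity (gamma u) E)
    (hv' : StronglyMeasurable v') (hM' : ∀ x, ‖v' x‖ ≤ M)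
    (hvv' : v =ᵐ[volume.restrict (Ioo 0 l)] v') (hΦ : IsPhiOne (gamma u) E Φ₁) {x : ℝ}
    (hx : x ∈ Icc 0 l) (i : Fin m₁) (κ : Fin m₁ ⊕ Fin m₂) :
    Integrable (fun t => ((applyColumns (Ring.inverse (opSx (opS E) x)) (deriv Φ₁) t)ᴴ *
      Matrix.fromCols (Φ₁ t) (1 : Matrix (Fin m₂) (Fin m₂) ℂ)) i κ)
      ((volume.restrict (Ioo 0 l)).restrict (Ioo 0 x)) ∧
    ∫ t, ((applyColumns (Ring.inverse (opSx (opS E) x)) (deriv Φ₁) t)ᴴ *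
        Matrix.fromCols (Φ₁ t) (1 : Matrix (Fin m₂) (Fin m₂) ℂ)) i κ
        ∂((volume.restrict (Ioo 0 l)).restrict (Ioo 0 x)) =
      -∫ t, (v' t * gamma u t) i κ ∂((volume.restrict (Ioo 0 l)).restrict (Ioo 0 x)) := by
  obtain ⟨f, hEf, hf⟩ := hΦ.exists_apply_eq_column hl hu hE κ
  have hy := hΦ.inverse_column_deriv hl hu hE hv' hM' hvv' hx i
  have hinner : (fun t => ((applyColumns (Ring.inverse (opSx (opS E) x)) (deriv Φ₁) t)ᴴ *
      Matrix.fromCols (Φ₁ t) (1 : Matrix (Fin m₂) (Fin m₂) ℂ)) i κ)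
      =ᵐ[(volume.restrict (Ioo 0 l)).restrict (Ioo 0 x)] fun t => inner ℂ
        (Ring.inverse (opSx (opS E) x)
          (column ((volume.restrict (Ioo 0 l)).restrict (Ioo 0 x)) (deriv Φ₁) i) t)
        (opP m₂ l x f t) := by
    filter_upwards [ae_restrict_of_ae hf, opP_coeFn (x := x) f] with t h1 h2
    rw [h2, PiLp.inner_apply, Matrix.mul_apply]
    refine Finset.sum_congr rfl fun a _ => ?_
    rw [h1 a, mul_comm]
    rfl
  refine ⟨(integrable_congr hinner).2 (L2.integrable_inner _ _), ?_⟩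
  rw [integral_congr_ae hinner, ← L2.inner_def, hy, inner_neg_left, inner_compression
    opP_comp_adjoint (T := (E : L2 m₂ l →L[ℂ] L2 m₂ l)) (hE.opP_apply_eq_zero hl hu hx),
    L2.inner_def]
  congr 1
  refine integral_congr_ae ?_
  filter_upwards [opP_coeFn (x := x) (column (volume.restrict (Ioo 0 l)) (fun t => (v' t)ᴴ) i),
    opP_coeFn (x := x) (E f), ae_restrict_of_ae hEf,
    ae_restrict_of_ae (column_conjTranspose_coeFn (l := l) hv' hM' i)] with t h1 h2 h3 h4
  rw [h1, h4]
  refine (congrArg (inner ℂ _) (h2.trans h3)).trans ?_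
  rw [PiLp.inner_apply, Matrix.mul_apply]
  refine Finset.sum_congr rfl fun a _ => ?_
  simp [mul_comm]

theorem IsPhiOne.beta_eq_sub_integral (hl : 0 ≤ l)
    (hu : IsFundamentalSolution l v u) (hE : IsNormalizedSimilarity (gamma u) E)
    (hv' : StronglyMeasurable v') (hM' : ∀ x, ‖v' x‖ ≤ M)
    (hvv' : v =ᵐ[volume.restrict (Ioo 0 l)] v') (hΦ : IsPhiOne (gamma u) E Φ₁) {x : ℝ}
    (hx : x ∈ Icc 0 l) :
    IntervalIntegrable (fun t =>
      (applyColumns (Ring.inverse (opSx (opS E) x)) (deriv Φ₁) t)ᴴ *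
        Matrix.fromCols (Φ₁ t) (1 : Matrix (Fin m₂) (Fin m₂) ℂ)) volume 0 x ∧
    beta u x = Matrix.fromCols 1 0 -
      ∫ t in (0 : ℝ)..x,
        (applyColumns (Ring.inverse (opSx (opS E) x)) (deriv Φ₁) t)ᴴ *
          Matrix.fromCols (Φ₁ t) (1 : Matrix (Fin m₂) (Fin m₂) ℂ) := by
  have hG := intervalIntegrable_of_mem_Icc
    (integrableOn_mul_continuousOn hv' hM' (continuousOn_gamma hl hu)).1 ⟨le_rfl, hl⟩ hx
  obtain ⟨hF, heq⟩ := intervalIntegral_eq_neg_of_entry hx hG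
    (hΦ.entry_integral hl hu hE hv' hM' hvv' hx)
  refine ⟨hF, ?_⟩
  rw [heq, beta_eq_add_integral hl hu hv' hM' hvv' x hx, beta_zero hu, sub_neg_eq_add]

end Recovery

end SkewDirac

theorem mainTheorem10 (m₁ m₂ : ℕ) (l M : ℝ) (hl : 0 < l)
    (v : ℝ → Matrix (Fin m₁) (Fin m₂) ℂ)
    (hv : AEStronglyMeasurable v (volume.restrict (Ioo 0 l)))
    (hM : ∀ x ∈ Ioo 0 l, ‖v x‖ ≤ M)
    (u : ℝ → ℂ → Matrix (Fin m₁ ⊕ Fin m₂) (Fin m₁ ⊕ Fin m₂) ℂ)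
    (hu : IsFundamentalSolution l v u) :
    (∃ E : L2 m₂ l ≃L[ℂ] L2 m₂ l, IsNormalizedSimilarity (gamma u) E) ∧
    ∀ E : L2 m₂ l ≃L[ℂ] L2 m₂ l, IsNormalizedSimilarity (gamma u) E →
      (∃ Φ₁ : ℝ → Matrix (Fin m₂) (Fin m₁) ℂ, IsPhiOne (gamma u) E Φ₁) ∧
      ∀ Φ₁ : ℝ → Matrix (Fin m₂) (Fin m₁) ℂ, IsPhiOne (gamma u) E Φ₁ →
        ∀ x ∈ Icc 0 l,
          IsUnit (opSx (opS E) x) ∧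
          IntervalIntegrable (fun t =>
            (applyColumns (Ring.inverse (opSx (opS E) x)) (deriv Φ₁) t)ᴴ *
              Matrix.fromCols (Φ₁ t) (1 : Matrix (Fin m₂) (Fin m₂) ℂ)) volume 0 x ∧
          beta u x = Matrix.fromCols 1 0 -
            ∫ t in (0 : ℝ)..x,
              (applyColumns (Ring.inverse (opSx (opS E) x)) (deriv Φ₁) t)ᴴ *
                Matrix.fromCols (Φ₁ t) (1 : Matrix (Fin m₂) (Fin m₂) ℂ) := by
  -- The bound holds only inside the open interval, so its midpoint serves to show that `M` is
  -- nonnegative.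
  have hM0 : 0 ≤ M := (norm_nonneg _).trans (hM (l / 2) ⟨by linarith, by linarith⟩)
  obtain ⟨v', hv', hM', hvv'⟩ := exists_stronglyMeasurable_bounded hM0 measurableSet_Ioo hv hM
  refine ⟨exists_isNormalizedSimilarity hl.le hM0 hv hM hu, fun E hE => ⟨⟨_,
    hE.isPhiOne_primitive hl.le hu hv' hM' hvv'⟩, fun Φ₁ hΦ x hx =>
    ⟨hE.isUnit_opSx hl.le hu hx, hΦ.beta_eq_sub_integral hl.le hu hE hv' hM' hvv' hx⟩⟩⟩
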